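/- Let $\rho\ge 0$, $r\ge 0$ and let $l,b:\mathbb R\to\mathbb R$ be measurable even functions for which there are constants $c_1,c_2,c_3>0$ such that, for all $\xi\in\mathbb R$, $$c_1^2(1+\xi^2)^{\rho/2}\le l(\xi)\le c_2^2(1+\xi^2)^{\rho/2},\qquad 0<b(\xi)\le c_3^2(1+\xi^2)^{-r/2}.$$ Let $L$ and $B$ be the operators with symbols $l$ and $b$, i.e. $\widehat{Lv}=l\,\widehat v$ and $\widehat{Bv}=b\,\widehat v$, where $\widehat v(\xi)=\int_{\mathbb R} e^{-i\xi x}v(x)\,dx$, and let $H^s=H^s(\mathbb R)$ be the $L^2$-based Sobolev space with norm $\|v\|_s^2=\int_{\mathbb R}(1+\xi^2)^s|\widehat v(\xi)|^2\,d\xi$, consisting of tempered distributions. Assume that $\frac{\rho}{2}+r\ge 1$, that $s>\frac12$, that $\varphi\in H^s$ and $\psi\in H^{s-1-\rho/2}$ are real, and that $g:\mathbb R\to\mathbb R$ is of class $C^{[s]+1}$, where $[s]$ is the integer part of $s$. Then there is some $T>0$ such that the Cauchy problem $$u_{tt}-Lu_{xx}=B(g(u))_{xx},\quad x\in\mathbb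 R,\ t>0,\qquad u(x,0)=\varphi(x),\quad u_t(x,0)=\psi(x),$$ has a unique real solution on $[0,T]$ in the class $$C([0,T],H^s)\cap C^1([0,T],H^{s-1-\rho/2}).$$ Here the equation is understood, for each $t\in(0,T]$, as an identity of tempered distributions in $x$: $u_{tt}(t)$ is the time derivative of $u_t$ in the space of tempered distributions (one-sided at $t=T$), and $B(g(u))_{xx}$ is $B$ applied to the distribution $(g(u))_{xx}$. -/

import Mathlib

open MeasureTheory Set FourierTransform
open scoped SchwartzMap

namespace NonlocalWave

/-- The tempered distribution `f` is (integration against) the function `w`. Integrability against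
every Schwartz function makes `w` locally integrable, so `w` is determined by `f` almost
everywhere. -/
def IsGivenBy (f : 𝓢'(ℝ, ℂ)) (w : ℝ → ℂ) : Prop :=
  ∀ η : 𝓢(ℝ, ℂ), Integrable (fun x ↦ η x * w x) ∧ f η = ∫ x, η x * w x

/-- A tempered distribution is real if it takes real values on real test functions. -/
def IsReal (f : 𝓢'(ℝ, ℂ)) : Prop :=
  ∀ η : 𝓢(ℝ, ℂ), (∀ x, (η x).im = 0) → (f η).im = 0

/-- The second distributional derivative `f_xx`. -/
noncomputable def dxx (f : 𝓢'(ℝ, ℂ)) : 𝓢'(ℝ, ℂ) :=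
  TemperedDistribution.derivCLM ℂ (TemperedDistribution.derivCLM ℂ f)

/-- `h = P f`, where `P` is the pseudodifferential operator with symbol `m`, that is
`(P f)^(ξ) = m(ξ) f^(ξ)` with `f^(ξ) = ∫ exp(-iξx) f(x) dx`, for a distribution `f` whose Fourier
transform is a function. Mathlib's `𝓕` uses `exp(-2πiξx)`, so its frequency `ξ` corresponds to the
frequency `2πξ` in the symbol. -/
def IsMultiplierImage (m : ℝ → ℝ) (f h : 𝓢'(ℝ, ℂ)) : Prop :=
  ∃ w : ℝ → ℂ, IsGivenBy (𝓕 f) w ∧ IsGivenBy (𝓕 h) (fun ξ ↦ (m (2 * Real.pi * ξ) : ℂ) * w ξ)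

/-- `F = g(f)` as a distribution: `f` is a real-valued function `v` and `F` is the function
`x ↦ g (v x)`. -/
def IsSuperposition (g : ℝ → ℝ) (f F : 𝓢'(ℝ, ℂ)) : Prop :=
  ∃ v : ℝ → ℝ, IsGivenBy f (fun x ↦ (v x : ℂ)) ∧ IsGivenBy F (fun x ↦ (g (v x) : ℂ))

/-- On `[0, T]` the curve `u` takes values in `H^s` and `U` is the curve of its images under the
Bessel potential of order `s`, which identifies `H^s` isometrically with `L²`
(up to an equivalent norm, this is `‖u‖_s² = ∫ (1 + ξ²)^s |u^(ξ)|² dξ`). -/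
def IsSobolevLift (s T : ℝ) (u : ℝ → 𝓢'(ℝ, ℂ)) (U : ℝ → Lp ℂ 2 (volume : Measure ℝ)) : Prop :=
  ∀ t ∈ Icc 0 T, TemperedDistribution.besselPotential ℝ ℂ s (u t) = (U t : 𝓢'(ℝ, ℂ))

/-- `u ∈ C([0, T], H^s)`. -/
def IsContinuousInto (s T : ℝ) (u : ℝ → 𝓢'(ℝ, ℂ)) : Prop :=
  ∃ U : ℝ → Lp ℂ 2 (volume : Measure ℝ), IsSobolevLift s T u U ∧ ContinuousOn U (Icc 0 T)

/-- `u ∈ C¹([0, T], H^s)` with time derivative `ut` (one-sided at the end points). -/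
def IsC1Into (s T : ℝ) (u ut : ℝ → 𝓢'(ℝ, ℂ)) : Prop :=
  ∃ U V : ℝ → Lp ℂ 2 (volume : Measure ℝ), IsSobolevLift s T u U ∧ IsSobolevLift s T ut V ∧
    (∀ t ∈ Icc 0 T, HasDerivWithinAt U (V t) (Icc 0 T) t) ∧ ContinuousOn V (Icc 0 T)

/-- `u_tt - L u_xx = B (g(u))_xx` at time `t`, as an identity of tempered distributions in `x`,
where `L` and `B` have the symbols `l` and `b`, `ut` is the time derivative of `u`, and
`u_tt` is the time derivative of `ut` in the space of tempered distributions. -/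
def SatisfiesEquationAt (l b g : ℝ → ℝ) (T : ℝ) (u ut : ℝ → 𝓢'(ℝ, ℂ)) (t : ℝ) : Prop :=
  ∃ Lu G BG : 𝓢'(ℝ, ℂ),
    IsMultiplierImage l (dxx (u t)) Lu ∧
    IsSuperposition g (u t) G ∧
    IsMultiplierImage b (dxx G) BG ∧
    ∀ η : 𝓢(ℝ, ℂ), HasDerivWithinAt (fun τ ↦ ut τ η) (Lu η + BG η) (Icc 0 T) t

/-- `u` is a real solution in `C([0, T], H^s) ∩ C¹([0, T], H^(s - 1 - ρ/2))` of the Cauchy problem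
`u_tt - L u_xx = B (g(u))_xx`, `u(0) = φ`, `u_t(0) = ψ`. -/
def IsSolution (l b g : ℝ → ℝ) (ρ s : ℝ) (φ ψ : 𝓢'(ℝ, ℂ)) (T : ℝ) (u : ℝ → 𝓢'(ℝ, ℂ)) : Prop :=
  (∀ t ∈ Icc 0 T, IsReal (u t)) ∧
  IsContinuousInto s T u ∧
  ∃ ut : ℝ → 𝓢'(ℝ, ℂ), IsC1Into (s - 1 - ρ / 2) T u ut ∧
    u 0 = φ ∧ ut 0 = ψ ∧ ∀ t ∈ Ioc 0 T, SatisfiesEquationAt l b g T u ut t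

end NonlocalWave

/-! Local well-posedness of `u_tt - L u_xx = B (g(u))_xx` in `H^s`, `s > 1/2`.

Write `κ = 1 + ρ/2` and `ω(ξ) = |2πξ| √l(2πξ)`, a quantity of the order of the weight
`(1 + ξ²)^(κ/2)` for `|ξ| ≥ 1`. On the Fourier side the equation is the oscillator
`A'' + ω² A = -(1 + ξ²)^(κ/2) q N(A)`, where `N(A)` is the Fourier transform of `g(u) - g(0)` (the
constant `g(0)` is annihilated by `∂ₓ²`) and `q` is the symbol of `-B ∂ₓ²` divided by the weight.
Both velocity and forcing lose `κ` derivatives, but one time integration against `sin(tω)/ω` gains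
them back, and `ρ/2 + r ≥ 1` is what makes `q` bounded (`dispersion_waveFreq`). Variation of constants,
`A = cos(tω) P + σ(t) R` with the bounded symbol `σ(t) = (1 + ξ²)^(κ/2) sin(tω)/ω`, turns the equation
into the ordinary differential equation `P' = σ q N(A)`, `R' = -cos(tω) q N(A)` with bounded operators
(`Dispersion.hasDerivWithinAt_position`, `Dispersion.hasDerivWithinAt_velocity`, and conversely
`Dispersion.hasDerivWithinAt_coefficients`).

For `g` of class `C^([s]+1)` the map `u ↦ g(u) - g(0)` is bounded on bounded subsets of `H^s`
(`superposeBounded`), but it need not be Lipschitz there. The contraction argument is therefore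
carried out in the norm of `L²`, on a set that is bounded in `H^s`: such sets are closed in `L²`
(`isClosed_weightedLe`), and by the Sobolev embedding `u` is bounded on them, so that `g` may be
truncated to a globally Lipschitz function, which acts as a Lipschitz map on `L²`
(`Dispersion.exists_solution`). Since `P'` and `R'` are bounded in `H^s`, the curves `P` and `R` are
Lipschitz into `H^s` (`exists_continuousOn_lift`); this gives the continuity of `u` and `u_t` in time.

The bound on `g(u)` is proved for real Schwartz functions and extended by density. It goes by
induction on `[s]`: for `s < 1` a Lipschitz function does not increase the Gagliardo seminorm by more
than a constant; for `1 ≤ s < 2` the derivative `g'(u) u'` is estimated in the Gagliardo seminorm of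
order `s - 1`, using that `g'(u)` is Hölder continuous; for `s ≥ 2` one uses that `H^(s-1)` is an
algebra.

For uniqueness, any solution in the class is bounded in `H^s`, hence in the supremum norm, and its
coefficients solve the same truncated ordinary differential equation in `L²`
(`IsSolution.exists_coefficients`), to which Gronwall's inequality applies (`IsSolution.eq`). -/

namespace NonlocalWave
open Filter Topology

/-! ### Multiplication operators on `L²` -/

/-- The Hilbert space `L²(ℝ; ℂ)`. -/
noncomputable abbrev L2C := Lp ℂ 2 (volume : Measure ℝ)

/-- A bounded measurable real symbol. -/
def BddSymbol (m : ℝ → ℝ) : Prop := Measurable m ∧ ∃ C, ∀ ξ, |m ξ| ≤ C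

lemma BddSymbol.memLp_mul {m : ℝ → ℝ} (hm : BddSymbol m) (f : L2C) :
    MemLp (fun ξ ↦ (m ξ : ℂ) * f ξ) 2 volume := by
  obtain ⟨hm1, C, hC⟩ := hm
  refine MemLp.of_le_mul (c := C) (Lp.memLp f) ?_ ?_
  · exact (Complex.measurable_ofReal.comp hm1).aestronglyMeasurable.mul
      (Lp.aestronglyMeasurable f)
  · refine Eventually.of_forall fun ξ ↦ ?_
    rw [norm_mul, Complex.norm_real, Real.norm_eq_abs]
    gcongr
    exact hC ξ

open Classical in
/-- Multiplication by the real symbol `m` as a bounded operator on `L²`. If `m` is not a bounded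
measurable function, this is `0`. -/
noncomputable def mulOp (m : ℝ → ℝ) : L2C →L[ℂ] L2C :=
  if hm : BddSymbol m then
    LinearMap.mkContinuousOfExistsBound
      { toFun := fun f ↦ (hm.memLp_mul f).toLp _
        map_add' := fun f g ↦ by
          ext1
          filter_upwards [(hm.memLp_mul (f + g)).coeFn_toLp, (hm.memLp_mul f).coeFn_toLp,
            (hm.memLp_mul g).coeFn_toLp, Lp.coeFn_add f g,
            Lp.coeFn_add ((hm.memLp_mul f).toLp _) ((hm.memLp_mul g).toLp _)] with x h1 h2 h3 h4 h5
          rw [h1, h5, Pi.add_apply, h2, h3, h4, Pi.add_apply, mul_add]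
        map_smul' := fun c f ↦ by
          ext1
          filter_upwards [(hm.memLp_mul (c • f)).coeFn_toLp, (hm.memLp_mul f).coeFn_toLp,
            Lp.coeFn_smul c f,
            Lp.coeFn_smul c ((hm.memLp_mul f).toLp _)] with x h1 h2 h3 h4
          rw [h1, RingHom.id_apply, h4, Pi.smul_apply, h2, h3, Pi.smul_apply, smul_eq_mul,
            smul_eq_mul]
          ring }
      (by
        obtain ⟨C, hC⟩ := hm.2
        refine ⟨C, fun f ↦ Lp.norm_le_mul_norm_of_ae_le_mul ?_⟩
        filter_upwards [(hm.memLp_mul f).coeFn_toLp] with x h1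
        simp only [LinearMap.coe_mk, AddHom.coe_mk]
        rw [h1, norm_mul, Complex.norm_real, Real.norm_eq_abs]
        gcongr
        exact hC x)
  else 0

lemma coeFn_mulOp {m : ℝ → ℝ} (hm : BddSymbol m) (f : L2C) :
    mulOp m f =ᵐ[volume] fun ξ ↦ (m ξ : ℂ) * f ξ := by
  have : mulOp m f = (hm.memLp_mul f).toLp _ := by
    simp only [mulOp, hm, dif_pos]
    rfl
  rw [this]
  exact (hm.memLp_mul f).coeFn_toLp

lemma norm_mulOp_apply_le {m : ℝ → ℝ} (hm : Measurable m) {C : ℝ} (hC : ∀ ξ, |m ξ| ≤ C)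
    (f : L2C) : ‖mulOp m f‖ ≤ C * ‖f‖ := by
  refine Lp.norm_le_mul_norm_of_ae_le_mul ?_
  filter_upwards [coeFn_mulOp ⟨hm, C, hC⟩ f] with x h1
  rw [h1, norm_mul, Complex.norm_real, Real.norm_eq_abs]
  gcongr
  exact hC x

lemma BddSymbol.mul {m n : ℝ → ℝ} (hm : BddSymbol m) (hn : BddSymbol n) :
    BddSymbol (fun ξ ↦ m ξ * n ξ) := by
  obtain ⟨hm1, C, hC⟩ := hm
  obtain ⟨hn1, D, hD⟩ := hn
  refine ⟨hm1.mul hn1, C * D, fun ξ ↦ ?_⟩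
  rw [abs_mul]
  exact mul_le_mul (hC ξ) (hD ξ) (abs_nonneg _) ((abs_nonneg _).trans (hC ξ))

lemma BddSymbol.add {m n : ℝ → ℝ} (hm : BddSymbol m) (hn : BddSymbol n) :
    BddSymbol (fun ξ ↦ m ξ + n ξ) := by
  obtain ⟨hm1, C, hC⟩ := hm
  obtain ⟨hn1, D, hD⟩ := hn
  exact ⟨hm1.add hn1, C + D, fun ξ ↦ (abs_add_le _ _).trans (add_le_add (hC ξ) (hD ξ))⟩

lemma BddSymbol.neg {m : ℝ → ℝ} (hm : BddSymbol m) : BddSymbol (fun ξ ↦ -m ξ) := by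
  obtain ⟨hm1, C, hC⟩ := hm
  exact ⟨hm1.neg, C, fun ξ ↦ by rw [abs_neg]; exact hC ξ⟩

lemma BddSymbol.sub {m n : ℝ → ℝ} (hm : BddSymbol m) (hn : BddSymbol n) :
    BddSymbol (fun ξ ↦ m ξ - n ξ) := by
  simpa only [sub_eq_add_neg] using hm.add hn.neg

lemma mulOp_mulOp {m n : ℝ → ℝ} (hm : BddSymbol m) (hn : BddSymbol n) (f : L2C) :
    mulOp m (mulOp n f) = mulOp (fun ξ ↦ m ξ * n ξ) f := by
  ext1
  filter_upwards [coeFn_mulOp hm (mulOp n f), coeFn_mulOp hn f, coeFn_mulOp (hm.mul hn) f]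
    with x h1 h2 h3
  rw [h1, h2, h3]
  push_cast
  ring

lemma mulOp_comm {m n : ℝ → ℝ} (hm : BddSymbol m) (hn : BddSymbol n) (f : L2C) :
    mulOp m (mulOp n f) = mulOp n (mulOp m f) := by
  rw [mulOp_mulOp hm hn, mulOp_mulOp hn hm]
  congr 2
  ext ξ
  ring

lemma mulOp_add {m n : ℝ → ℝ} (hm : BddSymbol m) (hn : BddSymbol n) (f : L2C) :
    mulOp (fun ξ ↦ m ξ + n ξ) f = mulOp m f + mulOp n f := by
  ext1
  filter_upwards [coeFn_mulOp hm f, coeFn_mulOp hn f, coeFn_mulOp (hm.add hn) f,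
    Lp.coeFn_add (mulOp m f) (mulOp n f)] with x h1 h2 h3 h4
  rw [h4, Pi.add_apply, h1, h2, h3]
  push_cast
  ring

lemma mulOp_neg {m : ℝ → ℝ} (hm : BddSymbol m) (f : L2C) :
    mulOp (fun ξ ↦ -m ξ) f = -mulOp m f := by
  ext1
  filter_upwards [coeFn_mulOp hm f, coeFn_mulOp hm.neg f, Lp.coeFn_neg (mulOp m f)]
    with x h1 h2 h3
  rw [h3, Pi.neg_apply, h1, h2]
  push_cast
  ring

lemma mulOp_sub {m n : ℝ → ℝ} (hm : BddSymbol m) (hn : BddSymbol n) (f : L2C) :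
    mulOp (fun ξ ↦ m ξ - n ξ) f = mulOp m f - mulOp n f := by
  simp only [sub_eq_add_neg]
  rw [mulOp_add hm hn.neg, mulOp_neg hn]

lemma mulOp_const_smul {m : ℝ → ℝ} (hm : BddSymbol m) (c : ℝ) (f : L2C) :
    mulOp (fun ξ ↦ c * m ξ) f = c • mulOp m f := by
  have hc : BddSymbol fun ξ ↦ c * m ξ := by
    have : BddSymbol fun _ ↦ c := ⟨measurable_const, |c|, fun _ ↦ le_rfl⟩
    exact this.mul hm
  ext1
  filter_upwards [coeFn_mulOp hm f, coeFn_mulOp hc f, Lp.coeFn_smul c (mulOp m f)]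
    with x h1 h2 h3
  rw [h3, Pi.smul_apply, h1, h2]
  push_cast
  rw [Complex.real_smul]
  ring

lemma mulOp_one (f : L2C) : mulOp (fun _ ↦ 1) f = f := by
  ext1
  filter_upwards [coeFn_mulOp (m := fun _ ↦ 1) ⟨measurable_const, 1, fun _ ↦ by simp⟩ f] with x h1
  rw [h1]
  simp

lemma mulOp_injective {m : ℝ → ℝ} (hm : BddSymbol m) (h0 : ∀ ξ, m ξ ≠ 0) :
    Function.Injective (mulOp m) := by
  intro f g hfg
  ext1
  filter_upwards [coeFn_mulOp hm f, coeFn_mulOp hm g] with x h1 h2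
  rw [hfg, h2] at h1
  exact (mul_left_cancel₀ (Complex.ofReal_ne_zero.2 (h0 x)) h1).symm

lemma enorm_sq_eq_lintegral (f : L2C) : ‖f‖ₑ ^ 2 = ∫⁻ ξ, ‖f ξ‖ₑ ^ 2 := by
  rw [Lp.enorm_def, eLpNorm_eq_lintegral_rpow_enorm_toReal (by norm_num) (by norm_num)]
  rw [← ENNReal.rpow_natCast, ← ENNReal.rpow_mul]
  simp

lemma integrable_norm_sq (f : L2C) : Integrable (fun ξ ↦ ‖f ξ‖ ^ 2) volume := by
  have := (Lp.memLp f).integrable_norm_pow (p := 2) (by norm_num)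
  simpa using this

lemma norm_sq_eq_integral (f : L2C) : ‖f‖ ^ 2 = ∫ ξ, ‖f ξ‖ ^ 2 := by
  have h := congrArg ENNReal.toReal (enorm_sq_eq_lintegral f)
  rw [ENNReal.toReal_pow, toReal_enorm] at h
  rw [h, integral_eq_lintegral_of_nonneg_ae (Eventually.of_forall fun _ ↦ by positivity)
    (integrable_norm_sq f).aestronglyMeasurable]
  congr 1
  refine lintegral_congr fun ξ ↦ ?_
  rw [← ofReal_norm, ENNReal.ofReal_pow (norm_nonneg _)]

/-- Dominated convergence for multiplication operators: uniformly bounded symbols tending to zero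
pointwise tend to zero strongly. -/
lemma tendsto_mulOp_zero {ι : Type*} {l : Filter ι} [l.IsCountablyGenerated] {m : ι → ℝ → ℝ}
    {C : ℝ} (hm : ∀ᶠ i in l, Measurable (m i) ∧ ∀ ξ, |m i ξ| ≤ C)
    (h0 : ∀ ξ, Tendsto (fun i ↦ m i ξ) l (𝓝 0)) (f : L2C) :
    Tendsto (fun i ↦ mulOp (m i) f) l (𝓝 0) := by
  rw [tendsto_zero_iff_norm_tendsto_zero]
  have key : Tendsto (fun i ↦ ∫ ξ, (m i ξ) ^ 2 * ‖f ξ‖ ^ 2) l (𝓝 (∫ _ : ℝ, 0)) := by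
    refine tendsto_integral_filter_of_dominated_convergence (fun ξ ↦ C ^ 2 * ‖f ξ‖ ^ 2) ?_ ?_ ?_ ?_
    · filter_upwards [hm] with i hi
      exact (hi.1.pow_const 2).aestronglyMeasurable.mul ((Lp.aestronglyMeasurable f).norm.pow 2)
    · filter_upwards [hm] with i hi
      refine Eventually.of_forall fun ξ ↦ ?_
      rw [Real.norm_eq_abs, abs_of_nonneg (by positivity), ← sq_abs (m i ξ)]
      gcongr
      exact hi.2 ξ
    · exact (integrable_norm_sq f).const_mul _
    · refine Eventually.of_forall fun ξ ↦ ?_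
      simpa using ((h0 ξ).pow 2).mul_const (‖f ξ‖ ^ 2)
  rw [integral_zero] at key
  have key2 : Tendsto (fun i ↦ ‖mulOp (m i) f‖ ^ 2) l (𝓝 0) := by
    refine key.congr' ?_
    filter_upwards [hm] with i hi
    rw [norm_sq_eq_integral]
    refine integral_congr_ae ?_
    filter_upwards [coeFn_mulOp ⟨hi.1, C, hi.2⟩ f] with ξ h1
    rw [h1, norm_mul, Complex.norm_real, mul_pow, Real.norm_eq_abs, sq_abs]
  have := key2.sqrt
  simpa [Real.sqrt_sq] using this

/-- A family of symbols indexed by `t ∈ S`, uniformly bounded by `C` and continuous in `t`. -/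
structure SymbolFamily (S : Set ℝ) (C : ℝ) (m : ℝ → ℝ → ℝ) : Prop where
  meas : ∀ t ∈ S, Measurable (m t)
  bdd : ∀ t ∈ S, ∀ ξ, |m t ξ| ≤ C
  cont : ∀ ξ, ContinuousOn (fun t ↦ m t ξ) S

lemma SymbolFamily.bddSymbol {S : Set ℝ} {C : ℝ} {m : ℝ → ℝ → ℝ} (h : SymbolFamily S C m)
    {t : ℝ} (ht : t ∈ S) : BddSymbol (m t) := ⟨h.meas t ht, C, h.bdd t ht⟩

lemma SymbolFamily.tendsto_sub {S : Set ℝ} {C : ℝ} {m : ℝ → ℝ → ℝ} (h : SymbolFamily S C m)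
    {t : ℝ} (ht : t ∈ S) (f : L2C) :
    Tendsto (fun τ ↦ mulOp (m τ) f) (𝓝[S] t) (𝓝 (mulOp (m t) f)) := by
  have h0 : Tendsto (fun τ ↦ mulOp (fun ξ ↦ m τ ξ - m t ξ) f) (𝓝[S] t) (𝓝 0) := by
    refine tendsto_mulOp_zero (C := C + C) ?_ (fun ξ ↦ ?_) f
    · filter_upwards [self_mem_nhdsWithin] with τ hτ
      exact ⟨(h.meas τ hτ).sub (h.meas t ht), fun ξ ↦
        (abs_sub _ _).trans (add_le_add (h.bdd τ hτ ξ) (h.bdd t ht ξ))⟩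
    · have := (h.cont ξ t ht).tendsto.sub_const (m t ξ)
      simpa using this
  have h1 : Tendsto (fun τ ↦ mulOp (m τ) f - mulOp (m t) f) (𝓝[S] t) (𝓝 0) := by
    refine h0.congr' ?_
    filter_upwards [self_mem_nhdsWithin] with τ hτ
    exact mulOp_sub (h.bddSymbol hτ) (h.bddSymbol ht) f
  simpa using h1.add_const (mulOp (m t) f)

lemma SymbolFamily.tendsto_apply {S : Set ℝ} {C : ℝ} {m : ℝ → ℝ → ℝ} (h : SymbolFamily S C m)
    {t : ℝ} (ht : t ∈ S) {x : ℝ → L2C} {y : L2C} {l : Filter ℝ} (hl : l ≤ 𝓝[S] t)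
    (hx : Tendsto x l (𝓝 y)) :
    Tendsto (fun τ ↦ mulOp (m τ) (x τ)) l (𝓝 (mulOp (m t) y)) := by
  have h1 : Tendsto (fun τ ↦ mulOp (m τ) (x τ - y)) l (𝓝 0) := by
    rw [tendsto_zero_iff_norm_tendsto_zero]
    have h2 : Tendsto (fun τ ↦ C * ‖x τ - y‖) l (𝓝 0) := by
      have := (tendsto_iff_norm_sub_tendsto_zero.1 hx).const_mul C
      simpa using this
    refine squeeze_zero' (Eventually.of_forall fun _ ↦ norm_nonneg _) ?_ h2
    filter_upwards [hl self_mem_nhdsWithin] with τ hτ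
    exact norm_mulOp_apply_le (h.meas τ hτ) (h.bdd τ hτ) _
  have h3 := h1.add ((h.tendsto_sub ht y).mono_left hl)
  simpa using h3

lemma SymbolFamily.continuousOn {S : Set ℝ} {C : ℝ} {m : ℝ → ℝ → ℝ} (h : SymbolFamily S C m)
    {x : ℝ → L2C} (hx : ContinuousOn x S) : ContinuousOn (fun τ ↦ mulOp (m τ) (x τ)) S :=
  fun t ht ↦ h.tendsto_apply ht le_rfl (hx t ht)

/-- The product rule for a strongly differentiable family of multiplication operators applied to a
differentiable curve in `L²`. -/
lemma SymbolFamily.hasDerivWithinAt {S : Set ℝ} (hS : Convex ℝ S) {C C' : ℝ} {m m' : ℝ → ℝ → ℝ}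
    (h : SymbolFamily S C m) (h' : SymbolFamily S C' m')
    (hd : ∀ ξ, ∀ t ∈ S, HasDerivWithinAt (fun τ ↦ m τ ξ) (m' t ξ) S t)
    {x : ℝ → L2C} {x' : L2C} {t : ℝ} (ht : t ∈ S) (hx : HasDerivWithinAt x x' S t) :
    HasDerivWithinAt (fun τ ↦ mulOp (m τ) (x τ)) (mulOp (m' t) (x t) + mulOp (m t) x') S t := by
  rw [hasDerivWithinAt_iff_tendsto_slope] at hx ⊢
  have hle : 𝓝[S \ {t}] t ≤ 𝓝[S] t := nhdsWithin_mono _ sdiff_subset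
  have h1 := h.tendsto_apply ht hle hx
  have h2 : Tendsto (fun τ ↦ mulOp (fun ξ ↦ (τ - t)⁻¹ * (m τ ξ - m t ξ) - m' t ξ) (x t))
      (𝓝[S \ {t}] t) (𝓝 0) := by
    refine tendsto_mulOp_zero (C := C' + C') ?_ (fun ξ ↦ ?_) (x t)
    · filter_upwards [self_mem_nhdsWithin] with τ hτ
      refine ⟨(((h.meas τ hτ.1).sub (h.meas t ht)).const_mul _).sub (h'.meas t ht), fun ξ ↦ ?_⟩
      refine (abs_sub _ _).trans (add_le_add ?_ (h'.bdd t ht ξ))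
      have hmv := hS.norm_image_sub_le_of_norm_hasDerivWithin_le
        (fun y hy ↦ hd ξ y hy) (fun y hy ↦ h'.bdd y hy ξ) ht hτ.1
      have hne : 0 < |τ - t| := abs_pos.2 (sub_ne_zero.2 fun hh ↦ hτ.2 (by simp [hh]))
      rw [abs_mul, abs_inv, inv_mul_le_iff₀ hne, mul_comm]
      exact hmv
    · have := (hasDerivWithinAt_iff_tendsto_slope.1 (hd ξ t ht)).sub_const (m' t ξ)
      simpa [slope_def_field, div_eq_inv_mul] using this
  have h3 := (h2.add h1).add_const (mulOp (m' t) (x t))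
  rw [zero_add, add_comm] at h3
  refine h3.congr' ?_
  filter_upwards [self_mem_nhdsWithin] with τ hτ
  have hb : BddSymbol (fun ξ ↦ m τ ξ - m t ξ) := (h.bddSymbol hτ.1).sub (h.bddSymbol ht)
  have hb2 : BddSymbol (fun ξ ↦ (τ - t)⁻¹ * (m τ ξ - m t ξ)) :=
    BddSymbol.mul (m := fun _ ↦ (τ - t)⁻¹) ⟨measurable_const, |(τ - t)⁻¹|, fun _ ↦ le_rfl⟩ hb
  rw [mulOp_sub hb2 (h'.bddSymbol ht), mulOp_const_smul hb, mulOp_sub (h.bddSymbol hτ.1)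
    (h.bddSymbol ht), slope_def_module, slope_def_module,
    (mulOp (m τ)).map_smul_of_tower, map_sub]
  simp only [smul_sub]
  abel

end NonlocalWave

namespace NonlocalWave
open Filter Topology TemperedDistribution ComplexConjugate

/-! ### Distributions given by functions -/

lemma exists_schwartz_of_contDiff {g : ℝ → ℝ} (hg : ContDiff ℝ (⊤ : ℕ∞) g)
    (hc : HasCompactSupport g) : ∃ η : 𝓢(ℝ, ℂ), ∀ x, η x = (g x : ℂ) := by
  have h1 : HasCompactSupport (Complex.ofRealCLM ∘ g) := hc.comp_left rfl
  have h2 : ContDiff ℝ (⊤ : ℕ∞) (Complex.ofRealCLM ∘ g) := Complex.ofRealCLM.contDiff.comp hg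
  exact ⟨h1.toSchwartzMap h2, fun x ↦ rfl⟩

lemma IsGivenBy.locallyIntegrable {f : 𝓢'(ℝ, ℂ)} {w : ℝ → ℂ} (h : IsGivenBy f w) :
    LocallyIntegrable w volume := by
  rw [locallyIntegrable_iff]
  intro K hK
  obtain ⟨R, hR⟩ := hK.isBounded.subset_closedBall 0
  let B : ContDiffBump (0 : ℝ) := ⟨max R 1, max R 1 + 1, by positivity, by linarith⟩
  obtain ⟨η, hη⟩ := exists_schwartz_of_contDiff B.contDiff B.hasCompactSupport
  refine ((h η).1.integrableOn (s := K)).congr_fun (fun x hx ↦ ?_) hK.measurableSet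
  have : B x = 1 := B.one_of_mem_closedBall
    (Metric.closedBall_subset_closedBall (le_max_left _ _) (hR hx))
  simp [hη, this]

lemma IsGivenBy.ae_eq {f : 𝓢'(ℝ, ℂ)} {w v : ℝ → ℂ} (hw : IsGivenBy f w) (hv : IsGivenBy f v) :
    w =ᵐ[volume] v := by
  refine ae_eq_of_integral_contDiff_smul_eq hw.locallyIntegrable hv.locallyIntegrable ?_
  intro g hg hc
  obtain ⟨η, hη⟩ := exists_schwartz_of_contDiff hg hc
  have h1 := (hw η).2.symm.trans (hv η).2
  simpa only [hη, ← Complex.real_smul] using h1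

lemma IsGivenBy.congr {f : 𝓢'(ℝ, ℂ)} {w v : ℝ → ℂ} (hw : IsGivenBy f w)
    (h : w =ᵐ[volume] v) : IsGivenBy f v := by
  intro η
  have h1 : (fun x ↦ η x * w x) =ᵐ[volume] fun x ↦ η x * v x := by
    filter_upwards [h] with x hx
    rw [hx]
  exact ⟨(hw η).1.congr h1, (hw η).2.trans (integral_congr_ae h1)⟩

lemma IsGivenBy.eq {f h : 𝓢'(ℝ, ℂ)} {w : ℝ → ℂ} (hw : IsGivenBy f w) (hv : IsGivenBy h w) :
    f = h := by
  ext η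
  rw [(hw η).2, (hv η).2]

lemma IsGivenBy.add {f h : 𝓢'(ℝ, ℂ)} {w v : ℝ → ℂ} (hw : IsGivenBy f w) (hv : IsGivenBy h v) :
    IsGivenBy (f + h) (fun x ↦ w x + v x) := by
  intro η
  simp only [mul_add]
  refine ⟨(hw η).1.add (hv η).1, ?_⟩
  rw [integral_add (hw η).1 (hv η).1, ← (hw η).2, ← (hv η).2]
  rfl

lemma IsGivenBy.smul {f : 𝓢'(ℝ, ℂ)} {w : ℝ → ℂ} (hw : IsGivenBy f w) (c : ℂ) :
    IsGivenBy (c • f) (fun x ↦ c * w x) := by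
  intro η
  have h1 : (fun x ↦ η x * (c * w x)) = fun x ↦ c * (η x * w x) := by ext x; ring
  rw [h1]
  refine ⟨(hw η).1.const_mul c, ?_⟩
  rw [integral_const_mul, ← (hw η).2]
  rfl

lemma isGivenBy_Lp (f : L2C) : IsGivenBy (f : 𝓢'(ℝ, ℂ)) f := by
  intro η
  refine ⟨?_, by rw [Lp.toTemperedDistribution_apply]; rfl⟩
  exact MemLp.integrable_mul (η.memLp 2 volume) (Lp.memLp f)

lemma IsGivenBy.smulLeftCLM {f : 𝓢'(ℝ, ℂ)} {w : ℝ → ℂ} (hw : IsGivenBy f w) {m : ℝ → ℂ}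
    (hm : m.HasTemperateGrowth) :
    IsGivenBy (TemperedDistribution.smulLeftCLM ℂ m f) (fun x ↦ m x * w x) := by
  intro η
  have h := hw (SchwartzMap.smulLeftCLM ℂ m η)
  have h1 : (fun x ↦ (SchwartzMap.smulLeftCLM ℂ m η) x * w x) = fun x ↦ η x * (m x * w x) := by
    ext x
    rw [SchwartzMap.smulLeftCLM_apply_apply hm, smul_eq_mul]
    ring
  rw [h1] at h
  exact h

/-! ### Bessel weights -/

/-- The weight `(1 + ξ²)^(s/2)`. -/
noncomputable def bw (s ξ : ℝ) : ℝ := (1 + ξ ^ 2) ^ (s / 2)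

lemma bw_pos (s ξ : ℝ) : 0 < bw s ξ := Real.rpow_pos_of_pos (by positivity) _

lemma bw_ne_zero (s ξ : ℝ) : bw s ξ ≠ 0 := (bw_pos s ξ).ne'

lemma bw_even (s ξ : ℝ) : bw s (-ξ) = bw s ξ := by simp [bw]

lemma bw_add (s t ξ : ℝ) : bw (s + t) ξ = bw s ξ * bw t ξ := by
  rw [bw, bw, bw, ← Real.rpow_add (by positivity), add_div]

lemma bw_zero (ξ : ℝ) : bw 0 ξ = 1 := by simp [bw]

lemma bw_neg_mul (s ξ : ℝ) : bw (-s) ξ * bw s ξ = 1 := by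
  rw [← bw_add, neg_add_cancel, bw_zero]

lemma bw_neg (s ξ : ℝ) : bw (-s) ξ = (bw s ξ)⁻¹ := eq_inv_of_mul_eq_one_left (bw_neg_mul s ξ)

lemma continuous_bw (s : ℝ) : Continuous (bw s) := by
  unfold bw
  exact (by fun_prop : Continuous fun ξ : ℝ ↦ 1 + ξ ^ 2).rpow_const
    fun ξ ↦ Or.inl (by positivity)

lemma bw_le_one {s : ℝ} (hs : s ≤ 0) (ξ : ℝ) : bw s ξ ≤ 1 :=
  Real.rpow_le_one_of_one_le_of_nonpos (by nlinarith [sq_nonneg ξ]) (by linarith)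

lemma bw_mono {s t : ℝ} (h : s ≤ t) (ξ : ℝ) : bw s ξ ≤ bw t ξ :=
  Real.rpow_le_rpow_of_exponent_le (by nlinarith [sq_nonneg ξ]) (by linarith)

lemma one_le_bw {s : ℝ} (hs : 0 ≤ s) (ξ : ℝ) : 1 ≤ bw s ξ := by
  simpa [bw_zero] using bw_mono hs ξ

lemma bddSymbol_bw {s : ℝ} (hs : s ≤ 0) : BddSymbol (bw s) :=
  ⟨(continuous_bw s).measurable, 1, fun ξ ↦ by
    rw [abs_of_pos (bw_pos s ξ)]; exact bw_le_one hs ξ⟩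

lemma hasTemperateGrowth_bw (s : ℝ) : (fun ξ : ℝ ↦ (bw s ξ : ℂ)).HasTemperateGrowth := by
  have : (fun ξ : ℝ ↦ (bw s ξ : ℂ)) = fun ξ : ℝ ↦ (((1 + ‖ξ‖ ^ 2) ^ (s / 2) : ℝ) : ℂ) := by
    ext ξ
    simp [bw]
  rw [this]
  fun_prop

lemma IsGivenBy.besselPotential {f : 𝓢'(ℝ, ℂ)} {w : ℝ → ℂ} (hw : IsGivenBy (𝓕 f) w) (s : ℝ) :
    IsGivenBy (𝓕 (TemperedDistribution.besselPotential ℝ ℂ s f)) (fun ξ ↦ (bw s ξ : ℂ) * w ξ) := by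
  rw [fourier_besselPotential_eq_smulLeftCLM_fourier_apply]
  have : (fun ξ : ℝ ↦ (((1 + ‖ξ‖ ^ 2) ^ (s / 2) : ℝ) : ℂ)) = fun ξ : ℝ ↦ (bw s ξ : ℂ) := by
    ext ξ
    simp [bw]
  rw [this]
  exact hw.smulLeftCLM (hasTemperateGrowth_bw s)

lemma fourier_injective {f g : 𝓢'(ℝ, ℂ)} (h : 𝓕 f = 𝓕 g) : f = g := by
  rw [← fourierInv_fourier_eq (F := 𝓢'(ℝ, ℂ)) f, h, fourierInv_fourier_eq]

lemma IsGivenBy.dxx {f : 𝓢'(ℝ, ℂ)} {w : ℝ → ℂ} (hw : IsGivenBy (𝓕 f) w) :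
    IsGivenBy (𝓕 (dxx f)) (fun ξ ↦ -((2 * Real.pi * ξ : ℝ) : ℂ) ^ 2 * w ξ) := by
  have key : ∀ {f : 𝓢'(ℝ, ℂ)} {w : ℝ → ℂ}, IsGivenBy (𝓕 f) w →
      IsGivenBy (𝓕 (derivCLM ℂ f)) (fun ξ ↦ (2 * Real.pi * Complex.I) * ((ξ : ℂ) * w ξ)) := by
    intro f w hw
    have h1 : derivCLM ℂ f = LineDeriv.lineDerivOp (1 : ℝ) f := rfl
    rw [h1, TemperedDistribution.fourier_lineDerivOp_eq]
    have h2 : (fun x : ℝ ↦ ((inner ℝ x (1 : ℝ) : ℝ) : ℂ)) = fun x : ℝ ↦ (x : ℂ) := by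
      ext x
      simp
    rw [h2]
    exact (hw.smulLeftCLM (by fun_prop)).smul _
  refine (key (key hw)).congr (Eventually.of_forall fun ξ ↦ ?_)
  simp only
  push_cast
  ring_nf
  rw [Complex.I_sq]
  ring

/-! ### Distributions with Fourier transform in a weighted `L²` space -/

/-- The tempered distribution whose Fourier transform is `(1 + ξ²)^(m/2) x(ξ)`, for `x ∈ L²`. -/
noncomputable def ofWeighted (m : ℝ) : L2C →L[ℂ] 𝓢'(ℝ, ℂ) :=
  besselPotential ℝ ℂ m ∘L Lp.toTemperedDistributionCLM ℂ volume 2 ∘L fourierInvCLM ℂ L2C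

lemma ofWeighted_apply (m : ℝ) (x : L2C) :
    ofWeighted m x = besselPotential ℝ ℂ m ((𝓕⁻ x : L2C) : 𝓢'(ℝ, ℂ)) := rfl

lemma isGivenBy_fourier_ofWeighted (m : ℝ) (x : L2C) :
    IsGivenBy (𝓕 (ofWeighted m x)) (fun ξ ↦ (bw m ξ : ℂ) * x ξ) := by
  rw [ofWeighted_apply]
  refine IsGivenBy.besselPotential ?_ m
  rw [Lp.fourier_toTemperedDistribution_eq, fourier_fourierInv_eq]
  exact isGivenBy_Lp x

lemma eq_ofWeighted {f : 𝓢'(ℝ, ℂ)} {w : ℝ → ℂ} (hf : IsGivenBy (𝓕 f) w) (m : ℝ) (x : L2C)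
    (h : w =ᵐ[volume] fun ξ ↦ (bw m ξ : ℂ) * x ξ) : f = ofWeighted m x :=
  fourier_injective ((hf.congr h).eq (isGivenBy_fourier_ofWeighted m x))

lemma besselPotential_ofWeighted (s m : ℝ) (x : L2C) :
    besselPotential ℝ ℂ s (ofWeighted m x) = ofWeighted (m + s) x := by
  rw [ofWeighted_apply, ofWeighted_apply, besselPotential_besselPotential_apply]

lemma ofWeighted_zero (x : L2C) : ofWeighted 0 x = ((𝓕⁻ x : L2C) : 𝓢'(ℝ, ℂ)) := by
  rw [ofWeighted_apply, besselPotential_zero]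
  rfl

lemma ofWeighted_mulOp (m : ℝ) {k : ℝ} (hk : k ≤ 0) (x : L2C) :
    ofWeighted m (mulOp (bw k) x) = ofWeighted (m + k) x := by
  refine eq_ofWeighted (isGivenBy_fourier_ofWeighted m _) _ _ ?_
  filter_upwards [coeFn_mulOp (bddSymbol_bw hk) x] with ξ h1
  rw [h1, bw_add]
  push_cast
  ring

lemma ofWeighted_injective (m : ℝ) : Function.Injective (ofWeighted m) := by
  intro x y h
  ext1
  have h1 := isGivenBy_fourier_ofWeighted m x
  rw [h] at h1
  filter_upwards [h1.ae_eq (isGivenBy_fourier_ofWeighted m y)] with ξ hξ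
  exact mul_left_cancel₀ (Complex.ofReal_ne_zero.2 (bw_ne_zero m ξ)) hξ

lemma eq_ofWeighted_of_besselPotential {s : ℝ} {f : 𝓢'(ℝ, ℂ)} {U : L2C}
    (h : besselPotential ℝ ℂ s f = (U : 𝓢'(ℝ, ℂ))) : f = ofWeighted (-s) (𝓕 U) := by
  rw [ofWeighted_apply, fourierInv_fourier_eq, ← h]
  simp

lemma besselPotential_eq_of_eq_ofWeighted {s : ℝ} {f : 𝓢'(ℝ, ℂ)} {x : L2C}
    (h : f = ofWeighted (-s) x) : besselPotential ℝ ℂ s f = ((𝓕⁻ x : L2C) : 𝓢'(ℝ, ℂ)) := by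
  rw [h, besselPotential_ofWeighted, neg_add_cancel, ofWeighted_zero]

/-- Evaluation of `ofWeighted m x` at a test function, as a functional of `x`. -/
noncomputable def ofWeightedEval (m : ℝ) (η : 𝓢(ℝ, ℂ)) : L2C →L[ℂ] ℂ :=
  PointwiseConvergenceCLM.evalCLM (RingHom.id ℂ) ℂ η ∘L ofWeighted m

lemma ofWeightedEval_apply (m : ℝ) (η : 𝓢(ℝ, ℂ)) (x : L2C) :
    ofWeightedEval m η x = ofWeighted m x η := rfl

/-! ### Reality and Hermitian symmetry -/

/-- The real-linear isometry `x ↦ conj (x (-ξ))` of `L²`. The Fourier transforms of the real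
functions are its fixed points. -/
noncomputable def dagger : L2C →L[ℝ] L2C :=
  (ContinuousLinearMap.compLpL 2 volume (Complex.conjCLE : ℂ →L[ℝ] ℂ)) ∘L
    (Lp.compMeasurePreservingₗᵢ ℝ (fun x : ℝ ↦ -x)
      (Measure.measurePreserving_neg volume)).toContinuousLinearMap

lemma ae_comp_neg {p : ℝ → Prop} (h : ∀ᵐ x, p x) : ∀ᵐ x, p (-x) :=
  (Measure.measurePreserving_neg (volume : Measure ℝ)).quasiMeasurePreserving.ae h

lemma coeFn_dagger (x : L2C) : dagger x =ᵐ[volume] fun ξ ↦ conj (x (-ξ)) := by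
  have h1 := ContinuousLinearMap.coeFn_compLpL (μ := volume) (p := 2)
    (Complex.conjCLE : ℂ →L[ℝ] ℂ) (Lp.compMeasurePreservingₗᵢ ℝ (fun x : ℝ ↦ -x)
      (Measure.measurePreserving_neg volume) x)
  have h2 := Lp.coeFn_compMeasurePreserving x (Measure.measurePreserving_neg (volume : Measure ℝ))
  filter_upwards [h1, h2] with ξ h1 h2
  refine h1.trans ?_
  exact congrArg conj h2

lemma dagger_mulOp {m : ℝ → ℝ} (hm : BddSymbol m) (he : ∀ ξ, m (-ξ) = m ξ) (x : L2C) :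
    dagger (mulOp m x) = mulOp m (dagger x) := by
  ext1
  filter_upwards [coeFn_dagger (mulOp m x), coeFn_dagger x, coeFn_mulOp hm (dagger x),
    ae_comp_neg (coeFn_mulOp hm x)] with ξ h1 h2 h3 h4
  rw [h1, h3, h2, h4, map_mul, Complex.conj_ofReal, he]

/-- Complex conjugation of Schwartz functions. -/
noncomputable def conjS : 𝓢(ℝ, ℂ) →L[ℝ] 𝓢(ℝ, ℂ) :=
  SchwartzMap.postcompCLM (Complex.conjCLE : ℂ →L[ℝ] ℂ)

lemma conjS_apply (η : 𝓢(ℝ, ℂ)) (x : ℝ) : conjS η x = conj (η x) := rfl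

lemma conj_fourierInv (η : 𝓢(ℝ, ℂ)) (ξ : ℝ) : conj (𝓕⁻ η ξ) = 𝓕⁻ (conjS η) (-ξ) := by
  rw [SchwartzMap.fourierInv_coe, SchwartzMap.fourierInv_coe, Real.fourierInv_eq',
    Real.fourierInv_eq', ← integral_conj]
  refine integral_congr_ae (Eventually.of_forall fun x ↦ ?_)
  simp only [smul_eq_mul, map_mul, conjS_apply, ← Complex.exp_conj, Complex.conj_ofReal,
    Complex.conj_I, inner_neg_right]
  push_cast
  ring_nf

lemma ofWeighted_dagger_apply (m : ℝ) (x : L2C) (η : 𝓢(ℝ, ℂ)) :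
    ofWeighted m (dagger x) η = conj (ofWeighted m x (conjS η)) := by
  have key : ∀ (x : L2C) (η : 𝓢(ℝ, ℂ)), ofWeighted m x η =
      ∫ ξ, 𝓕⁻ η ξ * ((bw m ξ : ℂ) * x ξ) := by
    intro x η
    rw [← (isGivenBy_fourier_ofWeighted m x (𝓕⁻ η)).2, TemperedDistribution.fourier_apply,
      fourier_fourierInv_eq]
  rw [key, key, ← integral_conj, ← integral_neg_eq_self]
  refine integral_congr_ae ?_
  filter_upwards [ae_comp_neg (coeFn_dagger x)] with ξ h1
  rw [h1, map_mul, map_mul, conj_fourierInv, Complex.conj_ofReal, bw_even, neg_neg]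
  congr 3
  ext y
  simp [conjS_apply]

lemma isReal_iff_conj {f : 𝓢'(ℝ, ℂ)} : IsReal f ↔ ∀ η, f (conjS η) = conj (f η) := by
  constructor
  · intro h η
    have h1 : (f (η + conjS η)).im = 0 := h _ fun x ↦ by simp [conjS_apply]
    have h2 : (f (Complex.I • (η - conjS η))).im = 0 := h _ fun x ↦ by
      simp [conjS_apply, Complex.mul_im]
    rw [map_add, Complex.add_im] at h1
    rw [map_smul, map_sub, smul_eq_mul] at h2
    simp [Complex.mul_im] at h2
    apply Complex.ext
    · rw [Complex.conj_re]; linarith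
    · rw [Complex.conj_im]; linarith
  · intro h η hη
    have : conjS η = η := by
      ext x
      rw [conjS_apply]
      exact Complex.conj_eq_iff_im.2 (hη x)
    have h1 := h η
    rw [this] at h1
    exact Complex.conj_eq_iff_im.1 h1.symm

lemma isReal_ofWeighted_iff {m : ℝ} {x : L2C} : IsReal (ofWeighted m x) ↔ dagger x = x := by
  rw [isReal_iff_conj]
  constructor
  · intro h
    apply ofWeighted_injective m
    ext η
    rw [ofWeighted_dagger_apply, h, Complex.conj_conj]
  · intro h η
    have h1 := ofWeighted_dagger_apply m x η
    rw [h] at h1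
    rw [h1, Complex.conj_conj]

lemma isReal_of_isGivenBy {f : 𝓢'(ℝ, ℂ)} {v : ℝ → ℝ} (h : IsGivenBy f (fun x ↦ (v x : ℂ))) :
    IsReal f := by
  rw [isReal_iff_conj]
  intro η
  rw [(h η).2, (h (conjS η)).2, ← integral_conj]
  refine integral_congr_ae (Eventually.of_forall fun x ↦ ?_)
  simp [conjS_apply]

lemma ae_im_eq_zero_of_isReal {f : 𝓢'(ℝ, ℂ)} {w : ℝ → ℂ} (h : IsGivenBy f w) (hf : IsReal f) :
    ∀ᵐ x, (w x).im = 0 := by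
  have h1 : IsGivenBy f (fun x ↦ conj (w x)) := by
    intro η
    have h2 := h (conjS η)
    have h3 : (fun x ↦ η x * conj (w x)) = fun x ↦ conj (conjS η x * w x) := by
      ext x
      simp [conjS_apply]
    rw [h3]
    refine ⟨?_, ?_⟩
    · exact (Complex.conjCLE : ℂ →L[ℝ] ℂ).integrable_comp h2.1
    · rw [integral_conj, ← h2.2, isReal_iff_conj.1 hf, Complex.conj_conj]
  filter_upwards [h.ae_eq h1] with x hx
  exact Complex.conj_eq_iff_im.1 hx.symm

end NonlocalWave

namespace NonlocalWave
open Filter Topology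

/-! ### Ordinary differential equations preserving a closed set -/

/-- A curve continuous on `[0, T]` extends to a continuous curve on the line. -/
lemma exists_continuous_eqOn_Icc {E : Type*} [TopologicalSpace E] {T : ℝ} (hT : 0 ≤ T) {x : ℝ → E}
    (hx : ContinuousOn x (Icc 0 T)) : ∃ y : ℝ → E, Continuous y ∧ EqOn y x (Icc 0 T) :=
  ⟨IccExtend hT ((Icc 0 T).domRestrict x), hx.domRestrict.Icc_extend', fun t ht ↦ by
    rw [IccExtend_of_mem hT _ ht]; rfl⟩

section ODE

variable {E : Type*} [NormedAddCommGroup E] [NormedSpace ℝ E] [CompleteSpace E]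

lemma hasDerivWithinAt_integral {T : ℝ} {x : ℝ → E}
    (hx : ContinuousOn x (Icc 0 T)) {t : ℝ} (ht : t ∈ Icc 0 T) :
    HasDerivWithinAt (fun t ↦ ∫ τ in (0 : ℝ)..t, x τ) (x t) (Icc 0 T) t := by
  obtain ⟨y, hy, hyx⟩ := exists_continuous_eqOn_Icc (ht.1.trans ht.2) hx
  have h1 : HasDerivWithinAt (fun t ↦ ∫ τ in (0 : ℝ)..t, y τ) (y t) (Icc 0 T) t :=
    (intervalIntegral.integral_hasDerivAt_right (hy.intervalIntegrable _ _)
      (hy.stronglyMeasurableAtFilter _ _) hy.continuousAt).hasDerivWithinAt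
  rw [hyx ht] at h1
  have key : ∀ s ∈ Icc 0 T, ∫ τ in (0 : ℝ)..s, x τ = ∫ τ in (0 : ℝ)..s, y τ := fun s hs ↦
    intervalIntegral.integral_congr fun τ hτ ↦ by
      rw [uIcc_of_le hs.1] at hτ
      exact (hyx ⟨hτ.1, hτ.2.trans hs.2⟩).symm
  exact h1.congr key (key t ht)

lemma eq_add_integral_of_hasDerivWithinAt {T : ℝ} {x x' : ℝ → E}
    (hx : ∀ t ∈ Icc 0 T, HasDerivWithinAt x (x' t) (Icc 0 T) t)
    (hx' : ContinuousOn x' (Icc 0 T)) {t : ℝ} (ht : t ∈ Icc 0 T) :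
    x t = x 0 + ∫ τ in (0 : ℝ)..t, x' τ := by
  have hsub : Icc 0 t ⊆ Icc 0 T := Icc_subset_Icc_right ht.2
  rw [intervalIntegral.integral_eq_sub_of_hasDerivAt_of_le ht.1
    (fun s hs ↦ ((hx s (hsub hs)).continuousWithinAt).mono hsub)
    (fun s hs ↦ (hx s ⟨hs.1.le, hs.2.le.trans ht.2⟩).hasDerivAt
      (Icc_mem_nhds hs.1 (hs.2.trans_le ht.2)))]
  · abel
  · exact (hx'.mono (by rw [uIcc_of_le ht.1]; exact hsub)).intervalIntegrable

/-- If the image of a continuous curve under an injective operator is differentiable and the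
derivative is the image of a continuous curve, then the curve itself is differentiable. -/
lemma hasDerivWithinAt_of_injective {F : Type*} [NormedAddCommGroup F] [NormedSpace ℝ F]
    [CompleteSpace F] {A : E →L[ℝ] F} (hA : Function.Injective A) {T : ℝ} {x x' : ℝ → E}
    (hx : ∀ t ∈ Icc 0 T, HasDerivWithinAt (fun τ ↦ A (x τ)) (A (x' t)) (Icc 0 T) t)
    (hx' : ContinuousOn x' (Icc 0 T)) {t : ℝ} (ht : t ∈ Icc 0 T) :
    HasDerivWithinAt x (x' t) (Icc 0 T) t := by
  have key : ∀ s ∈ Icc 0 T, x s = x 0 + ∫ τ in (0 : ℝ)..s, x' τ := by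
    intro s hs
    apply hA
    have hi : IntervalIntegrable x' volume 0 s :=
      (hx'.mono (by rw [uIcc_of_le hs.1]; exact Icc_subset_Icc_right hs.2)).intervalIntegrable
    rw [map_add, ← A.intervalIntegral_comp_comm hi]
    exact eq_add_integral_of_hasDerivWithinAt (x := fun τ ↦ A (x τ)) hx
      (A.continuous.comp_continuousOn hx') hs
  exact ((hasDerivWithinAt_integral hx' ht).const_add (x 0)).congr key (key t ht)

/-- Picard iteration in a closed set: if `V` is globally Lipschitz in the second variable, and if
every continuous curve in the closed set `K` is mapped by the Picard operator to a curve in `K`,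
then for small `T` the initial value problem has a solution in `K` on `[0, T]`. -/
lemma exists_solution_mem_closed {V : ℝ → E → E} {Λ : NNReal} {T : ℝ} (hT : 0 ≤ T)
    (hTΛ : T * Λ < 1) (hV : ∀ t ∈ Icc 0 T, LipschitzWith Λ (V t))
    (hVc : ∀ y : ℝ → E, ContinuousOn y (Icc 0 T) → ContinuousOn (fun t ↦ V t (y t)) (Icc 0 T))
    {K : Set E} (hK : IsClosed K) {y₀ : E} (hy₀ : y₀ ∈ K)
    (hinv : ∀ y : ℝ → E, ContinuousOn y (Icc 0 T) → (∀ t ∈ Icc 0 T, y t ∈ K) →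
      ∀ t ∈ Icc 0 T, y₀ + ∫ τ in (0 : ℝ)..t, V τ (y τ) ∈ K) :
    ∃ y : ℝ → E, y 0 = y₀ ∧ (∀ t ∈ Icc 0 T, y t ∈ K) ∧
      ∀ t ∈ Icc 0 T, HasDerivWithinAt y (V t (y t)) (Icc 0 T) t := by
  let ext : C(Icc (0 : ℝ) T, E) → ℝ → E := fun y ↦ IccExtend hT y
  have hext : ∀ y, Continuous (ext y) := fun y ↦ y.continuous.Icc_extend'
  have hextm : ∀ (y : C(Icc (0 : ℝ) T, E)) (t : Icc (0 : ℝ) T), ext y t = y t := fun y t ↦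
    IccExtend_val hT y t
  have hVy : ∀ y : C(Icc (0 : ℝ) T, E), ContinuousOn (fun t ↦ V t (ext y t)) (Icc 0 T) := fun y ↦
    hVc _ (hext y).continuousOn
  have hint : ∀ (y : C(Icc (0 : ℝ) T, E)) (t : ℝ), t ∈ Icc 0 T →
      IntervalIntegrable (fun t ↦ V t (ext y t)) volume 0 t := fun y t ht ↦
    ((hVy y).mono (by rw [uIcc_of_le ht.1]; exact Icc_subset_Icc_right ht.2)).intervalIntegrable
  let Φ : C(Icc (0 : ℝ) T, E) → C(Icc (0 : ℝ) T, E) := fun y ↦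
    ⟨fun t ↦ y₀ + ∫ τ in (0 : ℝ)..t, V τ (ext y τ), by
      have h1 : ContinuousOn (fun t ↦ y₀ + ∫ τ in (0 : ℝ)..t, V τ (ext y τ)) (Icc 0 T) :=
        fun t ht ↦ ((hasDerivWithinAt_integral (hVy y) ht).continuousWithinAt).const_add y₀
      exact h1.domRestrict⟩
  have hΦ : ∀ y (t : Icc (0 : ℝ) T), Φ y t = y₀ + ∫ τ in (0 : ℝ)..t, V τ (ext y τ) :=
    fun _ _ ↦ rfl
  have hlip : LipschitzWith (T.toNNReal * Λ) Φ := by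
    refine LipschitzWith.of_dist_le_mul fun y z ↦ ?_
    rw [ContinuousMap.dist_le (by positivity)]
    intro t
    rw [hΦ, hΦ, dist_add_left, dist_eq_norm, ← intervalIntegral.integral_sub (hint y t t.2)
      (hint z t t.2)]
    have hb : ∀ τ ∈ uIoc (0 : ℝ) t, ‖V τ (ext y τ) - V τ (ext z τ)‖ ≤ Λ * dist y z := by
      intro τ hτ
      rw [uIoc_of_le t.2.1] at hτ
      have hτ' : τ ∈ Icc 0 T := ⟨hτ.1.le, hτ.2.trans t.2.2⟩
      rw [← dist_eq_norm]
      refine ((hV τ hτ').dist_le_mul _ _).trans ?_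
      gcongr
      have h1 := hextm y ⟨τ, hτ'⟩
      have h2 := hextm z ⟨τ, hτ'⟩
      simp only at h1 h2
      rw [h1, h2]
      exact ContinuousMap.dist_apply_le_dist _
    refine (intervalIntegral.norm_integral_le_of_norm_le_const hb).trans ?_
    rw [sub_zero, abs_of_nonneg t.2.1, NNReal.coe_mul, Real.coe_toNNReal T hT]
    have := t.2.2
    have h3 : 0 ≤ Λ * dist y z := by positivity
    nlinarith
  let S : Set C(Icc (0 : ℝ) T, E) := {y | ∀ t, y t ∈ K}
  have hS : IsClosed S := by
    have : S = ⋂ t, (fun y : C(Icc (0 : ℝ) T, E) ↦ y t) ⁻¹' K := by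
      ext y
      simp [S]
    rw [this]
    exact isClosed_iInter fun t ↦ hK.preimage (continuous_eval_const t)
  have hmaps : MapsTo Φ S S := by
    intro y hy t
    rw [hΦ]
    refine hinv _ (hext y).continuousOn (fun τ hτ ↦ ?_) t t.2
    have := hextm y ⟨τ, hτ⟩
    simp only at this
    rw [this]
    exact hy _
  have hcontr : ContractingWith (T.toNNReal * Λ) (hmaps.restrict Φ S S) := by
    refine ⟨?_, fun y z ↦ hlip y z⟩
    rw [← NNReal.coe_lt_coe, NNReal.coe_mul, Real.coe_toNNReal T hT]
    exact hTΛ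
  obtain ⟨y, hyS, hfix, -⟩ := hcontr.exists_fixedPoint' hS.isComplete hmaps
    (x := ContinuousMap.const _ y₀) (fun _ ↦ hy₀) (edist_ne_top _ _)
  have hval : ∀ t ∈ Icc 0 T, ext y t = y₀ + ∫ τ in (0 : ℝ)..t, V τ (ext y τ) := by
    intro t ht
    have h1 := hextm y ⟨t, ht⟩
    simp only at h1
    rw [h1, ← hΦ y ⟨t, ht⟩, hfix]
  refine ⟨ext y, ?_, fun t ht ↦ ?_, fun t ht ↦ ?_⟩
  · rw [hval 0 ⟨le_rfl, hT⟩, intervalIntegral.integral_same, add_zero]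
  · have h1 := hextm y ⟨t, ht⟩
    simp only at h1
    rw [h1]
    exact hyS _
  · exact ((hasDerivWithinAt_integral (hVy y) ht).const_add y₀).congr hval (hval t ht)

end ODE

end NonlocalWave

namespace NonlocalWave
open Filter Topology
open scoped ENNReal

/-! ### Fourier transforms of bounded continuous integrable functions -/

/-- Bounded continuous integrable functions. They lie in `L¹ ∩ L²`, and the pointwise Fourier integral
and Fourier inversion are available for them. -/
structure IsBCL1 (f : ℝ → ℂ) : Prop where
  continuous : Continuous f
  integrable : Integrable f volume
  bounded : ∃ C, ∀ x, ‖f x‖ ≤ C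

lemma IsBCL1.memLp {f : ℝ → ℂ} (hf : IsBCL1 f) : MemLp f 2 volume := by
  obtain ⟨C, hC⟩ := hf.bounded
  rw [memLp_two_iff_integrable_sq_norm hf.continuous.aestronglyMeasurable]
  simp only [sq]
  exact hf.integrable.norm.mul_bdd (c := C) hf.continuous.norm.aestronglyMeasurable
    (Eventually.of_forall fun x ↦ by simpa using hC x)

lemma IsBCL1.sub {f g : ℝ → ℂ} (hf : IsBCL1 f) (hg : IsBCL1 g) : IsBCL1 (fun x ↦ f x - g x) := by
  obtain ⟨C, hC⟩ := hf.bounded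
  obtain ⟨D, hD⟩ := hg.bounded
  exact ⟨hf.continuous.sub hg.continuous, hf.integrable.sub hg.integrable, C + D, fun x ↦
    (norm_sub_le _ _).trans (add_le_add (hC x) (hD x))⟩

lemma IsBCL1.add {f g : ℝ → ℂ} (hf : IsBCL1 f) (hg : IsBCL1 g) : IsBCL1 (fun x ↦ f x + g x) := by
  obtain ⟨C, hC⟩ := hf.bounded
  obtain ⟨D, hD⟩ := hg.bounded
  exact ⟨hf.continuous.add hg.continuous, hf.integrable.add hg.integrable, C + D, fun x ↦
    (norm_add_le _ _).trans (add_le_add (hC x) (hD x))⟩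

lemma IsBCL1.mul_bdd {f g : ℝ → ℂ} (hf : IsBCL1 f) (hg : Continuous g) {D : ℝ}
    (hD : ∀ x, ‖g x‖ ≤ D) : IsBCL1 (fun x ↦ g x * f x) := by
  obtain ⟨C, hC⟩ := hf.bounded
  refine ⟨hg.mul hf.continuous, hf.integrable.bdd_mul (c := D) hg.aestronglyMeasurable
    (Eventually.of_forall hD), D * C, fun x ↦ ?_⟩
  rw [norm_mul]
  exact mul_le_mul (hD x) (hC x) (norm_nonneg _) ((norm_nonneg _).trans (hD x))

lemma IsBCL1.comp_add {f : ℝ → ℂ} (hf : IsBCL1 f) (h : ℝ) : IsBCL1 (fun x ↦ f (x + h)) := by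
  obtain ⟨C, hC⟩ := hf.bounded
  exact ⟨hf.continuous.comp (by fun_prop), hf.integrable.comp_add_right h, C, fun x ↦ hC _⟩

lemma continuous_fourier {f : ℝ → ℂ} (hf : Integrable f volume) : Continuous (𝓕 f) :=
  VectorFourier.fourierIntegral_continuous Real.continuous_fourierChar
    (innerSL ℝ).continuous₂ hf

lemma norm_fourier_le {f : ℝ → ℂ} (ξ : ℝ) : ‖𝓕 f ξ‖ ≤ ∫ x, ‖f x‖ :=
  VectorFourier.norm_fourierIntegral_le_integral_norm _ _ _ _ _

lemma integral_fourier_mul {f g : ℝ → ℂ} (hf : Integrable f volume) (hg : Integrable g volume) :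
    ∫ ξ, 𝓕 f ξ * g ξ = ∫ x, f x * 𝓕 g x := by
  have := VectorFourier.integral_bilin_fourierIntegral_eq_flip (ContinuousLinearMap.mul ℂ ℂ)
    (L := innerₗ ℝ) Real.continuous_fourierChar continuous_inner hf hg
  simpa using! this

/-- On `L¹ ∩ L²` the Fourier transform of `L²` is given by the Fourier integral. -/
lemma fourier_toLp_ae_eq {f : ℝ → ℂ} (hf : Integrable f volume) (hf2 : MemLp f 2 volume) :
    (𝓕 (hf2.toLp f) : L2C) =ᵐ[volume] 𝓕 f := by
  refine IsGivenBy.ae_eq (f := ((𝓕 (hf2.toLp f) : L2C) : 𝓢'(ℝ, ℂ))) (isGivenBy_Lp _) fun η ↦ ⟨?_, ?_⟩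
  · exact η.integrable.mul_bdd (c := ∫ x, ‖f x‖) (continuous_fourier hf).aestronglyMeasurable
      (Eventually.of_forall norm_fourier_le)
  · rw [← Lp.fourier_toTemperedDistribution_eq, TemperedDistribution.fourier_apply,
      ((isGivenBy_Lp (hf2.toLp f)).congr hf2.coeFn_toLp _).2]
    rw [SchwartzMap.fourier_coe, integral_fourier_mul η.integrable hf]

lemma lintegral_fourier_sq {f : ℝ → ℂ} (hf : IsBCL1 f) :
    ∫⁻ ξ, ‖𝓕 f ξ‖ₑ ^ 2 = ∫⁻ x, ‖f x‖ₑ ^ 2 := by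
  have h1 : ‖(𝓕 (hf.memLp.toLp f) : L2C)‖ₑ = ‖hf.memLp.toLp f‖ₑ := by
    rw [← ofReal_norm, ← ofReal_norm, Lp.norm_fourier_eq]
  have h2 := congrArg (· ^ 2) h1
  simp only [enorm_sq_eq_lintegral] at h2
  have h3 : ∫⁻ ξ, ‖(𝓕 (hf.memLp.toLp f) : L2C) ξ‖ₑ ^ 2 = ∫⁻ ξ, ‖𝓕 f ξ‖ₑ ^ 2 := by
    refine lintegral_congr_ae ?_
    filter_upwards [fourier_toLp_ae_eq hf.integrable hf.memLp] with ξ h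
    rw [h]
  have h4 : ∫⁻ ξ, ‖(hf.memLp.toLp f) ξ‖ₑ ^ 2 = ∫⁻ ξ, ‖f ξ‖ₑ ^ 2 := by
    refine lintegral_congr_ae ?_
    filter_upwards [hf.memLp.coeFn_toLp] with ξ h
    rw [h]
  rw [← h3, h2, h4]

lemma fourier_comp_add {f : ℝ → ℂ} (h ξ : ℝ) :
    𝓕 (fun x ↦ f (x + h)) ξ = (Real.fourierChar (h * ξ) : ℂ) * 𝓕 f ξ := by
  have := congrFun (VectorFourier.fourierIntegral_comp_add_right Real.fourierChar volume
    (innerₗ ℝ) f h) ξ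
  refine this.trans ?_
  rw [Circle.smul_def, smul_eq_mul]
  simp only [innerₗ_apply_apply, RCLike.inner_apply, conj_trivial, mul_comm ξ h]
  rfl

lemma fourier_add_apply {f g : ℝ → ℂ} (hf : Integrable f volume) (hg : Integrable g volume)
    (ξ : ℝ) : 𝓕 (fun x ↦ f x + g x) ξ = 𝓕 f ξ + 𝓕 g ξ := by
  simp only [Real.fourier_real_eq, smul_add]
  exact integral_add ((Real.fourierIntegral_convergent_iff (μ := volume) ξ).2 hf |>.congr
      (Eventually.of_forall fun x ↦ by simp [mul_comm]))
    ((Real.fourierIntegral_convergent_iff (μ := volume) ξ).2 hg |>.congr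
      (Eventually.of_forall fun x ↦ by simp [mul_comm]))

lemma fourier_const_mul (c : ℂ) (f : ℝ → ℂ) (ξ : ℝ) : 𝓕 (fun x ↦ c * f x) ξ = c * 𝓕 f ξ := by
  simp only [Real.fourier_real_eq, ← integral_const_mul, Circle.smul_def, smul_eq_mul]
  refine integral_congr_ae (Eventually.of_forall fun x ↦ ?_)
  simp only
  ring

lemma fourier_sub_apply {f g : ℝ → ℂ} (hf : Integrable f volume) (hg : Integrable g volume)
    (ξ : ℝ) : 𝓕 (fun x ↦ f x - g x) ξ = 𝓕 f ξ - 𝓕 g ξ := by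
  have h1 : (fun x ↦ f x - g x) = fun x ↦ f x + (-1) * g x := by ext x; ring
  rw [h1, fourier_add_apply hf (hg.const_mul _), fourier_const_mul]
  ring

lemma fourier_translate_sub {f : ℝ → ℂ} (hf : IsBCL1 f) (h ξ : ℝ) :
    𝓕 (fun x ↦ f (x + h) - f x) ξ = ((Real.fourierChar (h * ξ) : ℂ) - 1) * 𝓕 f ξ := by
  rw [fourier_sub_apply (hf.comp_add h).integrable hf.integrable, fourier_comp_add]
  ring

lemma enorm_le_lintegral_fourier {f : ℝ → ℂ} (hf : IsBCL1 f) (x : ℝ) :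
    ‖f x‖ₑ ≤ ∫⁻ ξ, ‖𝓕 f ξ‖ₑ := by
  by_cases h : ∫⁻ ξ, ‖𝓕 f ξ‖ₑ = ⊤
  · rw [h]; exact le_top
  have hi : Integrable (𝓕 f) volume :=
    ⟨(continuous_fourier hf.integrable).aestronglyMeasurable, lt_top_iff_ne_top.2 h⟩
  rw [← congrFun (hf.continuous.fourierInv_fourier_eq hf.integrable hi) x, Real.fourierInv_eq]
  refine (enorm_integral_le_lintegral_enorm _).trans (lintegral_mono fun ξ ↦ ?_)
  rw [← ofReal_norm, ← ofReal_norm, Circle.norm_smul]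

/-! ### Weighted norms on the Fourier side -/

/-- The square of the `H^s` norm, `∫ (1 + ξ²)^s |F(ξ)|² dξ`, of a function with Fourier
transform `F`. -/
noncomputable def sobE (s : ℝ) (F : ℝ → ℂ) : ℝ≥0∞ :=
  ∫⁻ ξ, ENNReal.ofReal (bw (2 * s) ξ) * ‖F ξ‖ₑ ^ 2

lemma sobE_mono {s t : ℝ} (h : s ≤ t) (F : ℝ → ℂ) : sobE s F ≤ sobE t F := by
  refine lintegral_mono fun ξ ↦ ?_
  dsimp only
  gcongr
  exact bw_mono (by linarith) ξ

lemma sobE_zero (F : ℝ → ℂ) : sobE 0 F = ∫⁻ ξ, ‖F ξ‖ₑ ^ 2 := by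
  simp [sobE, bw_zero]

lemma sobE_const_mul (s : ℝ) (c : ℂ) (F : ℝ → ℂ) :
    sobE s (fun ξ ↦ c * F ξ) = ‖c‖ₑ ^ 2 * sobE s F := by
  rw [sobE, sobE, ← lintegral_const_mul' _ _ (by finiteness)]
  refine lintegral_congr fun ξ ↦ ?_
  rw [enorm_mul, mul_pow]
  ring

lemma enorm_add_sq_le {E : Type*} [SeminormedAddCommGroup E] (a b : E) :
    ‖a + b‖ₑ ^ 2 ≤ 2 * ‖a‖ₑ ^ 2 + 2 * ‖b‖ₑ ^ 2 := by
  have h : ‖a + b‖ ^ 2 ≤ 2 * ‖a‖ ^ 2 + 2 * ‖b‖ ^ 2 := by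
    have := norm_add_le a b
    nlinarith [sq_nonneg (‖a‖ - ‖b‖), norm_nonneg (a + b), norm_nonneg a, norm_nonneg b]
  have h2 := ENNReal.ofReal_le_ofReal h
  rw [ENNReal.ofReal_add (by positivity) (by positivity), ENNReal.ofReal_mul (by norm_num),
    ENNReal.ofReal_mul (by norm_num), ENNReal.ofReal_pow (norm_nonneg _),
    ENNReal.ofReal_pow (norm_nonneg _), ENNReal.ofReal_pow (norm_nonneg _), ofReal_norm,
    ofReal_norm, ofReal_norm] at h2
  simpa using h2

lemma measurable_bw_mul {F : ℝ → ℂ} (hF : Measurable F) (s : ℝ) :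
    Measurable fun ξ ↦ ENNReal.ofReal (bw s ξ) * ‖F ξ‖ₑ ^ 2 :=
  ((continuous_bw s).measurable.ennreal_ofReal).mul (hF.enorm.pow_const 2)

lemma sobE_add_le (s : ℝ) {F G : ℝ → ℂ} (hF : Measurable F) :
    sobE s (fun ξ ↦ F ξ + G ξ) ≤ 2 * sobE s F + 2 * sobE s G := by
  rw [sobE, sobE, sobE, ← lintegral_const_mul' _ _ (by finiteness),
    ← lintegral_const_mul' _ _ (by finiteness),
    ← lintegral_add_left ((measurable_bw_mul hF _).const_mul _)]
  refine lintegral_mono fun ξ ↦ ?_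
  dsimp only
  calc _ ≤ ENNReal.ofReal (bw (2 * s) ξ) * (2 * ‖F ξ‖ₑ ^ 2 + 2 * ‖G ξ‖ₑ ^ 2) := by
        gcongr
        exact enorm_add_sq_le _ _
    _ = _ := by ring

lemma lintegral_mul_sq_le {f g : ℝ → ℝ≥0∞} (hf : AEMeasurable f volume)
    (hg : AEMeasurable g volume) :
    (∫⁻ x, f x * g x) ^ 2 ≤ (∫⁻ x, f x ^ 2) * ∫⁻ x, g x ^ 2 := by
  have h := ENNReal.lintegral_mul_le_Lp_mul_Lq volume Real.HolderConjugate.two_two hf hg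
  have h2 := pow_le_pow_left₀ (zero_le) h 2
  refine h2.trans_eq ?_
  rw [mul_pow, ← ENNReal.rpow_natCast, ← ENNReal.rpow_natCast, ← ENNReal.rpow_mul,
    ← ENNReal.rpow_mul]
  simp

/-- Cauchy–Schwarz with the weight: if `s - α > 1/2`, then `∫ (1 + ξ²)^(α/2) |F|` is controlled by
the `H^s` norm. -/
lemma exists_weighted_L1_le {α s : ℝ} (h : α + 1 / 2 < s) : ∃ K : ℝ≥0∞, K ≠ ⊤ ∧
    ∀ F : ℝ → ℂ, Measurable F → (∫⁻ ξ, ENNReal.ofReal (bw α ξ) * ‖F ξ‖ₑ) ^ 2 ≤ K * sobE s F := by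
  refine ⟨∫⁻ ξ, ENNReal.ofReal (bw (2 * (α - s)) ξ), ?_, fun F hF ↦ ?_⟩
  · have h1 := integrable_rpow_neg_one_add_norm_sq (E := ℝ) (μ := volume) (r := 2 * (s - α))
      (by simp; linarith)
    have h2 := h1.lintegral_lt_top
    refine ne_of_lt (lt_of_eq_of_lt (lintegral_congr fun ξ ↦ ?_) h2)
    rw [bw, Real.norm_eq_abs, sq_abs]
    congr 2
    ring
  · have h1 : ∀ ξ, ENNReal.ofReal (bw α ξ) * ‖F ξ‖ₑ =
        ENNReal.ofReal (bw (α - s) ξ) * (ENNReal.ofReal (bw s ξ) * ‖F ξ‖ₑ) := by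
      intro ξ
      rw [← mul_assoc, ← ENNReal.ofReal_mul (bw_pos _ _).le, ← bw_add, sub_add_cancel]
    simp only [h1]
    refine (lintegral_mul_sq_le (continuous_bw _).measurable.ennreal_ofReal.aemeasurable
      ((continuous_bw _).measurable.ennreal_ofReal.mul hF.enorm).aemeasurable).trans_eq ?_
    congr 1
    · refine lintegral_congr fun ξ ↦ ?_
      rw [← ENNReal.ofReal_pow (bw_pos _ _).le, sq, ← bw_add, two_mul]
    · refine lintegral_congr fun ξ ↦ ?_
      rw [Pi.mul_apply, mul_pow, ← ENNReal.ofReal_pow (bw_pos _ _).le, sq, ← bw_add, two_mul]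

/-- The Sobolev embedding `H^s ⊆ L^∞`, `s > 1/2`. -/
lemma exists_sup_le {s : ℝ} (hs : 1 / 2 < s) : ∃ K : ℝ≥0∞, K ≠ ⊤ ∧
    ∀ f : ℝ → ℂ, IsBCL1 f → ∀ x, ‖f x‖ₑ ^ 2 ≤ K * sobE s (𝓕 f) := by
  obtain ⟨K, hK, h⟩ := exists_weighted_L1_le (α := 0) (s := s) (by linarith)
  refine ⟨K, hK, fun f hf x ↦ ?_⟩
  have h1 := h _ (continuous_fourier hf.integrable).measurable
  simp only [bw_zero, ENNReal.ofReal_one, one_mul] at h1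
  exact (pow_le_pow_left₀ zero_le (enorm_le_lintegral_fourier hf x) 2).trans h1

lemma norm_fourierChar_sub_one_le (y : ℝ) : ‖(Real.fourierChar y : ℂ) - 1‖ ≤ 2 * Real.pi * |y| := by
  rw [Real.fourierChar_apply, mul_comm _ Complex.I]
  refine (Real.norm_exp_I_mul_ofReal_sub_one_le).trans_eq ?_
  rw [Real.norm_eq_abs, abs_mul, abs_of_pos Real.two_pi_pos]

lemma norm_fourierChar_sub_one_le_two (y : ℝ) : ‖(Real.fourierChar y : ℂ) - 1‖ ≤ 2 := by
  refine (norm_sub_le _ _).trans ?_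
  rw [Circle.norm_coe, norm_one]
  norm_num

lemma norm_fourierChar_sub_one_le_rpow {α : ℝ} (h0 : 0 ≤ α) (h1 : α ≤ 1) (y : ℝ) :
    ‖(Real.fourierChar y : ℂ) - 1‖ ≤ 2 * Real.pi * |y| ^ α := by
  rcases le_total |y| 1 with hy | hy
  · refine (norm_fourierChar_sub_one_le y).trans ?_
    gcongr
    exact Real.self_le_rpow_of_le_one (abs_nonneg _) hy h1
  · refine (norm_fourierChar_sub_one_le_two y).trans ?_
    have := Real.one_le_rpow hy h0
    nlinarith [Real.pi_gt_three]

lemma abs_rpow_le_bw {α : ℝ} (h0 : 0 ≤ α) (ξ : ℝ) : |ξ| ^ α ≤ bw α ξ := by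
  have h1 : |ξ| ^ α = (ξ ^ 2) ^ (α / 2) := by
    rw [← sq_abs, ← Real.rpow_natCast, ← Real.rpow_mul (abs_nonneg _)]
    congr 1
    push_cast
    ring
  rw [h1, bw]
  gcongr
  linarith

/-- Functions in `H^s` are Hölder continuous of exponent `α ≤ 1` if `s > α + 1/2`. -/
lemma exists_holder_le {α s : ℝ} (h0 : 0 ≤ α) (h1 : α ≤ 1) (h : α + 1 / 2 < s) :
    ∃ K : ℝ≥0∞, K ≠ ⊤ ∧ ∀ f : ℝ → ℂ, IsBCL1 f → ∀ x, ∀ t > 0,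
      ‖f (x + t) - f x‖ₑ ^ 2 ≤ ENNReal.ofReal (t ^ (2 * α)) * (K * sobE s (𝓕 f)) := by
  obtain ⟨K, hK, hK2⟩ := exists_weighted_L1_le h
  refine ⟨ENNReal.ofReal ((2 * Real.pi) ^ 2) * K, by finiteness, fun f hf x t ht ↦ ?_⟩
  have e1 := enorm_le_lintegral_fourier ((hf.comp_add t).sub hf) x
  have e2 : ∫⁻ ξ, ‖𝓕 (fun x ↦ f (x + t) - f x) ξ‖ₑ ≤ ENNReal.ofReal (2 * Real.pi * t ^ α) *
      ∫⁻ ξ, ENNReal.ofReal (bw α ξ) * ‖𝓕 f ξ‖ₑ := by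
    rw [← lintegral_const_mul' _ _ (by finiteness)]
    refine lintegral_mono fun ξ ↦ ?_
    dsimp only
    rw [fourier_translate_sub hf, enorm_mul, ← mul_assoc,
      ← ENNReal.ofReal_mul (by positivity), ← ofReal_norm]
    gcongr
    refine (norm_fourierChar_sub_one_le_rpow h0 h1 _).trans ?_
    rw [abs_mul, abs_of_pos ht, Real.mul_rpow ht.le (abs_nonneg _), mul_assoc (2 * Real.pi)]
    gcongr
    exact abs_rpow_le_bw h0 ξ
  refine (pow_le_pow_left₀ zero_le (e1.trans e2) 2).trans ?_
  rw [mul_pow, ← ENNReal.ofReal_pow (by positivity), mul_pow, ENNReal.ofReal_mul (by positivity)]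
  have e3 : (t ^ α) ^ 2 = t ^ (2 * α) := by
    rw [← Real.rpow_natCast, ← Real.rpow_mul ht.le, mul_comm]
    norm_num
  rw [e3]
  calc _ ≤ ENNReal.ofReal ((2 * Real.pi) ^ 2) * ENNReal.ofReal (t ^ (2 * α)) *
      (K * sobE s (𝓕 f)) := by
        gcongr
        exact hK2 _ (continuous_fourier hf.integrable).measurable
    _ = _ := by ring

end NonlocalWave

namespace NonlocalWave
open Filter Topology
open scoped ENNReal

/-! ### The Gagliardo seminorm -/

/-- The squared `L²` modulus of continuity, `∫ |f(x + h) - f(x)|² dx`. -/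
noncomputable def transE (f : ℝ → ℂ) (h : ℝ) : ℝ≥0∞ := ∫⁻ x, ‖f (x + h) - f x‖ₑ ^ 2

/-- The squared Gagliardo seminorm of order `σ`, with positive increments `h` only. -/
noncomputable def gagliardo (σ : ℝ) (f : ℝ → ℂ) : ℝ≥0∞ :=
  ∫⁻ h in Ioi (0 : ℝ), ENNReal.ofReal (h ^ (-1 - 2 * σ)) * transE f h

/-- The constant relating the Gagliardo seminorm of order `σ` to `∫ |ξ|^(2σ) |𝓕 f|²`. -/
noncomputable def gagConst (σ : ℝ) : ℝ≥0∞ :=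
  ∫⁻ y in Ioi (0 : ℝ), ENNReal.ofReal (y ^ (-1 - 2 * σ)) * ‖(Real.fourierChar y : ℂ) - 1‖ₑ ^ 2

lemma setLIntegral_Ioi_comp_mul {b : ℝ} (hb : 0 < b) {F : ℝ → ℝ≥0∞} (hF : Measurable F) :
    ∫⁻ h in Ioi (0 : ℝ), F (b * h) = ENNReal.ofReal b⁻¹ * ∫⁻ y in Ioi (0 : ℝ), F y := by
  rw [← lintegral_indicator measurableSet_Ioi, ← lintegral_indicator measurableSet_Ioi]
  have h1 : (fun h ↦ (Ioi (0 : ℝ)).indicator (fun h ↦ F (b * h)) h) =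
      fun h ↦ (Ioi (0 : ℝ)).indicator F (b * h) := by
    ext h
    simp only [indicator, mem_Ioi, mul_pos_iff_of_pos_left hb]
  rw [h1, ← lintegral_map (hF.indicator measurableSet_Ioi) (measurable_const_mul b),
    Real.map_volume_mul_left hb.ne', lintegral_smul_measure, abs_of_pos (inv_pos.2 hb), smul_eq_mul]

lemma continuous_fourierChar_sub_one :
    Continuous fun p : ℝ × ℝ ↦ (Real.fourierChar (p.1 * p.2) : ℂ) - 1 := by
  have := Real.continuous_fourierChar
  fun_prop

lemma enorm_fourierChar_abs_sub_one (y : ℝ) :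
    ‖(Real.fourierChar |y| : ℂ) - 1‖ₑ = ‖(Real.fourierChar y : ℂ) - 1‖ₑ := by
  rcases abs_choice y with h | h
  · rw [h]
  · rw [h, ← ofReal_norm, ← ofReal_norm, ← Complex.norm_conj, map_sub, map_one]
    congr 3
    simp [Real.fourierChar_apply, ← Complex.exp_conj, Complex.conj_ofNat]

lemma measurable_rpow_ofReal (a : ℝ) : Measurable fun h : ℝ ↦ ENNReal.ofReal (h ^ a) :=
  (measurable_id.pow_const a).ennreal_ofReal

lemma lintegral_rpow_mul_fourierChar {σ : ℝ} (hσ : 0 < σ) (ξ : ℝ) :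
    ∫⁻ h in Ioi (0 : ℝ), ENNReal.ofReal (h ^ (-1 - 2 * σ)) *
      ‖(Real.fourierChar (h * ξ) : ℂ) - 1‖ₑ ^ 2 = gagConst σ * ENNReal.ofReal (|ξ| ^ (2 * σ)) := by
  rcases eq_or_ne ξ 0 with rfl | hξ
  · have h0 : (0 : ℝ) ^ (2 * σ) = 0 := Real.zero_rpow (by linarith)
    simp [h0]
  have hξ' : 0 < |ξ| := abs_pos.2 hξ
  let k : ℝ → ℝ≥0∞ := fun y ↦
    ENNReal.ofReal (y ^ (-1 - 2 * σ)) * ‖(Real.fourierChar y : ℂ) - 1‖ₑ ^ 2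
  have hk : Measurable k := by
    have h1 : Continuous fun y : ℝ ↦ (Real.fourierChar y : ℂ) - 1 := by
      have := Real.continuous_fourierChar
      fun_prop
    exact (measurable_rpow_ofReal _).mul (h1.measurable.enorm.pow_const 2)
  have h1 : ∀ h ∈ Ioi (0 : ℝ), ENNReal.ofReal (h ^ (-1 - 2 * σ)) *
      ‖(Real.fourierChar (h * ξ) : ℂ) - 1‖ₑ ^ 2 =
      ENNReal.ofReal (|ξ| ^ (1 + 2 * σ)) * k (|ξ| * h) := by
    intro h hh
    have hh' : (0 : ℝ) < h := hh
    simp only [k]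
    have e1 : |ξ| * h = |h * ξ| := by rw [abs_mul, abs_of_pos hh', mul_comm]
    rw [← enorm_fourierChar_abs_sub_one (h * ξ), ← e1, ← mul_assoc,
      ← ENNReal.ofReal_mul (by positivity), Real.mul_rpow hξ'.le hh'.le, ← mul_assoc,
      ← Real.rpow_add hξ']
    have : 1 + 2 * σ + (-1 - 2 * σ) = 0 := by ring
    rw [this, Real.rpow_zero, one_mul]
  rw [setLIntegral_congr_fun measurableSet_Ioi h1, lintegral_const_mul' _ _ (by finiteness),
    setLIntegral_Ioi_comp_mul hξ' hk, ← mul_assoc, ← ENNReal.ofReal_mul (by positivity), mul_comm]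
  congr 2
  rw [← Real.rpow_neg_one, ← Real.rpow_add hξ']
  congr 1
  ring

/-- By Plancherel's theorem the Gagliardo seminorm is a homogeneous Sobolev seminorm. -/
lemma gagliardo_eq {σ : ℝ} (hσ : 0 < σ) {f : ℝ → ℂ} (hf : IsBCL1 f) :
    gagliardo σ f = gagConst σ * ∫⁻ ξ, ENNReal.ofReal (|ξ| ^ (2 * σ)) * ‖𝓕 f ξ‖ₑ ^ 2 := by
  have hm := (continuous_fourier hf.integrable).measurable
  have h1 : ∀ h, ENNReal.ofReal (h ^ (-1 - 2 * σ)) * transE f h =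
      ∫⁻ ξ, ENNReal.ofReal (h ^ (-1 - 2 * σ)) *
        (‖(Real.fourierChar (h * ξ) : ℂ) - 1‖ₑ ^ 2 * ‖𝓕 f ξ‖ₑ ^ 2) := by
    intro h
    rw [lintegral_const_mul' _ _ (by finiteness), transE,
      ← lintegral_fourier_sq ((hf.comp_add h).sub hf)]
    congr 1
    refine lintegral_congr fun ξ ↦ ?_
    rw [fourier_translate_sub hf, enorm_mul, mul_pow]
  simp only [gagliardo, h1]
  rw [lintegral_lintegral_swap]
  · have hmm : Measurable fun ξ : ℝ ↦ ENNReal.ofReal (|ξ| ^ (2 * σ)) * ‖𝓕 f ξ‖ₑ ^ 2 :=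
      ((measurable_id.abs.pow_const _).ennreal_ofReal).mul (hm.enorm.pow_const 2)
    rw [← lintegral_const_mul _ hmm]
    refine lintegral_congr fun ξ ↦ ?_
    simp only [← mul_assoc]
    rw [← lintegral_rpow_mul_fourierChar hσ, lintegral_mul_const']
    finiteness
  · refine Measurable.aemeasurable ?_
    exact ((measurable_rpow_ofReal _).comp measurable_fst).mul
      ((continuous_fourierChar_sub_one.measurable.enorm.pow_const 2).mul
        ((hm.comp measurable_snd).enorm.pow_const 2))

/-- The integrand is of order `h^(2α - 2σ - 1)` at zero and `h^(-1 - 2σ)` at infinity. -/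
lemma lintegral_rpow_min_ne_top {σ α : ℝ} (hσ : 0 < σ) (hα : σ < α) :
    ∫⁻ h in Ioi (0 : ℝ), ENNReal.ofReal (h ^ (-1 - 2 * σ)) *
      ENNReal.ofReal (min 1 (h ^ (2 * α))) ≠ ⊤ := by
  rw [← Ioc_union_Ioi_eq_Ioi (zero_le_one' ℝ), lintegral_union measurableSet_Ioi
    (Set.disjoint_left.2 fun x hx hx' ↦ not_lt.2 hx.2 hx')]
  refine ENNReal.add_ne_top.2 ⟨?_, ?_⟩
  · have hi : IntegrableOn (fun h : ℝ ↦ h ^ (2 * α - 1 - 2 * σ)) (Ioc 0 1) :=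
      (intervalIntegrable_iff_integrableOn_Ioc_of_le zero_le_one).1
        (intervalIntegral.intervalIntegrable_rpow' (by linarith))
    refine ne_top_of_le_ne_top hi.lintegral_lt_top.ne ?_
    refine setLIntegral_mono' measurableSet_Ioc fun h hh ↦ ?_
    rw [← ENNReal.ofReal_mul (Real.rpow_nonneg hh.1.le _)]
    refine ENNReal.ofReal_le_ofReal ?_
    calc h ^ (-1 - 2 * σ) * min 1 (h ^ (2 * α)) ≤ h ^ (-1 - 2 * σ) * h ^ (2 * α) := by
          gcongr
          · exact Real.rpow_nonneg hh.1.le _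
          · exact min_le_right _ _
      _ = h ^ (2 * α - 1 - 2 * σ) := by
          rw [← Real.rpow_add hh.1]
          congr 1
          ring
  · have hi : IntegrableOn (fun h : ℝ ↦ h ^ (-1 - 2 * σ)) (Ioi 1) :=
      integrableOn_Ioi_rpow_of_lt (by linarith) zero_lt_one
    refine ne_top_of_le_ne_top hi.lintegral_lt_top.ne ?_
    refine setLIntegral_mono' measurableSet_Ioi fun h hh ↦ ?_
    have hh' : (1 : ℝ) < h := hh
    rw [← ENNReal.ofReal_mul (by positivity)]
    refine ENNReal.ofReal_le_ofReal ?_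
    exact mul_le_of_le_one_right (by positivity) (min_le_left _ _)

lemma gagConst_ne_top {σ : ℝ} (h0 : 0 < σ) (h1 : σ < 1) : gagConst σ ≠ ⊤ := by
  have h2 := ENNReal.mul_ne_top (a := ENNReal.ofReal (4 * Real.pi ^ 2)) (by finiteness)
    (lintegral_rpow_min_ne_top h0 h1)
  rw [← lintegral_const_mul' _ _ (by finiteness)] at h2
  refine ne_top_of_le_ne_top h2 (setLIntegral_mono' measurableSet_Ioi fun y hy ↦ ?_)
  have hy' : (0 : ℝ) < y := hy
  rw [mul_left_comm, ← ENNReal.ofReal_mul (by positivity)]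
  gcongr
  rw [← ofReal_norm, ← ENNReal.ofReal_pow (norm_nonneg _)]
  refine ENNReal.ofReal_le_ofReal ?_
  have e1 := norm_fourierChar_sub_one_le y
  have e2 := norm_fourierChar_sub_one_le_two y
  rw [abs_of_pos hy'] at e1
  have e3 : y ^ (2 * (1 : ℝ)) = y ^ 2 := by norm_num
  have hn := norm_nonneg ((Real.fourierChar y : ℂ) - 1)
  rw [e3, mul_min_of_nonneg _ _ (by positivity), le_min_iff]
  constructor
  · nlinarith [Real.pi_gt_three]
  · calc _ ≤ (2 * Real.pi * y) ^ 2 := by gcongr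
      _ = _ := by ring

/-- The integrand vanishes only at the integers. -/
lemma gagConst_ne_zero (σ : ℝ) : gagConst σ ≠ 0 := by
  intro h
  have h1 : Continuous fun y : ℝ ↦ (Real.fourierChar y : ℂ) - 1 := by
    have := Real.continuous_fourierChar
    fun_prop
  have hm : Measurable fun y : ℝ ↦
      ENNReal.ofReal (y ^ (-1 - 2 * σ)) * ‖(Real.fourierChar y : ℂ) - 1‖ₑ ^ 2 :=
    (measurable_rpow_ofReal _).mul (h1.measurable.enorm.pow_const 2)
  rw [gagConst, lintegral_eq_zero_iff hm] at h
  have h2 : ∀ᵐ y ∂(volume.restrict (Ioo (0 : ℝ) 1)), False := by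
    filter_upwards [ae_restrict_of_ae_restrict_of_subset Ioo_subset_Ioi_self h,
      ae_restrict_mem measurableSet_Ioo] with y hy hy'
    have hp : 0 < y ^ (-1 - 2 * σ) := Real.rpow_pos_of_pos hy'.1 _
    simp only [Pi.zero_apply, mul_eq_zero, ENNReal.ofReal_eq_zero, not_le.2 hp, false_or,
      pow_eq_zero_iff (two_ne_zero), enorm_eq_zero, sub_eq_zero] at hy
    rw [Real.fourierChar_apply, Complex.exp_eq_one_iff] at hy
    obtain ⟨n, hn⟩ := hy
    have h3 : ((y : ℂ)) = n := by
      have h4 : (2 * Real.pi * Complex.I : ℂ) ≠ 0 := Complex.two_pi_I_ne_zero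
      apply mul_right_cancel₀ h4
      rw [← hn]
      push_cast
      ring
    have h5 : y = n := by exact_mod_cast h3
    have h6 : (0 : ℝ) < n := h5 ▸ hy'.1
    have h7 : (n : ℝ) < 1 := h5 ▸ hy'.2
    have h8 : 0 < n := by exact_mod_cast h6
    have h9 : n < 1 := by exact_mod_cast h7
    omega
  rw [ae_iff] at h2
  simp at h2

lemma gagliardo_le {σ : ℝ} (hσ : 0 < σ) {f : ℝ → ℂ} (hf : IsBCL1 f) :
    gagliardo σ f ≤ gagConst σ * sobE σ (𝓕 f) := by
  rw [gagliardo_eq hσ hf, sobE]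
  gcongr with ξ
  exact abs_rpow_le_bw (by linarith) ξ

lemma sobE_le_gagliardo {σ : ℝ} (h0 : 0 < σ) (h1 : σ < 1) {f : ℝ → ℂ} (hf : IsBCL1 f) :
    sobE σ (𝓕 f) ≤ ENNReal.ofReal (2 ^ σ) *
      ((∫⁻ x, ‖f x‖ₑ ^ 2) + (gagConst σ)⁻¹ * gagliardo σ f) := by
  have hm := (continuous_fourier hf.integrable).measurable
  rw [gagliardo_eq h0 hf, ← mul_assoc, ENNReal.inv_mul_cancel (gagConst_ne_zero σ)
    (gagConst_ne_top h0 h1), one_mul, ← lintegral_fourier_sq hf,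
    ← lintegral_add_left (hm.enorm.pow_const 2), sobE,
    ← lintegral_const_mul' _ _ (by finiteness)]
  refine lintegral_mono fun ξ ↦ ?_
  dsimp only
  have key : bw (2 * σ) ξ ≤ 2 ^ σ * (1 + |ξ| ^ (2 * σ)) := by
    have e1 : |ξ| ^ (2 * σ) = (ξ ^ 2) ^ σ := by
      rw [← sq_abs, ← Real.rpow_natCast, ← Real.rpow_mul (abs_nonneg _)]
      norm_num
    have e2 : 2 * σ / 2 = σ := by ring
    rw [bw, e1, e2]
    rcases le_total (ξ ^ 2) 1 with h | h
    · calc (1 + ξ ^ 2) ^ σ ≤ 2 ^ σ := by gcongr; linarith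
        _ ≤ _ := le_mul_of_one_le_right (by positivity) (by simp; positivity)
    · calc (1 + ξ ^ 2) ^ σ ≤ (2 * ξ ^ 2) ^ σ := by gcongr; linarith
        _ = 2 ^ σ * (ξ ^ 2) ^ σ := by rw [Real.mul_rpow (by norm_num) (by positivity)]
        _ ≤ _ := by gcongr; linarith
  calc _ ≤ ENNReal.ofReal (2 ^ σ * (1 + |ξ| ^ (2 * σ))) * ‖𝓕 f ξ‖ₑ ^ 2 := by gcongr
    _ = _ := by
      rw [ENNReal.ofReal_mul (by positivity), ENNReal.ofReal_add (by norm_num) (by positivity),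
        ENNReal.ofReal_one]
      ring

/-- The Gagliardo seminorm of a product `G v` with `G` Hölder continuous of an exponent greater
than `σ`. -/
lemma exists_gagliardo_mul_le {σ α : ℝ} (hσ : 0 < σ) (hα : σ < α) : ∃ c : ℝ≥0∞, c ≠ ⊤ ∧
    ∀ (G v : ℝ → ℂ) (M H : ℝ≥0∞), M ≠ ⊤ → H ≠ ⊤ → Continuous v → (∀ x, ‖G x‖ₑ ^ 2 ≤ M) →
      (∀ x, ∀ h > 0, ‖G (x + h) - G x‖ₑ ^ 2 ≤ H * ENNReal.ofReal (min 1 (h ^ (2 * α)))) →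
      gagliardo σ (fun x ↦ G x * v x) ≤
        2 * M * gagliardo σ v + 2 * H * c * ∫⁻ x, ‖v x‖ₑ ^ 2 := by
  refine ⟨_, lintegral_rpow_min_ne_top hσ hα, fun G v M H hM hH hv h1 h2 ↦ ?_⟩
  have key : ∀ h > 0, transE (fun x ↦ G x * v x) h ≤ 2 * M * transE v h +
      2 * H * ENNReal.ofReal (min 1 (h ^ (2 * α))) * ∫⁻ x, ‖v x‖ₑ ^ 2 := by
    intro h hh
    rw [transE, transE, ← lintegral_const_mul' _ _ (by finiteness),
      ← lintegral_const_mul' _ _ (by finiteness), ← lintegral_add_right _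
        ((hv.measurable.enorm.pow_const 2).const_mul _)]
    refine lintegral_mono fun x ↦ ?_
    dsimp only
    have e1 : G (x + h) * v (x + h) - G x * v x =
        G (x + h) * (v (x + h) - v x) + (G (x + h) - G x) * v x := by ring
    rw [e1]
    refine (enorm_add_sq_le _ _).trans ?_
    rw [enorm_mul, enorm_mul, mul_pow, mul_pow, mul_assoc 2 M, mul_assoc (2 * H), mul_assoc 2 H,
      ← mul_assoc H]
    gcongr
    · exact h1 _
    · exact h2 x h hh
  calc gagliardo σ (fun x ↦ G x * v x)
      ≤ ∫⁻ h in Ioi (0 : ℝ), (2 * M * (ENNReal.ofReal (h ^ (-1 - 2 * σ)) * transE v h) +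
        2 * H * (∫⁻ x, ‖v x‖ₑ ^ 2) * (ENNReal.ofReal (h ^ (-1 - 2 * σ)) *
          ENNReal.ofReal (min 1 (h ^ (2 * α))))) := by
        refine setLIntegral_mono' measurableSet_Ioi fun h hh ↦ ?_
        calc _ ≤ ENNReal.ofReal (h ^ (-1 - 2 * σ)) * (2 * M * transE v h +
            2 * H * ENNReal.ofReal (min 1 (h ^ (2 * α))) * ∫⁻ x, ‖v x‖ₑ ^ 2) := by
              gcongr
              exact key h hh
          _ = _ := by ring
    _ = _ := by
        have hmm : Measurable fun h : ℝ ↦ ENNReal.ofReal (h ^ (-1 - 2 * σ)) *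
            ENNReal.ofReal (min 1 (h ^ (2 * α))) :=
          (measurable_rpow_ofReal _).mul
            (measurable_const.min (measurable_id.pow_const _)).ennreal_ofReal
        rw [lintegral_add_right _ (hmm.const_mul _), lintegral_const_mul' _ _ (by finiteness),
          lintegral_const_mul _ hmm, gagliardo]
        ring

end NonlocalWave

namespace NonlocalWave
open Filter Topology
open scoped ENNReal

/-! ### Derivatives and products in Sobolev spaces -/

lemma fourier_of_hasDerivAt {f f' : ℝ → ℂ} (hf : IsBCL1 f) (hf' : IsBCL1 f')
    (hd : ∀ x, HasDerivAt f (f' x) x) (ξ : ℝ) :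
    𝓕 f' ξ = (2 * Real.pi * Complex.I * ξ) * 𝓕 f ξ := by
  have h1 : deriv f = f' := funext fun x ↦ (hd x).deriv
  have h2 := Real.fourier_deriv hf.integrable (fun x ↦ (hd x).differentiableAt)
    (h1 ▸ hf'.integrable)
  rw [h1] at h2
  rw [h2]
  rfl

lemma enorm_two_pi_I_mul_sq (ξ : ℝ) :
    ‖(2 * Real.pi * Complex.I * ξ : ℂ)‖ₑ ^ 2 = ENNReal.ofReal ((2 * Real.pi) ^ 2 * ξ ^ 2) := by
  have h : (2 * Real.pi * Complex.I * ξ : ℂ) = ((2 * Real.pi * ξ : ℝ) : ℂ) * Complex.I := by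
    push_cast
    ring
  rw [h, ← ofReal_norm, norm_mul, Complex.norm_I, mul_one, Complex.norm_real, Real.norm_eq_abs,
    ← ENNReal.ofReal_pow (abs_nonneg _), sq_abs, mul_pow]

lemma one_add_sq_mul_bw (s ξ : ℝ) : bw (2 * s) ξ = (1 + ξ ^ 2) * bw (2 * (s - 1)) ξ := by
  have h : 2 * s = 2 + 2 * (s - 1) := by ring
  rw [h, bw_add]
  congr 1
  simp [bw]

lemma sobE_fourier_deriv_le (s : ℝ) {f f' : ℝ → ℂ} (hf : IsBCL1 f) (hf' : IsBCL1 f')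
    (hd : ∀ x, HasDerivAt f (f' x) x) :
    sobE (s - 1) (𝓕 f') ≤ ENNReal.ofReal ((2 * Real.pi) ^ 2) * sobE s (𝓕 f) := by
  rw [sobE, sobE, ← lintegral_const_mul' _ _ (by finiteness)]
  refine lintegral_mono fun ξ ↦ ?_
  dsimp only
  rw [fourier_of_hasDerivAt hf hf' hd, enorm_mul, mul_pow, enorm_two_pi_I_mul_sq, ← mul_assoc,
    ← mul_assoc, ← ENNReal.ofReal_mul (bw_pos _ _).le, ← ENNReal.ofReal_mul (by positivity)]
  gcongr ENNReal.ofReal ?_ * _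
  rw [one_add_sq_mul_bw s ξ]
  have := bw_pos (2 * (s - 1)) ξ
  have h2 : 0 < (2 * Real.pi) ^ 2 := by positivity
  nlinarith [mul_pos this h2]

lemma sobE_le_deriv {s : ℝ} (hs : 0 ≤ s) {f f' : ℝ → ℂ} (hf : IsBCL1 f) (hf' : IsBCL1 f')
    (hd : ∀ x, HasDerivAt f (f' x) x) :
    sobE s (𝓕 f) ≤ ENNReal.ofReal (2 ^ s) * (∫⁻ x, ‖f x‖ₑ ^ 2) + sobE (s - 1) (𝓕 f') := by
  have hm := (continuous_fourier hf.integrable).measurable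
  rw [← lintegral_fourier_sq hf, sobE, sobE, ← lintegral_const_mul' _ _ (by finiteness),
    ← lintegral_add_left ((hm.enorm.pow_const 2).const_mul _)]
  refine lintegral_mono fun ξ ↦ ?_
  dsimp only
  rw [fourier_of_hasDerivAt hf hf' hd, enorm_mul, mul_pow, enorm_two_pi_I_mul_sq, ← mul_assoc,
    ← ENNReal.ofReal_mul (bw_pos _ _).le, ← add_mul, ← ENNReal.ofReal_add (by positivity)
      (mul_nonneg (bw_pos _ _).le (by positivity))]
  gcongr
  rcases le_total (ξ ^ 2) 1 with h | h
  · have h1 : bw (2 * s) ξ ≤ 2 ^ s := by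
      have e2 : 2 * s / 2 = s := by ring
      rw [bw, e2]
      gcongr
      linarith
    have h2 : 0 ≤ bw (2 * (s - 1)) ξ * ((2 * Real.pi) ^ 2 * ξ ^ 2) :=
      mul_nonneg (bw_pos _ _).le (by positivity)
    linarith
  · rw [one_add_sq_mul_bw s ξ]
    have h1 := bw_pos (2 * (s - 1)) ξ
    have h2 : (0 : ℝ) ≤ 2 ^ s := by positivity
    have h4 : 2 ≤ (2 * Real.pi) ^ 2 := by nlinarith [Real.pi_gt_three]
    have h3 : 1 + ξ ^ 2 ≤ (2 * Real.pi) ^ 2 * ξ ^ 2 := by nlinarith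
    nlinarith

/-- The Fourier transform of a product is bounded by the convolution of the absolute values. -/
lemma enorm_fourier_mul_le {f g : ℝ → ℂ} (hf : IsBCL1 f) (hg : IsBCL1 g)
    (hi : Integrable (𝓕 g) volume) (ξ : ℝ) :
    ‖𝓕 (fun x ↦ f x * g x) ξ‖ₑ ≤ ∫⁻ η, ‖𝓕 f (ξ - η)‖ₑ * ‖𝓕 g η‖ₑ := by
  let e : ℝ → ℂ := fun x ↦ (Real.fourierChar (-(x * ξ)) : ℂ) * f x
  have hcont : Continuous fun x : ℝ ↦ (Real.fourierChar (-(x * ξ)) : ℂ) := by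
    have := Real.continuous_fourierChar
    fun_prop
  have he : Integrable e volume := (hf.mul_bdd hcont (D := 1) fun x ↦ (Circle.norm_coe _).le).integrable
  have h1 : 𝓕 (fun x ↦ f x * g x) ξ = ∫ η, 𝓕 e η * 𝓕 g (-η) := by
    have hk : Integrable (fun η ↦ 𝓕 g (-η)) volume := hi.comp_neg
    rw [integral_fourier_mul he hk, Real.fourier_real_eq]
    refine integral_congr_ae (Eventually.of_forall fun x ↦ ?_)
    simp only [e, Circle.smul_def, smul_eq_mul]
    have : 𝓕 (fun η ↦ 𝓕 g (-η)) x = g x := by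
      rw [← Real.fourierInv_eq_fourier_comp_neg]
      exact congrFun (hg.continuous.fourierInv_fourier_eq hg.integrable hi) x
    rw [this]
    ring
  have h2 : ∀ η, 𝓕 e η = 𝓕 f (ξ + η) := by
    intro η
    rw [Real.fourier_real_eq, Real.fourier_real_eq]
    refine integral_congr_ae (Eventually.of_forall fun x ↦ ?_)
    simp only [e, Circle.smul_def, smul_eq_mul]
    rw [← mul_assoc, ← Circle.coe_mul, ← AddChar.map_add_eq_mul]
    congr 4
    ring
  rw [h1]
  refine (enorm_integral_le_lintegral_enorm _).trans_eq ?_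
  rw [← lintegral_neg_eq_self]
  refine lintegral_congr fun η ↦ ?_
  rw [h2, enorm_mul, neg_neg, sub_eq_add_neg]

/-- Young's inequality `L¹ * L² ⊆ L²`. -/
lemma lintegral_conv_sq_le {a b : ℝ → ℝ≥0∞} (ha : Measurable a) (hb : Measurable b) :
    ∫⁻ ξ, (∫⁻ η, a η * b (ξ - η)) ^ 2 ≤ (∫⁻ η, a η) ^ 2 * ∫⁻ ξ, b ξ ^ 2 := by
  have h1 : ∀ ξ, (∫⁻ η, a η * b (ξ - η)) ^ 2 ≤ (∫⁻ η, a η) * ∫⁻ η, a η * b (ξ - η) ^ 2 := by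
    intro ξ
    have hs : ∀ η, (a η ^ (1 / 2 : ℝ)) ^ 2 = a η := fun η ↦ by
      rw [← ENNReal.rpow_natCast, ← ENNReal.rpow_mul]
      norm_num
    have hb' : Measurable fun η ↦ b (ξ - η) := hb.comp (measurable_const.sub measurable_id)
    have h2 := lintegral_mul_sq_le (f := fun η ↦ a η ^ (1 / 2 : ℝ))
      (g := fun η ↦ a η ^ (1 / 2 : ℝ) * b (ξ - η)) (ha.pow_const _).aemeasurable
      ((ha.pow_const _).mul hb').aemeasurable
    simp only [← mul_assoc, ← sq, mul_pow, hs] at h2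
    exact h2
  refine (lintegral_mono h1).trans ?_
  have hjoint : Measurable fun p : ℝ × ℝ ↦ a p.2 * b (p.1 - p.2) ^ 2 :=
    (ha.comp measurable_snd).mul ((hb.comp (measurable_fst.sub measurable_snd)).pow_const 2)
  rw [lintegral_const_mul _ hjoint.lintegral_prod_right', lintegral_lintegral_swap
    hjoint.aemeasurable, sq, mul_assoc]
  gcongr
  rw [← lintegral_mul_const _ ha]
  refine lintegral_mono fun η ↦ ?_
  dsimp only
  have hmb : Measurable fun ξ ↦ b (ξ - η) ^ 2 := (hb.comp (measurable_id.sub_const η)).pow_const 2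
  rw [lintegral_const_mul _ hmb,
    lintegral_sub_right_eq_self (fun ξ ↦ b ξ ^ 2) η]

/-- Peetre-type inequality: `|ξ| ≤ 2 max (|η|, |ξ - η|)`. -/
lemma bw_le_add {s : ℝ} (hs : 0 ≤ s) (ξ η : ℝ) :
    bw s ξ ≤ 2 ^ s * (bw s η + bw s (ξ - η)) := by
  have key : ∀ a b : ℝ, b ^ 2 ≤ a ^ 2 → (1 + ξ ^ 2 ≤ 4 * (1 + a ^ 2)) →
      bw s ξ ≤ 2 ^ s * bw s a := by
    intro a b _ h
    have e1 : (2 : ℝ) ^ s = 4 ^ (s / 2) := by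
      rw [show (4 : ℝ) = 2 ^ (2 : ℝ) by norm_num, ← Real.rpow_mul (by norm_num)]
      congr 1
      ring
    rw [bw, bw, e1, ← Real.mul_rpow (by norm_num) (by positivity)]
    gcongr
  have hp : (0 : ℝ) < 2 ^ s := by positivity
  have e2 : ξ = η + (ξ - η) := by ring
  rw [mul_add]
  rcases le_total (η ^ 2) ((ξ - η) ^ 2) with h | h
  · have := key (ξ - η) η h (by nlinarith [sq_nonneg (η - (ξ - η))])
    have h3 := mul_pos hp (bw_pos s η)
    linarith
  · have := key η (ξ - η) h (by nlinarith [sq_nonneg (η - (ξ - η))])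
    have h3 := mul_pos hp (bw_pos s (ξ - η))
    linarith

lemma ennreal_add_sq_le (a b : ℝ≥0∞) : (a + b) ^ 2 ≤ 2 * a ^ 2 + 2 * b ^ 2 := by
  by_cases ha : a = ⊤
  · simp [ha]
  by_cases hb : b = ⊤
  · simp [hb]
  lift a to NNReal using ha
  lift b to NNReal using hb
  have h : (a + b) ^ 2 ≤ 2 * a ^ 2 + 2 * b ^ 2 := add_sq_le.trans_eq (by ring)
  exact_mod_cast h

/-- `H^s` is an algebra for `s > 1/2`. -/
lemma exists_sobE_mul_le {s : ℝ} (hs : 1 / 2 < s) : ∃ K : ℝ≥0∞, K ≠ ⊤ ∧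
    ∀ f g : ℝ → ℂ, IsBCL1 f → IsBCL1 g → sobE s (𝓕 f) ≠ ⊤ → sobE s (𝓕 g) ≠ ⊤ →
      sobE s (𝓕 fun x ↦ f x * g x) ≤ K * (sobE s (𝓕 f) * sobE s (𝓕 g)) := by
  obtain ⟨K, hK, hL1⟩ := exists_weighted_L1_le (α := 0) (s := s) (by linarith)
  simp only [bw_zero, ENNReal.ofReal_one, one_mul] at hL1
  refine ⟨ENNReal.ofReal ((2 ^ s) ^ 2) * (4 * K), by finiteness, fun f g hf hg hfs hgs ↦ ?_⟩
  have hmf := (continuous_fourier hf.integrable).measurable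
  have hmg := (continuous_fourier hg.integrable).measurable
  have hi : Integrable (𝓕 g) volume := by
    refine ⟨(continuous_fourier hg.integrable).aestronglyMeasurable, ?_⟩
    have h1 := (hL1 _ hmg).trans_lt (ENNReal.mul_lt_top (lt_top_iff_ne_top.2 hK)
      (lt_top_iff_ne_top.2 hgs))
    exact (ENNReal.pow_lt_top_iff.1 h1).resolve_right (by norm_num)
  have hsq : ∀ ξ, ENNReal.ofReal (bw (2 * s) ξ) = ENNReal.ofReal (bw s ξ) ^ 2 := fun ξ ↦ by
    rw [← ENNReal.ofReal_pow (bw_pos _ _).le, sq, ← bw_add, two_mul]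
  let wt : (ℝ → ℂ) → ℝ → ℝ≥0∞ := fun F ξ ↦ ENNReal.ofReal (bw s ξ) * ‖F ξ‖ₑ
  have hwt : ∀ F, ∫⁻ ξ, wt F ξ ^ 2 = sobE s F := fun F ↦
    lintegral_congr fun ξ ↦ by rw [hsq, mul_pow]
  have hwm : ∀ {F : ℝ → ℂ}, Measurable F → Measurable (wt F) := fun hF ↦
    (continuous_bw s).measurable.ennreal_ofReal.mul hF.enorm
  have hpt : ∀ ξ, wt (𝓕 fun x ↦ f x * g x) ξ ≤ ENNReal.ofReal (2 ^ s) *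
      ((∫⁻ η, ‖𝓕 f η‖ₑ * wt (𝓕 g) (ξ - η)) + ∫⁻ η, ‖𝓕 g η‖ₑ * wt (𝓕 f) (ξ - η)) := by
    intro ξ
    have e1 : ∫⁻ η, ‖𝓕 f η‖ₑ * wt (𝓕 g) (ξ - η) = ∫⁻ η, ‖𝓕 f (ξ - η)‖ₑ * wt (𝓕 g) η := by
      rw [← lintegral_sub_left_eq_self _ ξ]
      refine lintegral_congr fun η ↦ ?_
      rw [sub_sub_cancel]
    have hmm : Measurable fun η ↦ ‖𝓕 f (ξ - η)‖ₑ * wt (𝓕 g) η :=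
      (hmf.comp (measurable_const.sub measurable_id)).enorm.mul (hwm hmg)
    rw [e1, ← lintegral_add_left hmm, ← lintegral_const_mul' _ _ (by finiteness)]
    calc wt (𝓕 fun x ↦ f x * g x) ξ
        ≤ ENNReal.ofReal (bw s ξ) * ∫⁻ η, ‖𝓕 f (ξ - η)‖ₑ * ‖𝓕 g η‖ₑ := by
          simp only [wt]
          gcongr
          exact enorm_fourier_mul_le hf hg hi ξ
      _ = ∫⁻ η, ENNReal.ofReal (bw s ξ) * (‖𝓕 f (ξ - η)‖ₑ * ‖𝓕 g η‖ₑ) := by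
          rw [lintegral_const_mul' _ _ (by finiteness)]
      _ ≤ _ := by
          refine lintegral_mono fun η ↦ ?_
          dsimp only
          calc _ ≤ ENNReal.ofReal (2 ^ s * (bw s η + bw s (ξ - η))) *
              (‖𝓕 f (ξ - η)‖ₑ * ‖𝓕 g η‖ₑ) := by
                gcongr
                exact bw_le_add (by linarith) ξ η
            _ = _ := by
                rw [ENNReal.ofReal_mul (by positivity), ENNReal.ofReal_add (bw_pos _ _).le
                  (bw_pos _ _).le]
                simp only [wt]
                ring
  have hconv : ∀ {F G : ℝ → ℂ}, Measurable F → Measurable G →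
      ∫⁻ ξ, (∫⁻ η, ‖F η‖ₑ * wt G (ξ - η)) ^ 2 ≤ K * sobE s F * sobE s G := by
    intro F G hF hG
    refine (lintegral_conv_sq_le hF.enorm (hwm hG)).trans ?_
    rw [hwt]
    gcongr
    exact hL1 F hF
  have hmc : Measurable fun ξ ↦ ∫⁻ η, ‖𝓕 f η‖ₑ * wt (𝓕 g) (ξ - η) := by
    have : Measurable fun p : ℝ × ℝ ↦ ‖𝓕 f p.2‖ₑ * wt (𝓕 g) (p.1 - p.2) :=
      (hmf.comp measurable_snd).enorm.mul ((hwm hmg).comp (measurable_fst.sub measurable_snd))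
    exact this.lintegral_prod_right'
  rw [← hwt]
  calc ∫⁻ ξ, wt (𝓕 fun x ↦ f x * g x) ξ ^ 2
      ≤ ∫⁻ ξ, ENNReal.ofReal ((2 ^ s) ^ 2) * (2 * (∫⁻ η, ‖𝓕 f η‖ₑ * wt (𝓕 g) (ξ - η)) ^ 2 +
          2 * (∫⁻ η, ‖𝓕 g η‖ₑ * wt (𝓕 f) (ξ - η)) ^ 2) := by
        refine lintegral_mono fun ξ ↦ ?_
        dsimp only
        refine (pow_le_pow_left₀ zero_le (hpt ξ) 2).trans ?_
        rw [mul_pow, ENNReal.ofReal_pow (by positivity)]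
        gcongr
        exact ennreal_add_sq_le _ _
    _ ≤ ENNReal.ofReal ((2 ^ s) ^ 2) * (2 * (K * sobE s (𝓕 f) * sobE s (𝓕 g)) +
          2 * (K * sobE s (𝓕 g) * sobE s (𝓕 f))) := by
        rw [lintegral_const_mul' _ _ (by finiteness), lintegral_add_left
          ((hmc.pow_const 2).const_mul _), lintegral_const_mul' _ _ (by finiteness),
          lintegral_const_mul' _ _ (by finiteness)]
        gcongr
        · exact hconv hmf hmg
        · exact hconv hmg hmf
    _ = _ := by ring

end NonlocalWave

namespace NonlocalWave
open Filter Topology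
open scoped ENNReal NNReal

/-! ### Superposition operators on Sobolev spaces -/

lemma exists_lipschitzOnWith {g : ℝ → ℝ} (hg : ContDiff ℝ 1 g) (M : ℝ) :
    ∃ L : ℝ≥0, LipschitzOnWith L g (Icc (-M) M) := by
  obtain ⟨C, hC⟩ := (isCompact_Icc (a := -M) (b := M)).exists_bound_of_continuousOn
    (hg.continuous_deriv le_rfl).continuousOn
  refine ⟨C.toNNReal, (convex_Icc _ _).lipschitzOnWith_of_nnnorm_deriv_le
    (fun x _ ↦ (hg.differentiable (by norm_num)) x) fun x hx ↦ ?_⟩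
  rw [← NNReal.coe_le_coe]
  exact (hC x hx).trans (Real.le_coe_toNNReal C)

/-- The normalized superposition `x ↦ g (Re f(x)) - g 0`. -/
noncomputable def superpose (g : ℝ → ℝ) (f : ℝ → ℂ) : ℝ → ℂ := fun x ↦ ((g (f x).re - g 0 : ℝ) : ℂ)

lemma re_mem_Icc {M : ℝ} {z : ℂ} (h : ‖z‖ ≤ M) : z.re ∈ Icc (-M) M :=
  abs_le.1 ((Complex.abs_re_le_norm z).trans h)

section Lipschitz

variable {g : ℝ → ℝ} {M : ℝ} {L : ℝ≥0} {f : ℝ → ℂ}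

lemma enorm_superpose_sub_le (hL : LipschitzOnWith L g (Icc (-M) M)) (hM : ∀ x, ‖f x‖ ≤ M)
    (x y : ℝ) : ‖superpose g f x - superpose g f y‖ₑ ≤ L * ‖f x - f y‖ₑ := by
  have h1 : superpose g f x - superpose g f y = ((g (f x).re - g (f y).re : ℝ) : ℂ) := by
    simp only [superpose]
    push_cast
    ring
  have h2 := hL (re_mem_Icc (hM x)) (re_mem_Icc (hM y))
  rw [edist_eq_enorm_sub, edist_eq_enorm_sub] at h2
  rw [h1, ← ofReal_norm, Complex.norm_real, ofReal_norm]
  refine h2.trans ?_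
  gcongr
  rw [← Complex.sub_re, ← ofReal_norm, ← ofReal_norm]
  exact ENNReal.ofReal_le_ofReal (Complex.abs_re_le_norm _)

lemma enorm_superpose_le (hL : LipschitzOnWith L g (Icc (-M) M)) (hM : ∀ x, ‖f x‖ ≤ M)
    (x : ℝ) : ‖superpose g f x‖ₑ ≤ L * ‖f x‖ₑ := by
  have h0 : 0 ≤ M := (norm_nonneg _).trans (hM x)
  have h2 := hL (re_mem_Icc (hM x)) (show (0 : ℝ) ∈ Icc (-M) M from ⟨by linarith, h0⟩)
  rw [edist_eq_enorm_sub, edist_eq_enorm_sub, sub_zero] at h2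
  rw [superpose, ← ofReal_norm, Complex.norm_real, ofReal_norm]
  refine h2.trans ?_
  gcongr
  rw [← ofReal_norm, ← ofReal_norm]
  exact ENNReal.ofReal_le_ofReal (Complex.abs_re_le_norm _)

lemma isBCL1_superpose (hg : Continuous g) (hL : LipschitzOnWith L g (Icc (-M) M))
    (hf : IsBCL1 f) (hM : ∀ x, ‖f x‖ ≤ M) : IsBCL1 (superpose g f) := by
  have hc : Continuous (superpose g f) := by
    have := hf.continuous
    unfold superpose
    fun_prop
  have hn : ∀ x, ‖superpose g f x‖ ≤ L * ‖f x‖ := fun x ↦ by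
    have h1 := enorm_superpose_le hL hM x
    rw [← ofReal_norm, ← ofReal_norm, ← ENNReal.ofReal_coe_nnreal,
      ← ENNReal.ofReal_mul (by positivity)] at h1
    exact (ENNReal.ofReal_le_ofReal_iff (by positivity)).1 h1
  refine ⟨hc, (hf.integrable.norm.const_mul (L : ℝ)).mono' hc.aestronglyMeasurable
    (Eventually.of_forall hn), L * M, fun x ↦ (hn x).trans ?_⟩
  gcongr
  exact hM x

lemma lintegral_superpose_le (hL : LipschitzOnWith L g (Icc (-M) M)) (hM : ∀ x, ‖f x‖ ≤ M) :
    ∫⁻ x, ‖superpose g f x‖ₑ ^ 2 ≤ L ^ 2 * ∫⁻ x, ‖f x‖ₑ ^ 2 := by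
  rw [← lintegral_const_mul' _ _ (by finiteness)]
  refine lintegral_mono fun x ↦ ?_
  dsimp only
  rw [← mul_pow]
  gcongr
  exact enorm_superpose_le hL hM x

lemma gagliardo_superpose_le (hL : LipschitzOnWith L g (Icc (-M) M)) (hM : ∀ x, ‖f x‖ ≤ M)
    (σ : ℝ) : gagliardo σ (superpose g f) ≤ L ^ 2 * gagliardo σ f := by
  rw [gagliardo, gagliardo, ← lintegral_const_mul' _ _ (by finiteness)]
  refine lintegral_mono fun h ↦ ?_
  dsimp only
  rw [mul_left_comm]
  gcongr
  rw [transE, transE, ← lintegral_const_mul' _ _ (by finiteness)]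
  refine lintegral_mono fun x ↦ ?_
  dsimp only
  rw [← mul_pow]
  gcongr
  exact enorm_superpose_sub_le hL hM _ _

end Lipschitz

lemma exists_norm_le_of_sobE_le {s : ℝ} (hs : 1 / 2 < s) {R : ℝ≥0∞} (hR : R ≠ ⊤) :
    ∃ M : ℝ, 0 ≤ M ∧ ∀ f : ℝ → ℂ, IsBCL1 f → sobE s (𝓕 f) ≤ R → ∀ x, ‖f x‖ ≤ M := by
  obtain ⟨K, hK, h⟩ := exists_sup_le hs
  refine ⟨Real.sqrt (K * R).toReal, Real.sqrt_nonneg _, fun f hf hfR x ↦ ?_⟩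
  apply Real.le_sqrt_of_sq_le
  have h1 : ‖f x‖ₑ ^ 2 ≤ K * R := (h f hf x).trans (by gcongr)
  have h2 := ENNReal.toReal_mono (by finiteness) h1
  rwa [ENNReal.toReal_pow, toReal_enorm] at h2

lemma isBCL1_schwartz (u : 𝓢(ℝ, ℂ)) : IsBCL1 u := by
  refine ⟨u.continuous, u.integrable, ?_⟩
  obtain ⟨C, -, hC⟩ := u.decay 0 0
  exact ⟨C, fun x ↦ by simpa using hC x⟩

lemma hasDerivAt_schwartz (u : 𝓢(ℝ, ℂ)) (x : ℝ) :
    HasDerivAt u (SchwartzMap.derivCLM ℂ ℂ u x) x :=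
  u.differentiableAt.hasDerivAt

lemma hasDerivAt_re_schwartz {u : 𝓢(ℝ, ℂ)} (hu : ∀ x, (u x).im = 0) (x : ℝ) :
    ∃ d : ℝ, SchwartzMap.derivCLM ℂ ℂ u x = d ∧ HasDerivAt (fun x ↦ (u x).re) d x := by
  have h1 := Complex.reCLM.hasFDerivAt.comp_hasDerivAt x (hasDerivAt_schwartz u x)
  have h2 := Complex.imCLM.hasFDerivAt.comp_hasDerivAt x (hasDerivAt_schwartz u x)
  have h3 : (Complex.imCLM ∘ u) = fun _ ↦ 0 := funext hu
  rw [h3] at h2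
  have h4 := h2.unique (hasDerivAt_const x (0 : ℝ))
  exact ⟨_, Complex.ext rfl h4, h1⟩

lemma hasDerivAt_superpose {g : ℝ → ℝ} (hg : ContDiff ℝ 1 g) {u : 𝓢(ℝ, ℂ)}
    (hu : ∀ x, (u x).im = 0) (x : ℝ) : HasDerivAt (superpose g u)
      (((deriv g (u x).re : ℝ) : ℂ) * SchwartzMap.derivCLM ℂ ℂ u x) x := by
  obtain ⟨d, hd, hd'⟩ := hasDerivAt_re_schwartz hu x
  have h1 : HasDerivAt g (deriv g (u x).re) (u x).re :=
    ((hg.differentiable (by norm_num)) _).hasDerivAt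
  have h2 := ((h1.comp x hd').sub_const (g 0)).ofReal_comp
  rw [hd, ← Complex.ofReal_mul]
  exact h2

/-- The superposition operator of `g` is bounded on bounded subsets of `H^s`, tested on real
Schwartz functions. -/
def SuperposeBounded (s : ℝ) (g : ℝ → ℝ) : Prop :=
  ∀ R : ℝ≥0∞, R ≠ ⊤ → ∃ C : ℝ≥0∞, C ≠ ⊤ ∧ ∀ u : 𝓢(ℝ, ℂ), (∀ x, (u x).im = 0) →
    sobE s (𝓕 (u : ℝ → ℂ)) ≤ R → sobE s (𝓕 (superpose g u)) ≤ C

lemma lintegral_sq_le_sobE {s : ℝ} (hs : 0 ≤ s) {f : ℝ → ℂ} (hf : IsBCL1 f) :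
    ∫⁻ x, ‖f x‖ₑ ^ 2 ≤ sobE s (𝓕 f) := by
  rw [← lintegral_fourier_sq hf, ← sobE_zero]
  exact sobE_mono hs _

/-- For `1/2 < s < 1`, Lipschitz continuity suffices, by the Gagliardo seminorm. -/
lemma superposeBounded_of_lt_one {s : ℝ} (hs : 1 / 2 < s) (hs1 : s < 1) {g : ℝ → ℝ}
    (hg : ContDiff ℝ 1 g) : SuperposeBounded s g := by
  intro R hR
  obtain ⟨M, hM0, hM⟩ := exists_norm_le_of_sobE_le hs hR
  obtain ⟨L, hL⟩ := exists_lipschitzOnWith hg M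
  have hs0 : 0 < s := by linarith
  have hc := gagConst_ne_top hs0 hs1
  have hc0 := ENNReal.inv_ne_top.2 (gagConst_ne_zero s)
  refine ⟨ENNReal.ofReal (2 ^ s) * (L ^ 2 * R + (gagConst s)⁻¹ * (L ^ 2 * (gagConst s * R))),
    by finiteness, fun u hu huR ↦ ?_⟩
  have hbu := isBCL1_schwartz u
  have hMu := hM u hbu huR
  refine (sobE_le_gagliardo hs0 hs1 (isBCL1_superpose hg.continuous hL hbu hMu)).trans ?_
  gcongr
  · refine (lintegral_superpose_le hL hMu).trans ?_
    gcongr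
    exact (lintegral_sq_le_sobE hs0.le hbu).trans huR
  · refine (gagliardo_superpose_le hL hMu s).trans ?_
    gcongr
    exact (gagliardo_le hs0 hbu).trans (by gcongr)

lemma sobE_superpose_le_deriv {s : ℝ} (hs : 0 ≤ s) {g : ℝ → ℝ} (hg : ContDiff ℝ 1 g) {M : ℝ}
    {L : ℝ≥0} (hL : LipschitzOnWith L g (Icc (-M) M)) {u : 𝓢(ℝ, ℂ)} (hu : ∀ x, (u x).im = 0)
    (hM : ∀ x, ‖u x‖ ≤ M)
    (hb : IsBCL1 fun x ↦ ((deriv g (u x).re : ℝ) : ℂ) * SchwartzMap.derivCLM ℂ ℂ u x) :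
    sobE s (𝓕 (superpose g u)) ≤ ENNReal.ofReal (2 ^ s) * (L ^ 2 * sobE s (𝓕 (u : ℝ → ℂ))) +
      sobE (s - 1) (𝓕 fun x ↦ ((deriv g (u x).re : ℝ) : ℂ) * SchwartzMap.derivCLM ℂ ℂ u x) := by
  have hbu := isBCL1_schwartz u
  refine (sobE_le_deriv hs (isBCL1_superpose hg.continuous hL hbu hM) hb
    (hasDerivAt_superpose hg hu)).trans ?_
  gcongr
  refine (lintegral_superpose_le hL hM).trans ?_
  gcongr
  exact lintegral_sq_le_sobE hs hbu

lemma exists_norm_deriv_le {g : ℝ → ℝ} (hg : ContDiff ℝ 1 g) (M : ℝ) :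
    ∃ D : ℝ≥0, ∀ z : ℂ, ‖z‖ ≤ M → ‖((deriv g z.re : ℝ) : ℂ)‖ ≤ D := by
  obtain ⟨C, hC⟩ := (isCompact_Icc (a := -M) (b := M)).exists_bound_of_continuousOn
    (hg.continuous_deriv le_rfl).continuousOn
  refine ⟨C.toNNReal, fun z hz ↦ ?_⟩
  rw [Complex.norm_real]
  exact (hC _ (re_mem_Icc hz)).trans (Real.le_coe_toNNReal C)

/-- For `1 ≤ s < 2`, the derivative `g'(u) u'` is estimated in `H^(s-1)` by the Gagliardo seminorm,
since `g'(u)` is Hölder continuous of an exponent greater than `s - 1`. -/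
lemma superposeBounded_of_lt_two {s : ℝ} (hs : 1 ≤ s) (hs2 : s < 2) {g : ℝ → ℝ}
    (hg : ContDiff ℝ 2 g) : SuperposeBounded s g := by
  intro R hR
  have hg1 : ContDiff ℝ 1 g := hg.of_le (by norm_num)
  have hg' : ContDiff ℝ 1 (deriv g) := by
    have : ContDiff ℝ (1 + 1) g := by simpa [one_add_one_eq_two] using hg
    exact (contDiff_succ_iff_deriv.1 this).2.2
  obtain ⟨M, hM0, hM⟩ := exists_norm_le_of_sobE_le (s := s) (by linarith) hR
  obtain ⟨L, hL⟩ := exists_lipschitzOnWith hg1 M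
  obtain ⟨L', hL'⟩ := exists_lipschitzOnWith hg' M
  obtain ⟨D, hD⟩ := exists_norm_deriv_le hg1 M
  -- it suffices to bound the derivative
  suffices h : ∃ C : ℝ≥0∞, C ≠ ⊤ ∧ ∀ u : 𝓢(ℝ, ℂ), (∀ x, (u x).im = 0) →
      sobE s (𝓕 (u : ℝ → ℂ)) ≤ R → (∀ x, ‖u x‖ ≤ M) →
      IsBCL1 (fun x ↦ ((deriv g (u x).re : ℝ) : ℂ) * SchwartzMap.derivCLM ℂ ℂ u x) →
      sobE (s - 1) (𝓕 fun x ↦ ((deriv g (u x).re : ℝ) : ℂ) * SchwartzMap.derivCLM ℂ ℂ u x) ≤ C by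
    obtain ⟨C, hC, h⟩ := h
    refine ⟨ENNReal.ofReal (2 ^ s) * (L ^ 2 * R) + C, by finiteness, fun u hu huR ↦ ?_⟩
    have hbu := isBCL1_schwartz u
    have hMu := hM u hbu huR
    have hb : IsBCL1 (fun x ↦ ((deriv g (u x).re : ℝ) : ℂ) * SchwartzMap.derivCLM ℂ ℂ u x) := by
      refine (isBCL1_schwartz _).mul_bdd ?_ fun x ↦ hD _ (hMu x)
      have h1 := hg1.continuous_deriv le_rfl
      have h2 := u.continuous
      fun_prop
    refine (sobE_superpose_le_deriv (by linarith) hg1 hL hu hMu hb).trans ?_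
    gcongr
    exact h u hu huR hMu hb
  let P : ℝ≥0∞ := ENNReal.ofReal ((2 * Real.pi) ^ 2) * R
  have hP : P ≠ ⊤ := by finiteness
  have hu' : ∀ u : 𝓢(ℝ, ℂ), sobE s (𝓕 (u : ℝ → ℂ)) ≤ R →
      sobE (s - 1) (𝓕 (SchwartzMap.derivCLM ℂ ℂ u : ℝ → ℂ)) ≤ P := fun u huR ↦
    (sobE_fourier_deriv_le s (isBCL1_schwartz u) (isBCL1_schwartz _)
      (hasDerivAt_schwartz u)).trans (mul_le_mul_right huR _)
  have hL2 : ∀ u : 𝓢(ℝ, ℂ), sobE s (𝓕 (u : ℝ → ℂ)) ≤ R → (∀ x, ‖u x‖ ≤ M) →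
      ∫⁻ x, ‖((deriv g (u x).re : ℝ) : ℂ) * SchwartzMap.derivCLM ℂ ℂ u x‖ₑ ^ 2 ≤ D ^ 2 * P := by
    intro u huR hMu
    calc _ ≤ ∫⁻ x, (D : ℝ≥0∞) ^ 2 * ‖SchwartzMap.derivCLM ℂ ℂ u x‖ₑ ^ 2 := by
          refine lintegral_mono fun x ↦ ?_
          dsimp only
          rw [enorm_mul, mul_pow]
          gcongr
          rw [← ofReal_norm, ← ENNReal.ofReal_coe_nnreal]
          exact ENNReal.ofReal_le_ofReal (hD _ (hMu x))
      _ = D ^ 2 * ∫⁻ x, ‖SchwartzMap.derivCLM ℂ ℂ u x‖ₑ ^ 2 := by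
          rw [lintegral_const_mul' _ _ (by finiteness)]
      _ ≤ _ := by
          gcongr
          exact (lintegral_sq_le_sobE (by linarith) (isBCL1_schwartz _)).trans (hu' u huR)
  rcases hs.eq_or_lt with rfl | hs1
  · refine ⟨D ^ 2 * P, by finiteness, fun u hu huR hMu hb ↦ ?_⟩
    rw [sub_self, sobE_zero, lintegral_fourier_sq hb]
    exact hL2 u huR hMu
  · set σ := s - 1 with hσ
    have hσ0 : 0 < σ := by linarith
    have hσ1 : σ < 1 := by linarith
    have hc := gagConst_ne_top hσ0 hσ1
    have hc0 := ENNReal.inv_ne_top.2 (gagConst_ne_zero σ)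
    -- a Hölder exponent between `σ` and `min 1 (σ + 1/2)`
    obtain ⟨K, hK, hhol⟩ := exists_holder_le (α := (1 + 3 * σ) / 4) (s := s) (by linarith)
      (by linarith) (by linarith)
    obtain ⟨c, hcc, hmul⟩ := exists_gagliardo_mul_le (α := (1 + 3 * σ) / 4) hσ0 (by linarith)
    let H : ℝ≥0∞ := L' ^ 2 * (ENNReal.ofReal ((2 * M) ^ 2) + K * R)
    have hH : H ≠ ⊤ := by finiteness
    refine ⟨ENNReal.ofReal (2 ^ σ) * (D ^ 2 * P + (gagConst σ)⁻¹ *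
      (2 * D ^ 2 * (gagConst σ * P) + 2 * H * c * P)), by finiteness, fun u hu huR hMu hb ↦ ?_⟩
    refine (sobE_le_gagliardo hσ0 hσ1 hb).trans ?_
    have hbu' := isBCL1_schwartz (SchwartzMap.derivCLM ℂ ℂ u)
    gcongr
    · exact hL2 u huR hMu
    · refine (hmul (fun x ↦ ((deriv g (u x).re : ℝ) : ℂ)) _ (D ^ 2) H (by finiteness) hH
        (SchwartzMap.derivCLM ℂ ℂ u).continuous (fun x ↦ ?_) (fun x h hh ↦ ?_)).trans ?_
      · rw [← ofReal_norm, ← ENNReal.ofReal_coe_nnreal]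
        gcongr
        exact hD _ (hMu x)
      · have e1 := enorm_superpose_sub_le (g := deriv g) hL' hMu (x + h) x
        have e2 : superpose (deriv g) u (x + h) - superpose (deriv g) u x =
            ((deriv g (u (x + h)).re : ℝ) : ℂ) - ((deriv g (u x).re : ℝ) : ℂ) := by
          simp [superpose]
        rw [e2] at e1
        refine (pow_le_pow_left₀ zero_le e1 2).trans ?_
        rw [mul_pow]
        simp only [H]
        rw [mul_assoc]
        gcongr
        rcases le_total (h ^ (2 * ((1 + 3 * σ) / 4))) 1 with h1 | h1
        · rw [min_eq_right h1]
          refine (hhol u (isBCL1_schwartz u) x h hh).trans ?_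
          rw [mul_comm]
          gcongr
          exact le_add_left (by gcongr)
        · rw [min_eq_left h1, ENNReal.ofReal_one, mul_one]
          refine le_add_right ?_
          rw [← ofReal_norm, ← ENNReal.ofReal_pow (norm_nonneg _)]
          gcongr
          refine (norm_sub_le _ _).trans ?_
          linarith [hMu (x + h), hMu x]
      · gcongr
        · exact (gagliardo_le hσ0 hbu').trans (by gcongr; exact hu' u huR)
        · exact (lintegral_sq_le_sobE hσ0.le hbu').trans (hu' u huR)

/-- For `s ≥ 2`, the derivative `g'(u) u'` is estimated by the algebra property of `H^(s-1)`. -/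
lemma superposeBounded_succ {s : ℝ} (hs : 2 ≤ s) {g : ℝ → ℝ} (hg : ContDiff ℝ 2 g)
    (h : SuperposeBounded (s - 1) (deriv g)) : SuperposeBounded s g := by
  intro R hR
  have hg1 : ContDiff ℝ 1 g := hg.of_le (by norm_num)
  have hg' : ContDiff ℝ 1 (deriv g) := by
    have : ContDiff ℝ (1 + 1) g := by simpa [one_add_one_eq_two] using hg
    exact (contDiff_succ_iff_deriv.1 this).2.2
  obtain ⟨M, hM0, hM⟩ := exists_norm_le_of_sobE_le (s := s) (by linarith) hR
  obtain ⟨L, hL⟩ := exists_lipschitzOnWith hg1 M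
  obtain ⟨L', hL'⟩ := exists_lipschitzOnWith hg' M
  obtain ⟨C, hC, hCu⟩ := h R hR
  obtain ⟨K, hK, hmul⟩ := exists_sobE_mul_le (s := s - 1) (by linarith)
  let P : ℝ≥0∞ := ENNReal.ofReal ((2 * Real.pi) ^ 2) * R
  have hP : P ≠ ⊤ := by finiteness
  refine ⟨ENNReal.ofReal (2 ^ s) * (L ^ 2 * R) + (2 * (K * (C * P)) +
    2 * (‖((deriv g 0 : ℝ) : ℂ)‖ₑ ^ 2 * P)), by finiteness, fun u hu huR ↦ ?_⟩
  have hbu := isBCL1_schwartz u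
  have hbu' := isBCL1_schwartz (SchwartzMap.derivCLM ℂ ℂ u)
  have hMu := hM u hbu huR
  have hbs := isBCL1_superpose hg'.continuous hL' hbu hMu
  have hu' : sobE (s - 1) (𝓕 (SchwartzMap.derivCLM ℂ ℂ u : ℝ → ℂ)) ≤ P :=
    (sobE_fourier_deriv_le s hbu hbu' (hasDerivAt_schwartz u)).trans (mul_le_mul_right huR _)
  have hsup : sobE (s - 1) (𝓕 (superpose (deriv g) u)) ≤ C :=
    hCu u hu ((sobE_mono (by linarith) _).trans huR)
  obtain ⟨B, hB⟩ := hbs.bounded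
  have hb1 := hbu'.mul_bdd hbs.continuous hB
  have hb2 := hbu'.mul_bdd (g := fun _ ↦ ((deriv g 0 : ℝ) : ℂ)) continuous_const (D := ‖((deriv g 0 : ℝ) : ℂ)‖)
    fun _ ↦ le_rfl
  have hsplit : (fun x ↦ ((deriv g (u x).re : ℝ) : ℂ) * SchwartzMap.derivCLM ℂ ℂ u x) = fun x ↦
      superpose (deriv g) u x * SchwartzMap.derivCLM ℂ ℂ u x +
        ((deriv g 0 : ℝ) : ℂ) * SchwartzMap.derivCLM ℂ ℂ u x := by
    ext x
    simp only [superpose]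
    push_cast
    ring
  have hb : IsBCL1 (fun x ↦ ((deriv g (u x).re : ℝ) : ℂ) * SchwartzMap.derivCLM ℂ ℂ u x) := by
    rw [hsplit]
    exact hb1.add hb2
  refine (sobE_superpose_le_deriv (by linarith) hg1 hL hu hMu hb).trans ?_
  gcongr
  rw [hsplit]
  have hF : 𝓕 (fun x ↦ superpose (deriv g) u x * SchwartzMap.derivCLM ℂ ℂ u x +
      ((deriv g 0 : ℝ) : ℂ) * SchwartzMap.derivCLM ℂ ℂ u x) = fun ξ ↦
      𝓕 (fun x ↦ superpose (deriv g) u x * SchwartzMap.derivCLM ℂ ℂ u x) ξ +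
        ((deriv g 0 : ℝ) : ℂ) * 𝓕 (SchwartzMap.derivCLM ℂ ℂ u : ℝ → ℂ) ξ := by
    ext ξ
    rw [fourier_add_apply hb1.integrable hb2.integrable, fourier_const_mul]
  rw [hF]
  refine (sobE_add_le _ (continuous_fourier hb1.integrable).measurable).trans ?_
  rw [sobE_const_mul]
  gcongr
  exact (hmul _ _ hbs hbu' (ne_top_of_le_ne_top hC hsup) (ne_top_of_le_ne_top hP hu')).trans
    (by gcongr)

/-- If `g` is of class `C^([s]+1)` and `s > 1/2`, then `u ↦ g(u) - g(0)` is bounded on bounded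
subsets of `H^s`. -/
theorem superposeBounded {s : ℝ} (hs : 1 / 2 < s) {g : ℝ → ℝ}
    (hg : ContDiff ℝ ((⌊s⌋₊ + 1 : ℕ) : ℕ∞) g) : SuperposeBounded s g := by
  obtain ⟨n, hn⟩ : ∃ n, ⌊s⌋₊ = n := ⟨_, rfl⟩
  rw [hn] at hg
  induction n generalizing s g with
  | zero =>
    exact superposeBounded_of_lt_one hs (Nat.floor_eq_zero.1 hn) (by simpa using hg)
  | succ n ih =>
    have h1 := (Nat.floor_eq_iff (by linarith)).1 hn
    push_cast at h1
    have hg2 : ContDiff ℝ 2 g := by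
      have h2 : (((2 : ℕ) : ℕ∞) : WithTop ℕ∞) ≤ ((n + 1 + 1 : ℕ) : ℕ∞) := by
        exact_mod_cast (by omega : 2 ≤ n + 1 + 1)
      exact hg.of_le h2
    rcases lt_or_ge s 2 with h2 | h2
    · refine superposeBounded_of_lt_two ?_ h2 hg2
      have : (0 : ℝ) ≤ n := by positivity
      linarith
    · refine superposeBounded_succ h2 hg2 (ih (by linarith) ?_ ?_)
      · have : ContDiff ℝ (((n + 1 : ℕ) : ℕ∞) + 1) g := by exact_mod_cast hg
        exact (contDiff_succ_iff_deriv.1 this).2.2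
      · rw [Nat.floor_sub_one, hn, Nat.add_sub_cancel]

end NonlocalWave

namespace NonlocalWave
open Filter Topology ComplexConjugate
open scoped ENNReal NNReal

/-! ### Bounded subsets of weighted `L²` spaces -/

/-- The weight `(1 + ξ²)^(s/2)` cut off at frequency `N`. -/
noncomputable def cutWeight (s : ℝ) (N : ℕ) (ξ : ℝ) : ℝ := if |ξ| ≤ N then bw s ξ else 0

lemma cutWeight_nonneg (s : ℝ) (N : ℕ) (ξ : ℝ) : 0 ≤ cutWeight s N ξ := by
  unfold cutWeight
  split_ifs
  exacts [(bw_pos _ _).le, le_rfl]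

lemma cutWeight_le (s : ℝ) (N : ℕ) (ξ : ℝ) : cutWeight s N ξ ≤ bw s ξ := by
  unfold cutWeight
  split_ifs
  exacts [le_rfl, (bw_pos _ _).le]

lemma bddSymbol_cutWeight {s : ℝ} (hs : 0 ≤ s) (N : ℕ) : BddSymbol (cutWeight s N) := by
  refine ⟨Measurable.ite (measurableSet_le measurable_id.abs measurable_const)
    (continuous_bw s).measurable measurable_const, bw s N, fun ξ ↦ ?_⟩
  rw [abs_of_nonneg (cutWeight_nonneg _ _ _)]
  unfold cutWeight
  split_ifs with h
  · unfold bw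
    refine Real.rpow_le_rpow (by positivity) ?_ (by linarith)
    linarith [sq_le_sq' (abs_le.1 h).1 (abs_le.1 h).2]
  · exact (bw_pos _ _).le

/-- `(1 + ξ²)^(s/2) x` has `L²` norm at most `M`. Being expressed through the bounded cut-off weights,
this is visibly a closed condition in `L²`. -/
def WeightedLe (s M : ℝ) (x : L2C) : Prop := ∀ N : ℕ, ‖mulOp (cutWeight s N) x‖ ≤ M

lemma isClosed_weightedLe (s M : ℝ) : IsClosed {x | WeightedLe s M x} := by
  have : {x | WeightedLe s M x} = ⋂ N : ℕ, {x | ‖mulOp (cutWeight s N) x‖ ≤ M} := by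
    ext x
    simp [WeightedLe]
  rw [this]
  exact isClosed_iInter fun N ↦ isClosed_le (by fun_prop) continuous_const

lemma WeightedLe.add {s M M' : ℝ} {x y : L2C} (hx : WeightedLe s M x) (hy : WeightedLe s M' y) :
    WeightedLe s (M + M') (x + y) := fun N ↦ by
  rw [map_add]
  exact (norm_add_le _ _).trans (add_le_add (hx N) (hy N))

lemma WeightedLe.mono {s M M' : ℝ} {x : L2C} (hx : WeightedLe s M x) (h : M ≤ M') :
    WeightedLe s M' x := fun N ↦ (hx N).trans h

lemma WeightedLe.map_mulOp {s M : ℝ} (hs : 0 ≤ s) {x : L2C} (hx : WeightedLe s M x) {m : ℝ → ℝ}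
    (hm : Measurable m) {C : ℝ} (hC : ∀ ξ, |m ξ| ≤ C) : WeightedLe s (C * M) (mulOp m x) := by
  intro N
  rw [mulOp_comm (bddSymbol_cutWeight hs N) ⟨hm, C, hC⟩]
  refine (norm_mulOp_apply_le hm hC _).trans ?_
  have : 0 ≤ C := (abs_nonneg _).trans (hC 0)
  gcongr
  exact hx N

lemma WeightedLe.integral {s M : ℝ} {f : ℝ → L2C} {a t : ℝ}
    (hf : IntervalIntegrable f volume a t) (h : ∀ τ ∈ uIoc a t, WeightedLe s M (f τ)) :
    WeightedLe s (M * |t - a|) (∫ τ in a..t, f τ) := by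
  intro N
  have h1 := ((mulOp (cutWeight s N)).restrictScalars ℝ).intervalIntegral_comp_comm hf
  simp only [ContinuousLinearMap.coe_restrictScalars'] at h1
  rw [← h1]
  exact intervalIntegral.norm_integral_le_of_norm_le_const fun τ hτ ↦ h τ hτ N

lemma WeightedLe.of_exists {s M : ℝ} (hs : 0 ≤ s) {b : L2C} (hb : ‖b‖ ≤ M) :
    WeightedLe s M (mulOp (bw (-s)) b) := by
  intro N
  rw [mulOp_mulOp (bddSymbol_cutWeight hs N) (bddSymbol_bw (by linarith))]
  refine (norm_mulOp_apply_le ((bddSymbol_cutWeight hs N).mul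
    (bddSymbol_bw (by linarith))).1 (C := 1) (fun ξ ↦ ?_) b).trans (by linarith)
  rw [abs_of_nonneg (mul_nonneg (cutWeight_nonneg _ _ _) (bw_pos _ _).le)]
  calc _ ≤ bw s ξ * bw (-s) ξ :=
        mul_le_mul_of_nonneg_right (cutWeight_le _ _ _) (bw_pos _ _).le
    _ = 1 := by rw [mul_comm, bw_neg_mul]

/-- The bound yields the function `(1 + ξ²)^(s/2) x` in `L²`, by monotone convergence. -/
lemma WeightedLe.exists_eq {s M : ℝ} (hs : 0 ≤ s) {x : L2C} (h : WeightedLe s M x) :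
    ∃ b : L2C, ‖b‖ ≤ M ∧ mulOp (bw (-s)) b = x := by
  have hM : 0 ≤ M := (norm_nonneg _).trans (h 0)
  have hmeas : AEStronglyMeasurable (fun ξ ↦ (bw s ξ : ℂ) * x ξ) volume :=
    (Complex.continuous_ofReal.comp (continuous_bw s)).aestronglyMeasurable.mul
      (Lp.aestronglyMeasurable x)
  have hcm : ∀ N : ℕ, AEStronglyMeasurable (fun ξ ↦ (cutWeight s N ξ : ℂ) * x ξ) volume := fun N ↦
    (Complex.measurable_ofReal.comp (bddSymbol_cutWeight hs N).1).aestronglyMeasurable.mul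
      (Lp.aestronglyMeasurable x)
  have hlim : Tendsto (fun N : ℕ ↦ ∫⁻ ξ, ‖(cutWeight s N ξ : ℂ) * x ξ‖ₑ ^ 2) atTop
      (𝓝 (∫⁻ ξ, ‖(bw s ξ : ℂ) * x ξ‖ₑ ^ 2)) := by
    refine lintegral_tendsto_of_tendsto_of_monotone (fun N ↦ (hcm N).enorm.pow_const 2) ?_ ?_
    · refine Eventually.of_forall fun ξ N N' hN ↦ ?_
      dsimp only
      rw [enorm_mul, enorm_mul]
      gcongr
      rw [← ofReal_norm, ← ofReal_norm, Complex.norm_real, Complex.norm_real, Real.norm_eq_abs,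
        Real.norm_eq_abs, abs_of_nonneg (cutWeight_nonneg _ _ _),
        abs_of_nonneg (cutWeight_nonneg _ _ _)]
      refine ENNReal.ofReal_le_ofReal ?_
      by_cases h1 : |ξ| ≤ N
      · have h2 : |ξ| ≤ N' := h1.trans (by exact_mod_cast hN)
        simp [cutWeight, h1, h2]
      · simp only [cutWeight, h1, if_false]
        exact cutWeight_nonneg _ _ _
    · refine Eventually.of_forall fun ξ ↦ tendsto_const_nhds.congr' ?_
      obtain ⟨N₀, hN₀⟩ := exists_nat_ge |ξ|
      filter_upwards [eventually_ge_atTop N₀] with N hN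
      have h2 : |ξ| ≤ N := hN₀.trans (by exact_mod_cast hN)
      simp [cutWeight, h2]
  have hle : ∫⁻ ξ, ‖(bw s ξ : ℂ) * x ξ‖ₑ ^ 2 ≤ ENNReal.ofReal M ^ 2 := by
    refine le_of_tendsto' hlim fun N ↦ ?_
    have h1 : ∫⁻ ξ, ‖(cutWeight s N ξ : ℂ) * x ξ‖ₑ ^ 2 = ‖mulOp (cutWeight s N) x‖ₑ ^ 2 := by
      rw [enorm_sq_eq_lintegral]
      refine lintegral_congr_ae ?_
      filter_upwards [coeFn_mulOp (bddSymbol_cutWeight hs N) x] with ξ hξ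
      rw [hξ]
    rw [h1, ← ofReal_norm]
    gcongr
    exact h N
  have hmem : MemLp (fun ξ ↦ (bw s ξ : ℂ) * x ξ) 2 volume := by
    refine ⟨hmeas, ?_⟩
    rw [eLpNorm_lt_top_iff_lintegral_rpow_enorm_lt_top (by norm_num) (by norm_num)]
    simpa using hle.trans_lt (by finiteness)
  refine ⟨hmem.toLp _, ?_, ?_⟩
  · have h1 : ‖hmem.toLp _‖ₑ ^ 2 ≤ ENNReal.ofReal M ^ 2 := by
      rw [enorm_sq_eq_lintegral]
      refine le_trans (le_of_eq (lintegral_congr_ae ?_)) hle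
      filter_upwards [hmem.coeFn_toLp] with ξ hξ
      rw [hξ]
    rw [← ofReal_norm, ← ENNReal.ofReal_pow (norm_nonneg _), ← ENNReal.ofReal_pow hM,
      ENNReal.ofReal_le_ofReal_iff (by positivity)] at h1
    exact le_of_sq_le_sq h1 hM
  · ext1
    filter_upwards [coeFn_mulOp (bddSymbol_bw (by linarith : -s ≤ 0)) (hmem.toLp _),
      hmem.coeFn_toLp] with ξ h1 h2
    rw [h1, h2, ← mul_assoc, ← Complex.ofReal_mul, bw_neg_mul, Complex.ofReal_one, one_mul]

lemma weightedLe_of_sobE_le {s : ℝ} (hs : 0 ≤ s) {F : ℝ → ℂ} {C : ℝ≥0∞} (hC : C ≠ ⊤)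
    (hF : sobE s F ≤ C) {x : L2C} (hx : x =ᵐ[volume] F) : WeightedLe s (Real.sqrt C.toReal) x := by
  intro N
  apply Real.le_sqrt_of_sq_le
  have h1 : ‖mulOp (cutWeight s N) x‖ₑ ^ 2 ≤ C := by
    rw [enorm_sq_eq_lintegral]
    refine (lintegral_mono_ae ?_).trans hF
    filter_upwards [coeFn_mulOp (bddSymbol_cutWeight hs N) x, hx] with ξ h1 h2
    rw [h1, h2, enorm_mul, mul_pow]
    gcongr
    rw [← ofReal_norm, Complex.norm_real, Real.norm_eq_abs,
      abs_of_nonneg (cutWeight_nonneg _ _ _), ← ENNReal.ofReal_pow (cutWeight_nonneg _ _ _)]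
    refine ENNReal.ofReal_le_ofReal ?_
    rw [two_mul, bw_add, sq]
    exact mul_le_mul (cutWeight_le _ _ _) (cutWeight_le _ _ _) (cutWeight_nonneg _ _ _)
      (bw_pos _ _).le
  have h2 := ENNReal.toReal_mono hC h1
  rwa [ENNReal.toReal_pow, toReal_enorm] at h2

/-! ### The truncated nonlinearity as an operator on `L²` -/

/-- `z ↦ g (Re z) - g 0` with `Re z` first projected to `[-M, M]`. It is globally Lipschitz if `g` is
Lipschitz on `[-M, M]`. -/
noncomputable def truncNl (g : ℝ → ℝ) (M : ℝ) (z : ℂ) : ℂ :=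
  ((g (max (-M) (min z.re M)) - g 0 : ℝ) : ℂ)

lemma truncNl_zero (g : ℝ → ℝ) {M : ℝ} (hM : 0 ≤ M) : truncNl g M 0 = 0 := by
  simp [truncNl, hM]

lemma truncNl_eq {g : ℝ → ℝ} {M : ℝ} {z : ℂ} (hz : ‖z‖ ≤ M) :
    truncNl g M z = ((g z.re - g 0 : ℝ) : ℂ) := by
  have h := re_mem_Icc hz
  rw [truncNl, min_eq_left h.2, max_eq_right h.1]

lemma lipschitzWith_truncNl {g : ℝ → ℝ} {M : ℝ} (hM : 0 ≤ M) {L : ℝ≥0}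
    (hL : LipschitzOnWith L g (Icc (-M) M)) : LipschitzWith L (truncNl g M) := by
  have hmem : ∀ y, max (-M) (min y M) ∈ Icc (-M) M := fun y ↦
    ⟨le_max_left _ _, max_le (by linarith) (min_le_right _ _)⟩
  refine LipschitzWith.of_dist_le_mul fun z w ↦ ?_
  have h1 := hL.dist_le_mul _ (hmem z.re) _ (hmem w.re)
  have h2 : dist (truncNl g M z) (truncNl g M w) =
      dist (g (max (-M) (min z.re M))) (g (max (-M) (min w.re M))) := by
    simp only [truncNl]
    rw [Complex.dist_eq, ← Complex.ofReal_sub, Complex.norm_real, Real.dist_eq, Real.norm_eq_abs,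
      sub_sub_sub_cancel_right]
  rw [h2]
  refine h1.trans ?_
  gcongr
  rw [Real.dist_eq, Complex.dist_eq]
  have hclamp : ∀ a b : ℝ, |max (-M) (min a M) - max (-M) (min b M)| ≤ |a - b| := fun a b ↦ by
    grind
  calc _ ≤ |z.re - w.re| := hclamp _ _
    _ ≤ ‖z - w‖ := by rw [← Complex.sub_re]; exact Complex.abs_re_le_norm _

/-- The superposition operator conjugated by the Fourier transform: `x ↦ 𝓕 (G ∘ 𝓕⁻¹ x)`. -/
noncomputable def nlOp {L : ℝ≥0} {G : ℂ → ℂ} (hG : LipschitzWith L G) (h0 : G 0 = 0) (x : L2C) :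
    L2C := 𝓕 (hG.compLp h0 (𝓕⁻ x : L2C))

lemma lipschitzWith_nlOp {L : ℝ≥0} {G : ℂ → ℂ} (hG : LipschitzWith L G) (h0 : G 0 = 0) :
    LipschitzWith L (nlOp hG h0) := by
  refine LipschitzWith.of_dist_le_mul fun x y ↦ ?_
  have h1 := (Lp.fourierTransformₗᵢ ℝ ℂ).dist_map (hG.compLp h0 (𝓕⁻ x : L2C))
    (hG.compLp h0 (𝓕⁻ y : L2C))
  have h2 := (Lp.fourierTransformₗᵢ ℝ ℂ).symm.dist_map x y
  refine (h1.trans_le ?_)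
  rw [← h2]
  exact (hG.lipschitzWith_compLp h0).dist_le_mul _ _

lemma dagger_nlOp {L : ℝ≥0} {g : ℝ → ℝ} {M : ℝ} (hG : LipschitzWith L (truncNl g M))
    (h0 : truncNl g M 0 = 0) (x : L2C) : dagger (nlOp hG h0 x) = nlOp hG h0 x := by
  rw [← isReal_ofWeighted_iff (m := 0), ofWeighted_zero, nlOp, fourierInv_fourier_eq]
  refine isReal_of_isGivenBy (v := fun ξ ↦ g (max (-M) (min ((𝓕⁻ x : L2C) ξ).re M)) - g 0)
    ((isGivenBy_Lp _).congr ?_)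
  filter_upwards [hG.coeFn_compLp h0 (𝓕⁻ x : L2C)] with ξ hξ
  rw [hξ]
  rfl

lemma fourier_conjS (v : 𝓢(ℝ, ℂ)) (ξ : ℝ) : 𝓕 (conjS v) ξ = conj (𝓕 v (-ξ)) := by
  have h1 : ∀ w : 𝓢(ℝ, ℂ), ∀ y, 𝓕⁻ w (-y) = 𝓕 w y := fun w y ↦ by
    rw [SchwartzMap.fourierInv_coe, SchwartzMap.fourier_coe, Real.fourierInv_eq_fourier_neg,
      neg_neg]
  rw [← h1, ← conj_fourierInv]
  congr 1

/-- Real Schwartz functions are dense in the real part of `H^s`. -/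
lemma exists_real_schwartz_near {s : ℝ} (hs : 0 ≤ s) {b : L2C} (hb : dagger b = b) {ε : ℝ}
    (hε : 0 < ε) : ∃ (u : 𝓢(ℝ, ℂ)) (b' : L2C), (∀ x, (u x).im = 0) ∧ ‖b' - b‖ < ε ∧
      (𝓕 (u.toLp 2 : L2C) : L2C) = mulOp (bw (-s)) b' ∧ sobE s (𝓕 (u : ℝ → ℂ)) = ‖b'‖ₑ ^ 2 := by
  have hd := SchwartzMap.denseRange_toLpCLM (E := ℝ) (F := ℂ) (p := 2) ENNReal.ofNat_ne_top
    (μ := volume)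
  obtain ⟨β, hβ⟩ := hd.exists_dist_lt b hε
  have hβ' : ‖(β.toLp 2 : L2C) - b‖ < ε := by
    rw [dist_comm, dist_eq_norm] at hβ
    exact hβ
  -- the real part of the function with Fourier transform `(1 + ξ²)^(-s/2) β`
  let γ : 𝓢(ℝ, ℂ) := SchwartzMap.smulLeftCLM ℂ (fun ξ : ℝ ↦ (bw (-s) ξ : ℂ)) β
  have hγ : ∀ ξ, γ ξ = (bw (-s) ξ : ℂ) * β ξ := fun ξ ↦
    SchwartzMap.smulLeftCLM_apply_apply (hasTemperateGrowth_bw (-s)) β ξ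
  let v : 𝓢(ℝ, ℂ) := 𝓕⁻ γ
  have hv : 𝓕 v = γ := fourier_fourierInv_eq γ
  let u : 𝓢(ℝ, ℂ) := (1 / 2 : ℂ) • (v + conjS v)
  let b' : L2C := (1 / 2 : ℝ) • ((β.toLp 2 : L2C) + dagger (β.toLp 2 : L2C))
  have hFu : ∀ ξ, 𝓕 u ξ = (1 / 2 : ℂ) * (γ ξ + conj (γ (-ξ))) := by
    intro ξ
    have e1 : 𝓕 u = (1 / 2 : ℂ) • (𝓕 v + 𝓕 (conjS v)) := by
      simp only [u, FourierTransform.fourier_smul, FourierTransform.fourier_add]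
    rw [e1, hv]
    simp only [smul_apply, add_apply, smul_eq_mul, fourier_conjS, hv]
  have hb'ae : b' =ᵐ[volume] fun ξ ↦ (1 / 2 : ℂ) * (β ξ + conj (β (-ξ))) := by
    filter_upwards [Lp.coeFn_smul (1 / 2 : ℝ) ((β.toLp 2 : L2C) + dagger (β.toLp 2 : L2C)),
      Lp.coeFn_add (β.toLp 2 : L2C) (dagger (β.toLp 2 : L2C)), coeFn_dagger (β.toLp 2 : L2C),
      β.coeFn_toLp 2 volume, ae_comp_neg (β.coeFn_toLp 2 volume)] with ξ h1 h2 h3 h4 h5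
    simp only [b']
    rw [h1, Pi.smul_apply, h2, Pi.add_apply, h3, h4, h5, Complex.real_smul]
    push_cast
    ring
  have hFb : ∀ ξ, 𝓕 u ξ = (bw (-s) ξ : ℂ) * ((1 / 2 : ℂ) * (β ξ + conj (β (-ξ)))) := by
    intro ξ
    rw [hFu, hγ, hγ, map_mul, Complex.conj_ofReal, bw_even]
    ring
  refine ⟨u, b', fun x ↦ ?_, ?_, ?_, ?_⟩
  · simp only [u, smul_apply, add_apply, conjS_apply, smul_eq_mul]
    simp [Complex.mul_im]
  · have e1 : b' - b = (1 / 2 : ℝ) • (((β.toLp 2 : L2C) - b) + dagger ((β.toLp 2 : L2C) - b)) := by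
      rw [map_sub, hb]
      simp only [b', smul_add, smul_sub]
      have : b = (1 / 2 : ℝ) • b + (1 / 2 : ℝ) • b := by rw [← add_smul]; norm_num
      nth_rewrite 1 [this]
      abel
    have e2 : ∀ y : L2C, ‖dagger y‖ = ‖y‖ := by
      intro y
      rw [← sq_eq_sq₀ (norm_nonneg _) (norm_nonneg _), norm_sq_eq_integral, norm_sq_eq_integral,
        ← integral_neg_eq_self (fun ξ ↦ ‖y ξ‖ ^ 2)]
      refine integral_congr_ae ?_
      filter_upwards [coeFn_dagger y] with ξ hξ
      rw [hξ, RCLike.norm_conj]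
    rw [e1, norm_smul]
    have e3 := norm_add_le ((β.toLp 2 : L2C) - b) (dagger ((β.toLp 2 : L2C) - b))
    rw [e2] at e3
    rw [Real.norm_of_nonneg (by norm_num)]
    linarith
  · rw [SchwartzMap.toLp_fourier_eq]
    ext1
    filter_upwards [(𝓕 u).coeFn_toLp 2 volume, coeFn_mulOp (bddSymbol_bw (by linarith : -s ≤ 0)) b',
      hb'ae] with ξ h1 h2 h3
    rw [h1, h2, h3, hFb]
  · rw [enorm_sq_eq_lintegral, sobE]
    refine lintegral_congr_ae ?_
    filter_upwards [hb'ae] with ξ h3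
    rw [← SchwartzMap.fourier_coe, hFb, h3, enorm_mul, mul_pow, ← mul_assoc, ← ofReal_norm,
      Complex.norm_real, Real.norm_of_nonneg (bw_pos _ _).le,
      ← ENNReal.ofReal_pow (bw_pos _ _).le, ← ENNReal.ofReal_mul (bw_pos _ _).le, sq, ← bw_add,
      ← bw_add]
    have : 2 * s + (-s + -s) = 0 := by ring
    rw [this, bw_zero, ENNReal.ofReal_one, one_mul]

lemma isClosed_ae_norm_le (M : ℝ) : IsClosed {f : L2C | ∀ᵐ x, ‖f x‖ ≤ M} := by
  refine IsSeqClosed.isClosed fun f f₀ hf hlim ↦ ?_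
  obtain ⟨n, -, hn⟩ := (tendstoInMeasure_of_tendsto_Lp hlim).exists_seq_tendsto_ae
  have h1 : ∀ᵐ x, ∀ i, ‖f i x‖ ≤ M := ae_all_iff.2 hf
  filter_upwards [hn, h1] with x hx h1
  exact le_of_tendsto' hx.norm fun i ↦ h1 _

lemma contDiff_one_of_floor {s : ℝ} {g : ℝ → ℝ} (hg : ContDiff ℝ ((⌊s⌋₊ + 1 : ℕ) : ℕ∞) g) :
    ContDiff ℝ 1 g := by
  have h2 : (((1 : ℕ) : ℕ∞) : WithTop ℕ∞) ≤ ((⌊s⌋₊ + 1 : ℕ) : ℕ∞) := by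
    exact_mod_cast (by omega : 1 ≤ ⌊s⌋₊ + 1)
  exact hg.of_le h2

/-- The truncated nonlinearity maps bounded subsets of the real part of `H^s` to bounded subsets of
`H^s`, provided that the truncation level exceeds the supremum norm; the bound does not depend on
the level. The bound passes from Schwartz functions to their limits because it is closed in `L²`. -/
theorem exists_nlOp_bound {s : ℝ} (hs : 1 / 2 < s) {g : ℝ → ℝ}
    (hg : ContDiff ℝ ((⌊s⌋₊ + 1 : ℕ) : ℕ∞) g) (B : ℝ) : ∃ M₀ C : ℝ, 0 ≤ M₀ ∧ 0 ≤ C ∧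
      ∀ b : L2C, dagger b = b → ‖b‖ ≤ B →
        (∀ᵐ x, ‖(𝓕⁻ (mulOp (bw (-s)) b) : L2C) x‖ ≤ M₀) ∧
        ∀ (M : ℝ) (L : ℝ≥0) (hG : LipschitzWith L (truncNl g M)) (h0 : truncNl g M 0 = 0),
          M₀ ≤ M → WeightedLe s C (nlOp hG h0 (mulOp (bw (-s)) b)) := by
  let R : ℝ≥0∞ := ENNReal.ofReal (B + 1) ^ 2
  have hR : R ≠ ⊤ := by finiteness
  have hs0 : 0 ≤ s := by linarith
  obtain ⟨M₀, hM₀, hsup⟩ := exists_norm_le_of_sobE_le hs hR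
  obtain ⟨C, hC, hbd⟩ := superposeBounded hs hg R hR
  have hg1 := contDiff_one_of_floor hg
  refine ⟨M₀, Real.sqrt C.toReal, hM₀, Real.sqrt_nonneg _, fun b hb hbB ↦ ?_⟩
  choose u b' hu hb' hFu hE using fun n : ℕ ↦ exists_real_schwartz_near hs0 hb
    (ε := 1 / ((n : ℝ) + 1)) (by positivity)
  have hlim : Tendsto b' atTop (𝓝 b) := by
    rw [tendsto_iff_norm_sub_tendsto_zero]
    exact squeeze_zero (fun _ ↦ norm_nonneg _) (fun n ↦ (hb' n).le)
      tendsto_one_div_add_atTop_nhds_zero_nat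
  have hER : ∀ n, sobE s (𝓕 (u n : ℝ → ℂ)) ≤ R := by
    intro n
    rw [hE, ← ofReal_norm]
    simp only [R]
    gcongr
    have h1 : ‖b' n‖ ≤ ‖b' n - b‖ + ‖b‖ := by simpa using norm_add_le (b' n - b) b
    have h2 : 1 / ((n : ℝ) + 1) ≤ 1 := by
      rw [div_le_one (by positivity)]
      linarith [(Nat.cast_nonneg n : (0 : ℝ) ≤ n)]
    linarith [hb' n]
  have hMu : ∀ n x, ‖u n x‖ ≤ M₀ := fun n ↦ hsup _ (isBCL1_schwartz _) (hER n)
  have hFinv : ∀ n, (𝓕⁻ (mulOp (bw (-s)) (b' n)) : L2C) = (u n).toLp 2 := fun n ↦ by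
    rw [← hFu, fourierInv_fourier_eq]
  have hlim2 : Tendsto (fun n ↦ mulOp (bw (-s)) (b' n)) atTop (𝓝 (mulOp (bw (-s)) b)) :=
    ((mulOp (bw (-s))).continuous.tendsto b).comp hlim
  constructor
  · have h1 : Tendsto (fun n ↦ (𝓕⁻ (mulOp (bw (-s)) (b' n)) : L2C)) atTop
        (𝓝 (𝓕⁻ (mulOp (bw (-s)) b))) :=
      ((fourierInvCLM ℂ L2C).continuous.tendsto _).comp hlim2
    refine (isClosed_ae_norm_le M₀).mem_of_tendsto h1 (Eventually.of_forall fun n ↦ ?_)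
    rw [hFinv]
    simp only [mem_ofPred_eq]
    filter_upwards [(u n).coeFn_toLp 2 volume] with x hx
    rw [hx]
    exact hMu n x
  · intro M L hG h0 hM
    refine (isClosed_weightedLe s _).mem_of_tendsto
      (((lipschitzWith_nlOp hG h0).continuous.tendsto _).comp hlim2)
      (Eventually.of_forall fun n ↦ ?_)
    obtain ⟨L', hL'⟩ := exists_lipschitzOnWith hg1 M₀
    have hbs := isBCL1_superpose hg1.continuous hL' (isBCL1_schwartz (u n)) (hMu n)
    refine weightedLe_of_sobE_le hs0 hC (hbd (u n) (hu n) (hER n)) ?_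
    have h3 : hG.compLp h0 ((u n).toLp 2 : L2C) = hbs.memLp.toLp _ := by
      ext1
      filter_upwards [hG.coeFn_compLp h0 ((u n).toLp 2 : L2C), hbs.memLp.coeFn_toLp,
        (u n).coeFn_toLp 2 volume] with x h1 h2 h3
      rw [h1, h2, Function.comp_apply, h3, truncNl_eq ((hMu n x).trans hM)]
      rfl
    simp only [Function.comp_apply, nlOp]
    rw [hFinv, h3]
    exact fourier_toLp_ae_eq hbs.integrable hbs.memLp

end NonlocalWave

namespace NonlocalWave
open Filter Topology
open scoped ENNReal NNReal

/-! ### The linear propagator -/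

/-- A positive even frequency `ω` comparable with `(1 + ξ²)^(κ/2)` away from the origin (and bounded
by it near the origin), together with a bounded even symbol `q`. -/
structure Dispersion (κ : ℝ) (ω q : ℝ → ℝ) : Prop where
  exponent_nonneg : 0 ≤ κ
  meas : Measurable ω
  pos : ∀ ξ, 0 < ω ξ
  even : ∀ ξ, ω (-ξ) = ω ξ
  le_bw : ∃ C, ∀ ξ, ω ξ ≤ C * bw κ ξ
  bw_le : ∃ C, ∀ ξ, 1 ≤ |ξ| → bw κ ξ ≤ C * ω ξ
  forcing_bdd : BddSymbol q
  forcing_even : ∀ ξ, q (-ξ) = q ξ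

/-- The symbol `cos (t ω)`. -/
noncomputable def cosSym (ω : ℝ → ℝ) (t ξ : ℝ) : ℝ := Real.cos (t * ω ξ)

/-- The symbol `sin (t ω)`. -/
noncomputable def sinSym (ω : ℝ → ℝ) (t ξ : ℝ) : ℝ := Real.sin (t * ω ξ)

/-- The symbol `sin (t ω) / ω`. -/
noncomputable def sincSym (ω : ℝ → ℝ) (t ξ : ℝ) : ℝ := Real.sin (t * ω ξ) / ω ξ

/-- The symbol `(1 + ξ²)^(κ/2) sin (t ω) / ω`. -/
noncomputable def sigmaSym (κ : ℝ) (ω : ℝ → ℝ) (t ξ : ℝ) : ℝ := bw κ ξ * sincSym ω t ξ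

/-- The normalized frequency `(1 + ξ²)^(-κ/2) ω`. -/
noncomputable def relFreq (κ : ℝ) (ω : ℝ → ℝ) (ξ : ℝ) : ℝ := bw (-κ) ξ * ω ξ

lemma SymbolFamily.mono {S S' : Set ℝ} {C : ℝ} {m : ℝ → ℝ → ℝ} (h : SymbolFamily S C m)
    (hS : S' ⊆ S) : SymbolFamily S' C m :=
  ⟨fun t ht ↦ h.meas t (hS ht), fun t ht ↦ h.bdd t (hS ht), fun ξ ↦ (h.cont ξ).mono hS⟩

lemma SymbolFamily.const_mul {S : Set ℝ} {C D : ℝ} {m : ℝ → ℝ → ℝ} (h : SymbolFamily S C m)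
    {n : ℝ → ℝ} (hn : Measurable n) (hD : ∀ ξ, |n ξ| ≤ D) :
    SymbolFamily S (D * C) (fun t ξ ↦ n ξ * m t ξ) :=
  ⟨fun t ht ↦ hn.mul (h.meas t ht), fun t ht ξ ↦ by
    rw [abs_mul]
    exact mul_le_mul (hD ξ) (h.bdd t ht ξ) (abs_nonneg _) ((abs_nonneg _).trans (hD ξ)),
    fun ξ ↦ (h.cont ξ).const_mul _⟩

lemma SymbolFamily.neg {S : Set ℝ} {C : ℝ} {m : ℝ → ℝ → ℝ} (h : SymbolFamily S C m) :
    SymbolFamily S C (fun t ξ ↦ -m t ξ) :=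
  ⟨fun t ht ↦ (h.meas t ht).neg, fun t ht ξ ↦ by rw [abs_neg]; exact h.bdd t ht ξ,
    fun ξ ↦ (h.cont ξ).neg⟩

section Symbols

variable {κ : ℝ} {ω q : ℝ → ℝ}

lemma Dispersion.family_cos (hω : Dispersion κ ω q) (S : Set ℝ) : SymbolFamily S 1 (cosSym ω) :=
  ⟨fun t _ ↦ Real.continuous_cos.measurable.comp (hω.meas.const_mul t),
    fun _ _ _ ↦ Real.abs_cos_le_one _, fun ξ ↦ by unfold cosSym; fun_prop⟩

lemma Dispersion.family_sin (hω : Dispersion κ ω q) (S : Set ℝ) : SymbolFamily S 1 (sinSym ω) :=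
  ⟨fun t _ ↦ Real.continuous_sin.measurable.comp (hω.meas.const_mul t),
    fun _ _ _ ↦ Real.abs_sin_le_one _, fun ξ ↦ by unfold sinSym; fun_prop⟩

lemma Dispersion.meas_sincSym (hω : Dispersion κ ω q) (t : ℝ) : Measurable (sincSym ω t) :=
  (Real.continuous_sin.measurable.comp (hω.meas.const_mul t)).div hω.meas

lemma Dispersion.abs_sincSym_le (hω : Dispersion κ ω q) {t : ℝ} (ht : t ∈ Icc (0 : ℝ) 1) (ξ : ℝ) :
    |sincSym ω t ξ| ≤ 1 := by
  have hp := hω.pos ξ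
  rw [sincSym, abs_div, abs_of_pos hp, div_le_one hp]
  refine Real.abs_sin_le_abs.trans ?_
  rw [abs_mul, abs_of_pos hp, abs_of_nonneg ht.1]
  nlinarith [ht.2]

lemma Dispersion.family_sinc (hω : Dispersion κ ω q) : SymbolFamily (Icc 0 1) 1 (sincSym ω) :=
  ⟨fun t _ ↦ hω.meas_sincSym t, fun _ ht ξ ↦ hω.abs_sincSym_le ht ξ,
    fun ξ ↦ by unfold sincSym; fun_prop⟩

/-- For bounded times the symbol `(1 + ξ²)^(κ/2) sin (t ω) / ω` is bounded, also at low frequencies,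
where `ω` may be much smaller than the weight. -/
lemma Dispersion.exists_family_sigma (hω : Dispersion κ ω q) :
    ∃ C, 0 ≤ C ∧ SymbolFamily (Icc 0 1) C (sigmaSym κ ω) := by
  obtain ⟨C, hC⟩ := hω.bw_le
  refine ⟨max C (bw κ 1), le_max_of_le_right (bw_pos _ _).le,
    fun t _ ↦ (continuous_bw κ).measurable.mul (hω.meas_sincSym t), fun t ht ξ ↦ ?_,
    fun ξ ↦ (hω.family_sinc.cont ξ).const_mul _⟩
  rw [sigmaSym, abs_mul, abs_of_pos (bw_pos _ _)]
  have hp := hω.pos ξ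
  rcases le_or_gt 1 |ξ| with h | h
  · refine le_trans ?_ (le_max_left _ _)
    rw [sincSym, abs_div, abs_of_pos hp, mul_div_assoc', div_le_iff₀ hp]
    calc _ ≤ bw κ ξ * 1 := mul_le_mul_of_nonneg_left (Real.abs_sin_le_one _) (bw_pos _ _).le
      _ ≤ C * ω ξ := by rw [mul_one]; exact hC ξ h
  · refine le_trans ?_ (le_max_right _ _)
    calc _ ≤ bw κ ξ * 1 :=
          mul_le_mul_of_nonneg_left (hω.abs_sincSym_le ht ξ) (bw_pos _ _).le
      _ ≤ bw κ 1 := by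
        rw [mul_one]
        refine Real.rpow_le_rpow (by positivity) ?_ (by linarith [hω.exponent_nonneg])
        have := sq_lt_sq' (abs_lt.1 h).1 (abs_lt.1 h).2
        linarith

lemma Dispersion.bdd_sigma (hω : Dispersion κ ω q) {t : ℝ} (ht : t ∈ Icc (0 : ℝ) 1) :
    BddSymbol (sigmaSym κ ω t) := by
  obtain ⟨C, -, hC⟩ := hω.exists_family_sigma
  exact hC.bddSymbol ht

lemma Dispersion.exists_abs_relFreq_le (hω : Dispersion κ ω q) :
    ∃ C, ∀ ξ, |relFreq κ ω ξ| ≤ C := by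
  obtain ⟨C, hC⟩ := hω.le_bw
  refine ⟨C, fun ξ ↦ ?_⟩
  rw [relFreq, abs_of_pos (mul_pos (bw_pos _ _) (hω.pos ξ)), bw_neg, inv_mul_le_iff₀ (bw_pos _ _),
    mul_comm]
  exact hC ξ

lemma Dispersion.bdd_relFreq (hω : Dispersion κ ω q) : BddSymbol (relFreq κ ω) :=
  ⟨(continuous_bw _).measurable.mul hω.meas, hω.exists_abs_relFreq_le⟩

lemma Dispersion.bdd_bw (hω : Dispersion κ ω q) : BddSymbol (bw (-κ)) :=
  bddSymbol_bw (by linarith [hω.exponent_nonneg])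

lemma hasDerivAt_cosSym (ω : ℝ → ℝ) (t ξ : ℝ) :
    HasDerivAt (fun τ ↦ cosSym ω τ ξ) (-(ω ξ * sinSym ω t ξ)) t := by
  have := (Real.hasDerivAt_cos (t * ω ξ)).comp t ((hasDerivAt_id t).mul_const (ω ξ))
  refine this.congr_deriv ?_
  simp only [sinSym]
  ring

lemma hasDerivAt_sinSym (ω : ℝ → ℝ) (t ξ : ℝ) :
    HasDerivAt (fun τ ↦ sinSym ω τ ξ) (ω ξ * cosSym ω t ξ) t := by
  have := (Real.hasDerivAt_sin (t * ω ξ)).comp t ((hasDerivAt_id t).mul_const (ω ξ))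
  refine this.congr_deriv ?_
  simp only [cosSym]
  ring

/-- The solution operator of the linear equation, applied to `y = (P, R)`: with `P`, `R` constant in
time, this is the solution with Fourier transform `P` and velocity `(1 + ξ²)^(κ/2) R` at `t = 0`. -/
noncomputable def position (κ : ℝ) (ω : ℝ → ℝ) (t : ℝ) (y : L2C × L2C) : L2C :=
  mulOp (cosSym ω t) y.1 + mulOp (sigmaSym κ ω t) y.2

/-- The velocity that belongs to `position`, divided by `(1 + ξ²)^(κ/2)`. -/
noncomputable def velocity (κ : ℝ) (ω : ℝ → ℝ) (t : ℝ) (y : L2C × L2C) : L2C :=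
  mulOp (cosSym ω t) y.2 - mulOp (relFreq κ ω) (mulOp (sinSym ω t) y.1)

variable {T : ℝ}

lemma Dispersion.hasDerivWithinAt_bw_cos (hω : Dispersion κ ω q) (T : ℝ) {t : ℝ}
    (ht : t ∈ Icc 0 T) {x : ℝ → L2C} {x' : L2C} (hx : HasDerivWithinAt x x' (Icc 0 T) t) :
    HasDerivWithinAt (fun τ ↦ mulOp (bw (-κ)) (mulOp (cosSym ω τ) (x τ)))
      (mulOp (bw (-κ)) (mulOp (cosSym ω t) x') -
        mulOp (relFreq κ ω) (mulOp (sinSym ω t) (x t))) (Icc 0 T) t := by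
  obtain ⟨C, hC⟩ := hω.bdd_bw.2
  obtain ⟨D, hD⟩ := hω.exists_abs_relFreq_le
  have h1 := (hω.family_cos (Icc 0 T)).const_mul hω.bdd_bw.1 hC
  have h2 := ((hω.family_sin (Icc 0 T)).const_mul hω.bdd_relFreq.1 hD).neg
  have h3 := h1.hasDerivWithinAt (convex_Icc 0 T) h2 (fun ξ τ _ ↦ by
    refine (((hasDerivAt_cosSym ω τ ξ).const_mul (bw (-κ) ξ)).congr_deriv ?_).hasDerivWithinAt
    simp only [relFreq]
    ring) ht hx
  have hc : ∀ τ, BddSymbol (cosSym ω τ) := fun τ ↦ (hω.family_cos univ).bddSymbol (mem_univ τ)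
  have hs : ∀ τ, BddSymbol (sinSym ω τ) := fun τ ↦ (hω.family_sin univ).bddSymbol (mem_univ τ)
  simp only [mulOp_mulOp hω.bdd_bw (hc _), mulOp_mulOp hω.bdd_relFreq (hs _)]
  refine h3.congr_deriv ?_
  rw [mulOp_neg (hω.bdd_relFreq.mul (hs t)), sub_eq_add_neg, add_comm]

lemma Dispersion.hasDerivWithinAt_bw_sin (hω : Dispersion κ ω q) (T : ℝ) {t : ℝ}
    (ht : t ∈ Icc 0 T) {x : ℝ → L2C} {x' : L2C} (hx : HasDerivWithinAt x x' (Icc 0 T) t) :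
    HasDerivWithinAt (fun τ ↦ mulOp (bw (-κ)) (mulOp (sinSym ω τ) (x τ)))
      (mulOp (bw (-κ)) (mulOp (sinSym ω t) x') +
        mulOp (relFreq κ ω) (mulOp (cosSym ω t) (x t))) (Icc 0 T) t := by
  obtain ⟨C, hC⟩ := hω.bdd_bw.2
  obtain ⟨D, hD⟩ := hω.exists_abs_relFreq_le
  have h1 := (hω.family_sin (Icc 0 T)).const_mul hω.bdd_bw.1 hC
  have h2 := (hω.family_cos (Icc 0 T)).const_mul hω.bdd_relFreq.1 hD
  have h3 := h1.hasDerivWithinAt (convex_Icc 0 T) h2 (fun ξ τ _ ↦ by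
    refine (((hasDerivAt_sinSym ω τ ξ).const_mul (bw (-κ) ξ)).congr_deriv ?_).hasDerivWithinAt
    simp only [relFreq]
    ring) ht hx
  have hc : ∀ τ, BddSymbol (cosSym ω τ) := fun τ ↦ (hω.family_cos univ).bddSymbol (mem_univ τ)
  have hs : ∀ τ, BddSymbol (sinSym ω τ) := fun τ ↦ (hω.family_sin univ).bddSymbol (mem_univ τ)
  simp only [mulOp_mulOp hω.bdd_bw (hs _), mulOp_mulOp hω.bdd_relFreq (hc _)]
  rwa [add_comm] at h3

lemma Dispersion.hasDerivWithinAt_sinc (hω : Dispersion κ ω q) (hT : T ≤ 1) {t : ℝ}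
    (ht : t ∈ Icc 0 T) {x : ℝ → L2C} {x' : L2C} (hx : HasDerivWithinAt x x' (Icc 0 T) t) :
    HasDerivWithinAt (fun τ ↦ mulOp (sincSym ω τ) (x τ))
      (mulOp (sincSym ω t) x' + mulOp (cosSym ω t) (x t)) (Icc 0 T) t := by
  have h1 := hω.family_sinc.mono (Icc_subset_Icc_right hT)
  have h3 := h1.hasDerivWithinAt (convex_Icc 0 T) (hω.family_cos (Icc 0 T)) (fun ξ τ _ ↦ by
    refine (((hasDerivAt_sinSym ω τ ξ).div_const (ω ξ)).congr_deriv ?_).hasDerivWithinAt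
    have := (hω.pos ξ).ne'
    field_simp) ht hx
  rwa [add_comm] at h3

section Algebra

variable (hω : Dispersion κ ω q) {t : ℝ} (ht : t ∈ Icc (0 : ℝ) 1)
include hω

lemma Dispersion.bdd_cos (t : ℝ) : BddSymbol (cosSym ω t) :=
  (hω.family_cos univ).bddSymbol (mem_univ t)

lemma Dispersion.bdd_sin (t : ℝ) : BddSymbol (sinSym ω t) :=
  (hω.family_sin univ).bddSymbol (mem_univ t)

lemma Dispersion.cos_cos_add_sin_sin (x : L2C) :
    mulOp (cosSym ω t) (mulOp (cosSym ω t) x) + mulOp (sinSym ω t) (mulOp (sinSym ω t) x) = x := by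
  rw [mulOp_mulOp (hω.bdd_cos t) (hω.bdd_cos t), mulOp_mulOp (hω.bdd_sin t) (hω.bdd_sin t),
    ← mulOp_add ((hω.bdd_cos t).mul (hω.bdd_cos t)) ((hω.bdd_sin t).mul (hω.bdd_sin t))]
  have h1 : (fun ξ ↦ cosSym ω t ξ * cosSym ω t ξ + sinSym ω t ξ * sinSym ω t ξ) = fun _ ↦ 1 := by
    ext ξ
    rw [cosSym, sinSym]
    linarith [Real.cos_sq_add_sin_sq (t * ω ξ)]
  rw [h1, mulOp_one]

include ht

lemma Dispersion.bdd_sinc : BddSymbol (sincSym ω t) := hω.family_sinc.bddSymbol ht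

lemma Dispersion.bw_sigma (x : L2C) :
    mulOp (bw (-κ)) (mulOp (sigmaSym κ ω t) x) = mulOp (sincSym ω t) x := by
  rw [mulOp_mulOp hω.bdd_bw (hω.bdd_sigma ht)]
  congr 2
  ext ξ
  rw [sigmaSym, ← mul_assoc, bw_neg_mul, one_mul]

lemma Dispersion.relFreq_sigma (x : L2C) :
    mulOp (relFreq κ ω) (mulOp (sigmaSym κ ω t) x) = mulOp (sinSym ω t) x := by
  rw [mulOp_mulOp hω.bdd_relFreq (hω.bdd_sigma ht)]
  congr 2
  ext ξ
  have := (hω.pos ξ).ne'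
  rw [sigmaSym, relFreq, mul_mul_mul_comm, bw_neg_mul, one_mul, sincSym, sinSym]
  field_simp

lemma Dispersion.relFreq_sinc (x : L2C) :
    mulOp (relFreq κ ω) (mulOp (sincSym ω t) x) = mulOp (bw (-κ)) (mulOp (sinSym ω t) x) := by
  rw [← hω.bw_sigma ht, mulOp_comm hω.bdd_relFreq hω.bdd_bw, hω.relFreq_sigma ht]

end Algebra

/-- Variation of constants: if `P' = σ w` and `R' = -cos w`, then the time derivative of the
position is the velocity (in the weaker norm in which the velocity is defined). -/
lemma Dispersion.hasDerivWithinAt_position (hω : Dispersion κ ω q) (hT : T ≤ 1) {t : ℝ}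
    (ht : t ∈ Icc 0 T) {y : ℝ → L2C × L2C} {w : L2C}
    (h1 : HasDerivWithinAt (fun τ ↦ (y τ).1) (mulOp (sigmaSym κ ω t) w) (Icc 0 T) t)
    (h2 : HasDerivWithinAt (fun τ ↦ (y τ).2) (-mulOp (cosSym ω t) w) (Icc 0 T) t) :
    HasDerivWithinAt (fun τ ↦ mulOp (bw (-κ)) (position κ ω τ (y τ))) (velocity κ ω t (y t))
      (Icc 0 T) t := by
  have hsub : Icc 0 T ⊆ Icc (0 : ℝ) 1 := Icc_subset_Icc_right hT
  have h3 := (hω.hasDerivWithinAt_bw_cos T ht h1).add (hω.hasDerivWithinAt_sinc hT ht h2)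
  refine (h3.congr (fun τ hτ ↦ ?_) ?_).congr_deriv ?_
  · simp only [position, map_add, Pi.add_apply, hω.bw_sigma (hsub hτ)]
  · simp only [position, map_add, Pi.add_apply, hω.bw_sigma (hsub ht)]
  · rw [mulOp_comm (hω.bdd_cos t) (hω.bdd_sigma (hsub ht)), hω.bw_sigma (hsub ht), map_neg,
      velocity]
    abel

lemma Dispersion.hasDerivWithinAt_velocity (hω : Dispersion κ ω q) (hT : T ≤ 1) {t : ℝ}
    (ht : t ∈ Icc 0 T) {y : ℝ → L2C × L2C} {w : L2C}
    (h1 : HasDerivWithinAt (fun τ ↦ (y τ).1) (mulOp (sigmaSym κ ω t) w) (Icc 0 T) t)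
    (h2 : HasDerivWithinAt (fun τ ↦ (y τ).2) (-mulOp (cosSym ω t) w) (Icc 0 T) t) :
    HasDerivWithinAt (fun τ ↦ mulOp (bw (-κ)) (velocity κ ω τ (y τ)))
      (-mulOp (relFreq κ ω) (mulOp (relFreq κ ω) (position κ ω t (y t))) - mulOp (bw (-κ)) w)
      (Icc 0 T) t := by
  have ht1 : t ∈ Icc (0 : ℝ) 1 := Icc_subset_Icc_right hT ht
  have h3 := (hω.hasDerivWithinAt_bw_cos T ht h2).sub
    (((mulOp (relFreq κ ω)).restrictScalars ℝ).hasFDerivAt.comp_hasDerivWithinAt t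
      (hω.hasDerivWithinAt_bw_sin T ht h1))
  refine (h3.congr (fun τ hτ ↦ ?_) ?_).congr_deriv ?_
  · simp only [velocity, map_sub, Pi.sub_apply, Function.comp_apply,
      ContinuousLinearMap.coe_restrictScalars', mulOp_comm hω.bdd_bw hω.bdd_relFreq]
  · simp only [velocity, map_sub, Pi.sub_apply, Function.comp_apply,
      ContinuousLinearMap.coe_restrictScalars', mulOp_comm hω.bdd_bw hω.bdd_relFreq]
  · have e1 := congrArg (mulOp (bw (-κ))) (hω.cos_cos_add_sin_sin (t := t) w)
    rw [map_add] at e1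
    simp only [ContinuousLinearMap.coe_restrictScalars', map_add, map_neg, position,
      mulOp_comm (hω.bdd_sin t) (hω.bdd_sigma ht1), hω.relFreq_sigma ht1]
    rw [mulOp_comm hω.bdd_relFreq hω.bdd_bw, hω.relFreq_sigma ht1, ← e1]
    abel

/-- Inverting the variation of constants: a curve with velocity `Z` whose acceleration is that of
the linear equation plus `-w` has coefficients `P`, `R` with `P' = σ w` and `R' = -cos w`. The
identities hold after two applications of the smoothing operator. -/
lemma Dispersion.hasDerivWithinAt_coefficients (hω : Dispersion κ ω q) (hT : T ≤ 1) {t : ℝ}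
    (ht : t ∈ Icc 0 T) {A Z : ℝ → L2C} {w : L2C}
    (h1 : HasDerivWithinAt (fun τ ↦ mulOp (bw (-κ)) (A τ)) (Z t) (Icc 0 T) t)
    (h2 : HasDerivWithinAt (fun τ ↦ mulOp (bw (-κ)) (Z τ))
      (-mulOp (relFreq κ ω) (mulOp (relFreq κ ω) (A t)) - mulOp (bw (-κ)) w) (Icc 0 T) t) :
    HasDerivWithinAt (fun τ ↦ mulOp (bw (-κ)) (mulOp (bw (-κ))
        (mulOp (cosSym ω τ) (A τ) - mulOp (sigmaSym κ ω τ) (Z τ))))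
      (mulOp (bw (-κ)) (mulOp (bw (-κ)) (mulOp (sigmaSym κ ω t) w))) (Icc 0 T) t ∧
    HasDerivWithinAt (fun τ ↦ mulOp (bw (-κ)) (mulOp (bw (-κ))
        (mulOp (relFreq κ ω) (mulOp (sinSym ω τ) (A τ)) + mulOp (cosSym ω τ) (Z τ))))
      (mulOp (bw (-κ)) (mulOp (bw (-κ)) (-mulOp (cosSym ω t) w))) (Icc 0 T) t := by
  have hsub : Icc 0 T ⊆ Icc (0 : ℝ) 1 := Icc_subset_Icc_right hT
  have hJ := hω.bdd_bw
  have hr := hω.bdd_relFreq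
  have hs := hω.bdd_sin
  have hc := hω.bdd_cos
  constructor
  · have h3 := (hω.hasDerivWithinAt_bw_cos T ht h1).sub (hω.hasDerivWithinAt_sinc hT ht h2)
    have key : ∀ τ ∈ Icc 0 T, mulOp (bw (-κ)) (mulOp (bw (-κ))
        (mulOp (cosSym ω τ) (A τ) - mulOp (sigmaSym κ ω τ) (Z τ))) =
        mulOp (bw (-κ)) (mulOp (cosSym ω τ) (mulOp (bw (-κ)) (A τ))) -
          mulOp (sincSym ω τ) (mulOp (bw (-κ)) (Z τ)) := fun τ hτ ↦ by
      rw [map_sub, map_sub, mulOp_comm hJ (hc τ), hω.bw_sigma (hsub hτ),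
        mulOp_comm hJ (hω.bdd_sinc (hsub hτ))]
    refine (h3.congr key (key t ht)).congr_deriv ?_
    have e := hω.bdd_sinc (hsub ht)
    rw [map_sub, map_neg, mulOp_comm e hr, mulOp_comm e hr, hω.relFreq_sinc (hsub ht),
      mulOp_comm hr hJ, mulOp_comm e hJ, hω.bw_sigma (hsub ht), mulOp_comm hJ (hc t),
      mulOp_comm (hs t) hJ, mulOp_comm hr hJ]
    abel
  · have h3 := (((mulOp (relFreq κ ω)).restrictScalars ℝ).hasFDerivAt.comp_hasDerivWithinAt t
      (hω.hasDerivWithinAt_bw_sin T ht h1)).add (hω.hasDerivWithinAt_bw_cos T ht h2)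
    have key : ∀ τ ∈ Icc 0 T, mulOp (bw (-κ)) (mulOp (bw (-κ))
        (mulOp (relFreq κ ω) (mulOp (sinSym ω τ) (A τ)) + mulOp (cosSym ω τ) (Z τ))) =
        mulOp (relFreq κ ω) (mulOp (bw (-κ)) (mulOp (sinSym ω τ) (mulOp (bw (-κ)) (A τ)))) +
          mulOp (bw (-κ)) (mulOp (cosSym ω τ) (mulOp (bw (-κ)) (Z τ))) := fun τ _ ↦ by
      rw [map_add, map_add, mulOp_comm hJ hr, mulOp_comm hJ (hs τ), mulOp_comm hJ hr,
        mulOp_comm hJ (hc τ)]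
    refine (h3.congr key (key t ht)).congr_deriv ?_
    simp only [ContinuousLinearMap.coe_restrictScalars', map_add, map_sub, map_neg]
    rw [mulOp_comm hr hJ, mulOp_comm (hc t) hJ, mulOp_comm (hc t) hr, mulOp_comm (hc t) hr,
      mulOp_comm (hc t) hJ, mulOp_comm hJ hr, mulOp_comm hJ hr, mulOp_comm hJ hr,
      mulOp_comm (hs t) hJ]
    abel

end Symbols

end NonlocalWave

namespace NonlocalWave
open Filter Topology
open scoped ENNReal NNReal

/-! ### Existence for the truncated problem -/

section Field

variable {κ : ℝ} {ω q : ℝ → ℝ}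

/-- The right-hand side of the ordinary differential equation for the coefficients `(P, R)` of the
variation of constants formula, with nonlinearity `G`. -/
noncomputable def field (κ : ℝ) (ω q : ℝ → ℝ) {L : ℝ≥0} {G : ℂ → ℂ} (hG : LipschitzWith L G)
    (h0 : G 0 = 0) (t : ℝ) (y : L2C × L2C) : L2C × L2C :=
  (mulOp (sigmaSym κ ω t) (mulOp q (nlOp hG h0 (position κ ω t y))),
    -mulOp (cosSym ω t) (mulOp q (nlOp hG h0 (position κ ω t y))))

lemma lipschitzWith_mulOp {m : ℝ → ℝ} (hm : Measurable m) {C : ℝ} (hC : ∀ ξ, |m ξ| ≤ C) :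
    LipschitzWith C.toNNReal (mulOp m) := by
  refine LipschitzWith.of_dist_le_mul fun x y ↦ ?_
  rw [dist_eq_norm, dist_eq_norm, ← map_sub,
    Real.coe_toNNReal C ((abs_nonneg _).trans (hC 0))]
  exact norm_mulOp_apply_le hm hC _

lemma Dispersion.exists_lipschitzWith_field (hω : Dispersion κ ω q) {L : ℝ≥0} {G : ℂ → ℂ}
    (hG : LipschitzWith L G) (h0 : G 0 = 0) :
    ∃ Λ : ℝ≥0, ∀ t ∈ Icc (0 : ℝ) 1, LipschitzWith Λ (field κ ω q hG h0 t) := by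
  obtain ⟨C, hC, hσ⟩ := hω.exists_family_sigma
  obtain ⟨D, hD⟩ := hω.forcing_bdd.2
  let Λ : ℝ≥0 := D.toNNReal * (L * ((1 : ℝ).toNNReal * 1 + C.toNNReal * 1))
  refine ⟨max (C.toNNReal * Λ) ((1 : ℝ).toNNReal * Λ), fun t ht ↦ ?_⟩
  have h1 := lipschitzWith_mulOp (hσ.meas t ht) (hσ.bdd t ht)
  have h2 := lipschitzWith_mulOp (hω.bdd_cos t).1 ((hω.family_cos univ).bdd t (mem_univ t))
  have h3 := lipschitzWith_mulOp hω.forcing_bdd.1 hD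
  have h4 : LipschitzWith _ (position κ ω t) :=
    (h2.comp LipschitzWith.prod_fst).add (h1.comp LipschitzWith.prod_snd)
  have h5 := h3.comp ((lipschitzWith_nlOp hG h0).comp h4)
  exact (h1.comp h5).prodMk (h2.comp h5).neg

lemma Dispersion.continuousOn_position (hω : Dispersion κ ω q) {T : ℝ} (hT : T ≤ 1)
    {P R : ℝ → L2C} (hP : ContinuousOn P (Icc 0 T)) (hR : ContinuousOn R (Icc 0 T)) :
    ContinuousOn (fun t ↦ position κ ω t (P t, R t)) (Icc 0 T) := by
  obtain ⟨C, hC, hσ⟩ := hω.exists_family_sigma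
  exact ((hω.family_cos _).continuousOn hP).add
    ((hσ.mono (Icc_subset_Icc_right hT)).continuousOn hR)

lemma Dispersion.continuousOn_velocity (hω : Dispersion κ ω q) {T : ℝ}
    {P R : ℝ → L2C} (hP : ContinuousOn P (Icc 0 T)) (hR : ContinuousOn R (Icc 0 T)) :
    ContinuousOn (fun t ↦ velocity κ ω t (P t, R t)) (Icc 0 T) :=
  ((hω.family_cos _).continuousOn hR).sub
    ((mulOp (relFreq κ ω)).continuous.comp_continuousOn ((hω.family_sin _).continuousOn hP))

lemma Dispersion.continuousOn_field (hω : Dispersion κ ω q) {L : ℝ≥0} {G : ℂ → ℂ}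
    (hG : LipschitzWith L G) (h0 : G 0 = 0) {T : ℝ} (hT : T ≤ 1) {y : ℝ → L2C × L2C}
    (hy : ContinuousOn y (Icc 0 T)) :
    ContinuousOn (fun t ↦ field κ ω q hG h0 t (y t)) (Icc 0 T) := by
  obtain ⟨C, hC, hσ⟩ := hω.exists_family_sigma
  have h1 := hω.continuousOn_position hT (continuous_fst.comp_continuousOn hy)
    (continuous_snd.comp_continuousOn hy)
  have h2 := (mulOp q).continuous.comp_continuousOn
    ((lipschitzWith_nlOp hG h0).continuous.comp_continuousOn h1)
  exact ((hσ.mono (Icc_subset_Icc_right hT)).continuousOn h2).prodMk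
    ((hω.family_cos _).continuousOn h2).neg

/-- Pairs of Fourier transforms of real functions with `H^s` norms at most `R`. -/
def realBall (s R : ℝ) : Set (L2C × L2C) :=
  {y | (WeightedLe s R y.1 ∧ dagger y.1 = y.1) ∧ WeightedLe s R y.2 ∧ dagger y.2 = y.2}

lemma isClosed_realBall (s R : ℝ) : IsClosed (realBall s R) := by
  have h : IsClosed {x : L2C | WeightedLe s R x ∧ dagger x = x} :=
    (isClosed_weightedLe s R).inter (isClosed_eq dagger.continuous continuous_id)
  exact (h.preimage continuous_fst).inter (h.preimage continuous_snd)

lemma Dispersion.sigmaSym_even (hω : Dispersion κ ω q) (t ξ : ℝ) :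
    sigmaSym κ ω t (-ξ) = sigmaSym κ ω t ξ := by
  simp only [sigmaSym, sincSym, hω.even, bw_even]

lemma Dispersion.cosSym_even (hω : Dispersion κ ω q) (t ξ : ℝ) :
    cosSym ω t (-ξ) = cosSym ω t ξ := by
  simp only [cosSym, hω.even]

lemma dagger_eq_of_mulOp_bw {s : ℝ} (hs : 0 ≤ s) {b x : L2C} (h : mulOp (bw (-s)) b = x)
    (hx : dagger x = x) : dagger b = b := by
  have hb := bddSymbol_bw (s := -s) (by linarith)
  apply mulOp_injective hb (bw_ne_zero _)
  rw [← dagger_mulOp hb (bw_even _), h, hx]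

/-- On bounded sets of real functions in `H^s` the position is bounded in the supremum norm, and the
field is real and bounded in `H^s`; the bound does not depend on the truncation level. -/
lemma Dispersion.exists_field_bound (hω : Dispersion κ ω q) {s : ℝ} (hs : 1 / 2 < s) {g : ℝ → ℝ}
    (hg : ContDiff ℝ ((⌊s⌋₊ + 1 : ℕ) : ℕ∞) g) (R : ℝ) : ∃ M D : ℝ, 0 ≤ M ∧ 0 ≤ D ∧
      ∀ t ∈ Icc (0 : ℝ) 1, ∀ y ∈ realBall s R,
        (∀ᵐ x, ‖(𝓕⁻ (position κ ω t y) : L2C) x‖ ≤ M) ∧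
        ∀ (L : ℝ≥0) (hG : LipschitzWith L (truncNl g M)) (h0 : truncNl g M 0 = 0),
          field κ ω q hG h0 t y ∈ realBall s D := by
  have hs0 : 0 ≤ s := by linarith
  obtain ⟨C, hC, hσ⟩ := hω.exists_family_sigma
  obtain ⟨Q, hQ⟩ := hω.forcing_bdd.2
  have hQ0 : 0 ≤ Q := (abs_nonneg _).trans (hQ 0)
  have hcos := (hω.family_cos univ).bdd
  obtain ⟨M, N, hM, hN, hMN⟩ := exists_nlOp_bound hs hg (1 * R + C * R)
  refine ⟨M, (1 + C) * (Q * N), hM, by positivity, fun t ht y hy ↦ ?_⟩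
  obtain ⟨⟨h1, h2⟩, h3, h4⟩ := hy
  have hpos : WeightedLe s (1 * R + C * R) (position κ ω t y) :=
    (h1.map_mulOp hs0 (hω.bdd_cos t).1 (hcos t (mem_univ t))).add
      (h3.map_mulOp hs0 (hσ.meas t ht) (hσ.bdd t ht))
  have hpos' : dagger (position κ ω t y) = position κ ω t y := by
    rw [position, map_add, dagger_mulOp (hω.bdd_cos t) (hω.cosSym_even t), h2,
      dagger_mulOp (hω.bdd_sigma ht) (hω.sigmaSym_even t), h4]
  obtain ⟨b, hb, hbe⟩ := hpos.exists_eq hs0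
  obtain ⟨h5, h6⟩ := hMN b (dagger_eq_of_mulOp_bw hs0 hbe hpos') hb
  rw [hbe] at h5 h6
  refine ⟨h5, fun L hG h0 ↦ ?_⟩
  have h7 := (h6 M L hG h0 le_rfl).map_mulOp hs0 hω.forcing_bdd.1 hQ
  have h8 : dagger (mulOp q (nlOp hG h0 (position κ ω t y))) =
      mulOp q (nlOp hG h0 (position κ ω t y)) := by
    rw [dagger_mulOp hω.forcing_bdd hω.forcing_even, dagger_nlOp]
  have hQN : 0 ≤ Q * N := by positivity
  refine ⟨⟨?_, ?_⟩, ?_, ?_⟩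
  · refine (h7.map_mulOp hs0 (hσ.meas t ht) (hσ.bdd t ht)).mono ?_
    nlinarith
  · rw [field, dagger_mulOp (hω.bdd_sigma ht) (hω.sigmaSym_even t), h8]
  · intro n
    have h9 := h7.map_mulOp hs0 (hω.bdd_cos t).1 (hcos t (mem_univ t)) n
    rw [field, map_neg, norm_neg]
    refine h9.trans ?_
    nlinarith
  · rw [field, map_neg, dagger_mulOp (hω.bdd_cos t) (hω.cosSym_even t), h8]

end Field

/-- A curve in `L²` whose derivative is bounded in `H^s` is continuous into `H^s`. -/
lemma exists_continuousOn_lift {s D T : ℝ} (hs : 0 ≤ s) {x x' : ℝ → L2C}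
    (hx : ∀ t ∈ Icc 0 T, HasDerivWithinAt x (x' t) (Icc 0 T) t)
    (hx' : ContinuousOn x' (Icc 0 T)) (hD : ∀ t ∈ Icc 0 T, WeightedLe s D (x' t)) {b : L2C}
    (hb : mulOp (bw (-s)) b = x 0) :
    ∃ B : ℝ → L2C, ContinuousOn B (Icc 0 T) ∧ ∀ t ∈ Icc 0 T, mulOp (bw (-s)) (B t) = x t := by
  have hsub : ∀ t ∈ Icc 0 T, ∀ t' ∈ Icc 0 T, uIcc t t' ⊆ Icc 0 T := fun t ht t' ht' ↦
    (ordConnected_Icc (a := (0 : ℝ)) (b := T)).uIcc_subset ht ht'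
  have hdiff : ∀ t ∈ Icc 0 T, ∀ t' ∈ Icc 0 T, WeightedLe s (D * |t - t'|) (x t - x t') := by
    intro t ht t' ht'
    have h0 : (0 : ℝ) ∈ Icc 0 T := ⟨le_rfl, ht.1.trans ht.2⟩
    have hi : ∀ a ∈ Icc 0 T, ∀ c ∈ Icc 0 T, IntervalIntegrable x' volume a c := fun a ha c hc ↦
      (hx'.mono (hsub a ha c hc)).intervalIntegrable
    have h1 : x t - x t' = ∫ τ in t'..t, x' τ := by
      rw [eq_add_integral_of_hasDerivWithinAt hx hx' ht,
        eq_add_integral_of_hasDerivWithinAt hx hx' ht', add_sub_add_left_eq_sub,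
        intervalIntegral.integral_interval_sub_left (hi 0 h0 t ht) (hi 0 h0 t' ht')]
    rw [h1]
    exact WeightedLe.integral (hi t' ht' t ht) fun τ hτ ↦
      hD τ (hsub t' ht' t ht (uIoc_subset_uIcc hτ))
  have hex : ∀ t, ∃ c : L2C, t ∈ Icc 0 T → mulOp (bw (-s)) c = x t := by
    intro t
    by_cases ht : t ∈ Icc 0 T
    · obtain ⟨c, -, hc⟩ := (hdiff t ht 0 ⟨le_rfl, ht.1.trans ht.2⟩).exists_eq hs
      exact ⟨c + b, fun _ ↦ by rw [map_add, hc, hb, sub_add_cancel]⟩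
    · exact ⟨0, fun h ↦ absurd h ht⟩
  choose B hB using hex
  refine ⟨B, ?_, hB⟩
  refine LipschitzOnWith.continuousOn (K := D.toNNReal)
    (LipschitzOnWith.of_dist_le_mul fun t ht t' ht' ↦ ?_)
  obtain ⟨c, hc, hce⟩ := (hdiff t ht t' ht').exists_eq hs
  have h2 : B t - B t' = c := by
    apply mulOp_injective (bddSymbol_bw (s := -s) (by linarith)) (bw_ne_zero _)
    rw [map_sub, hB t ht, hB t' ht', hce]
  rw [dist_eq_norm, h2, Real.dist_eq]
  exact hc.trans (mul_le_mul_of_nonneg_right (Real.le_coe_toNNReal D) (abs_nonneg _))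

/-- Local existence for the truncated first order system, with the truncation inactive along the
solution. -/
theorem Dispersion.exists_solution {κ : ℝ} {ω q : ℝ → ℝ} (hω : Dispersion κ ω q) {s : ℝ}
    (hs : 1 / 2 < s) {g : ℝ → ℝ} (hg : ContDiff ℝ ((⌊s⌋₊ + 1 : ℕ) : ℕ∞) g) {b₀ b₁ : L2C}
    (hb₀ : dagger b₀ = b₀) (hb₁ : dagger b₁ = b₁) :
    ∃ T : ℝ, 0 < T ∧ T ≤ 1 ∧ ∃ (M : ℝ) (L : ℝ≥0) (hG : LipschitzWith L (truncNl g M))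
      (h0 : truncNl g M 0 = 0) (y : ℝ → L2C × L2C) (BP BR : ℝ → L2C),
      y 0 = (mulOp (bw (-s)) b₀, mulOp (bw (-s)) b₁) ∧
      (∀ t ∈ Icc 0 T, HasDerivWithinAt y (field κ ω q hG h0 t (y t)) (Icc 0 T) t) ∧
      (∀ t ∈ Icc 0 T, y t = (mulOp (bw (-s)) (BP t), mulOp (bw (-s)) (BR t))) ∧
      ContinuousOn BP (Icc 0 T) ∧ ContinuousOn BR (Icc 0 T) ∧
      (∀ t ∈ Icc 0 T, dagger (position κ ω t (y t)) = position κ ω t (y t)) ∧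
      ∀ t ∈ Icc 0 T, ∀ᵐ x, ‖(𝓕⁻ (position κ ω t (y t)) : L2C) x‖ ≤ M := by
  have hs0 : 0 ≤ s := by linarith
  have hbw := bddSymbol_bw (s := -s) (by linarith)
  have hg1 := contDiff_one_of_floor hg
  set R₀ : ℝ := ‖b₀‖ + ‖b₁‖ with hR₀
  obtain ⟨M, D, hM, hD, hMD⟩ := hω.exists_field_bound hs hg (R₀ + 1)
  obtain ⟨L, hL⟩ := exists_lipschitzOnWith hg1 M
  have hG := lipschitzWith_truncNl hM hL
  have h0 := truncNl_zero g hM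
  obtain ⟨Λ, hΛ⟩ := hω.exists_lipschitzWith_field hG h0
  have hpos : 0 < 1 + (Λ : ℝ) + D := by positivity
  -- short enough for the Picard map to be a contraction and to gain at most `1` in `H^s`
  set T : ℝ := 1 / (1 + Λ + D) with hT
  have hT0 : 0 < T := by positivity
  have hTm : T * (1 + Λ + D) = 1 := by rw [hT]; field_simp
  have hTΛ : T * Λ < 1 := by nlinarith
  have hTD : T * D ≤ 1 := by nlinarith [mul_nonneg hT0.le Λ.coe_nonneg]
  have hT1 : T ≤ 1 := by nlinarith [mul_nonneg hT0.le Λ.coe_nonneg, mul_nonneg hT0.le hD]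
  have hsub : Icc 0 T ⊆ Icc (0 : ℝ) 1 := Icc_subset_Icc_right hT1
  set y₀ : L2C × L2C := (mulOp (bw (-s)) b₀, mulOp (bw (-s)) b₁) with hy₀
  have hw₀ : WeightedLe s R₀ y₀.1 := WeightedLe.of_exists hs0 (by linarith [norm_nonneg b₁])
  have hw₁ : WeightedLe s R₀ y₀.2 := WeightedLe.of_exists hs0 (by linarith [norm_nonneg b₀])
  have hd₀ : dagger y₀.1 = y₀.1 := by rw [hy₀, dagger_mulOp hbw (bw_even _), hb₀]
  have hd₁ : dagger y₀.2 = y₀.2 := by rw [hy₀, dagger_mulOp hbw (bw_even _), hb₁]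
  -- one component of the Picard map: the integral adds at most `T * D ≤ 1` to the `H^s` bound
  have hstep : ∀ (c x : L2C) (f : ℝ → L2C) (t : ℝ), t ∈ Icc 0 T → ContinuousOn f (Icc 0 T) →
      WeightedLe s R₀ c → dagger c = c → x = c + ∫ τ in (0 : ℝ)..t, f τ →
      (∀ τ ∈ Icc 0 T, WeightedLe s D (f τ) ∧ dagger (f τ) = f τ) →
      WeightedLe s (R₀ + 1) x ∧ dagger x = x := by
    rintro c x f t ht hf hc hdc rfl hfD
    have hu : uIcc 0 t ⊆ Icc 0 T := by rw [uIcc_of_le ht.1]; exact Icc_subset_Icc_right ht.2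
    have hi : IntervalIntegrable f volume 0 t := (hf.mono hu).intervalIntegrable
    refine ⟨hc.add ((WeightedLe.integral hi fun τ hτ ↦
      (hfD τ (hu (uIoc_subset_uIcc hτ))).1).mono ?_), ?_⟩
    · rw [sub_zero, abs_of_nonneg ht.1]
      nlinarith [ht.2]
    · rw [map_add, hdc, ← dagger.intervalIntegral_comp_comm hi]
      congr 1
      exact intervalIntegral.integral_congr fun τ hτ ↦ (hfD τ (hu hτ)).2
  have hinv : ∀ y : ℝ → L2C × L2C, ContinuousOn y (Icc 0 T) →
      (∀ t ∈ Icc 0 T, y t ∈ realBall s (R₀ + 1)) → ∀ t ∈ Icc 0 T,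
        y₀ + ∫ τ in (0 : ℝ)..t, field κ ω q hG h0 τ (y τ) ∈ realBall s (R₀ + 1) := by
    intro y hy hyK t ht
    have hf := hω.continuousOn_field hG h0 hT1 hy
    have hu : uIcc 0 t ⊆ Icc 0 T := by rw [uIcc_of_le ht.1]; exact Icc_subset_Icc_right ht.2
    have hi := (hf.mono hu).intervalIntegrable (μ := volume)
    have hball := fun τ (hτ : τ ∈ Icc 0 T) ↦
      (hMD τ (hsub hτ) (y τ) (hyK τ hτ)).2 L hG h0
    exact ⟨hstep y₀.1 _ _ t ht (continuous_fst.comp_continuousOn hf) hw₀ hd₀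
      (by
        rw [Prod.fst_add, ← ContinuousLinearMap.coe_fst' (R := ℝ),
          ← ContinuousLinearMap.intervalIntegral_comp_comm _ hi]
        rfl) fun τ hτ ↦ (hball τ hτ).1,
      hstep y₀.2 _ _ t ht (continuous_snd.comp_continuousOn hf) hw₁ hd₁
      (by
        rw [Prod.snd_add, ← ContinuousLinearMap.coe_snd' (R := ℝ),
          ← ContinuousLinearMap.intervalIntegral_comp_comm _ hi]
        rfl) fun τ hτ ↦ (hball τ hτ).2⟩
  obtain ⟨y, hy0, hyK, hyd⟩ := exists_solution_mem_closed hT0.le hTΛ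
    (fun t ht ↦ hΛ t (hsub ht)) (fun y hy ↦ hω.continuousOn_field hG h0 hT1 hy)
    (isClosed_realBall s (R₀ + 1))
    (y₀ := y₀) ⟨⟨hw₀.mono (by linarith), hd₀⟩, hw₁.mono (by linarith), hd₁⟩ hinv
  have hyc : ContinuousOn y (Icc 0 T) := fun t ht ↦ (hyd t ht).continuousWithinAt
  have hfc := hω.continuousOn_field hG h0 hT1 hyc
  have hball := fun τ (hτ : τ ∈ Icc 0 T) ↦ (hMD τ (hsub hτ) (y τ) (hyK τ hτ)).2 L hG h0
  obtain ⟨BP, hBPc, hBP⟩ := exists_continuousOn_lift hs0 (x := fun t ↦ (y t).1) (b := b₀)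
    (fun t ht ↦ (hyd t ht).fst) (continuous_fst.comp_continuousOn hfc)
    (fun t ht ↦ (hball t ht).1.1) (by rw [hy0])
  obtain ⟨BR, hBRc, hBR⟩ := exists_continuousOn_lift hs0 (x := fun t ↦ (y t).2) (b := b₁)
    (fun t ht ↦ (hyd t ht).snd) (continuous_snd.comp_continuousOn hfc)
    (fun t ht ↦ (hball t ht).2.1) (by rw [hy0])
  refine ⟨T, hT0, hT1, M, L, hG, h0, y, BP, BR, hy0, hyd, fun t ht ↦ ?_, hBPc, hBRc,
    fun t ht ↦ ?_, fun t ht ↦ (hMD t (hsub ht) (y t) (hyK t ht)).1⟩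
  · rw [hBP t ht, hBR t ht]
  · have h1 := (hyK t ht).1.2
    have h2 := (hyK t ht).2.2
    rw [position, map_add, dagger_mulOp (hω.bdd_cos t) (hω.cosSym_even t), h1,
      dagger_mulOp (hω.bdd_sigma (hsub ht)) (hω.sigmaSym_even t), h2]

end NonlocalWave

namespace NonlocalWave
open Filter Topology
open scoped ENNReal NNReal

/-! ### The symbols of the equation -/

lemma bw_scale_le {a : ℝ} (ha : 0 ≤ a) (ξ : ℝ) :
    bw a (2 * Real.pi * ξ) ≤ (2 * Real.pi) ^ a * bw a ξ := by
  have hpi : (1 : ℝ) ≤ 2 * Real.pi := by linarith [Real.pi_gt_three]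
  have h1 : (2 * Real.pi) ^ a = ((2 * Real.pi) ^ 2) ^ (a / 2) := by
    rw [← Real.rpow_natCast, ← Real.rpow_mul (by positivity)]
    congr 1
    push_cast
    ring
  rw [bw, bw, h1, ← Real.mul_rpow (by positivity) (by positivity)]
  refine Real.rpow_le_rpow (by positivity) ?_ (by linarith)
  nlinarith [sq_nonneg ξ]

lemma bw_le_scale {a : ℝ} (ha : 0 ≤ a) (ξ : ℝ) : bw a ξ ≤ bw a (2 * Real.pi * ξ) := by
  have hpi : (1 : ℝ) ≤ 2 * Real.pi := by linarith [Real.pi_gt_three]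
  refine Real.rpow_le_rpow (by positivity) ?_ (by linarith)
  have : 1 ≤ (2 * Real.pi) ^ 2 := by nlinarith
  nlinarith [sq_nonneg ξ]

lemma bw_half_sq (a ξ : ℝ) : bw (a / 2) ξ ^ 2 = bw a ξ := by
  rw [sq, ← bw_add, add_halves]

lemma bw_two (ξ : ℝ) : bw 2 ξ = 1 + ξ ^ 2 := by
  rw [bw, div_self two_ne_zero, Real.rpow_one]

/-- The frequency `|2πξ| √l(2πξ)` of the linear equation; the value at `0` is changed to `1` in
order to make it positive everywhere. -/
noncomputable def waveFreq (l : ℝ → ℝ) (ξ : ℝ) : ℝ :=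
  if ξ = 0 then 1 else |2 * Real.pi * ξ| * √(l (2 * Real.pi * ξ))

/-- The symbol of `-B ∂ₓ²`, divided by the weight `(1 + ξ²)^(κ/2)`. -/
noncomputable def forcingSym (κ : ℝ) (b : ℝ → ℝ) (ξ : ℝ) : ℝ :=
  bw (-κ) ξ * (b (2 * Real.pi * ξ) * (2 * Real.pi * ξ) ^ 2)

lemma sq_waveFreq {l : ℝ → ℝ} (hl : ∀ ξ, 0 ≤ l ξ) {ξ : ℝ} (hξ : ξ ≠ 0) :
    waveFreq l ξ ^ 2 = (2 * Real.pi * ξ) ^ 2 * l (2 * Real.pi * ξ) := by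
  rw [waveFreq, if_neg hξ, mul_pow, sq_abs, Real.sq_sqrt (hl _)]

lemma abs_scale_le (ξ : ℝ) : |2 * Real.pi * ξ| ≤ 2 * Real.pi * bw 1 ξ := by
  rw [abs_mul, abs_of_pos Real.two_pi_pos]
  refine mul_le_mul_of_nonneg_left ?_ Real.two_pi_pos.le
  refine abs_le_of_sq_le_sq' ?_ (bw_pos _ _).le |> abs_le.2
  have := bw_half_sq 2 ξ
  rw [div_self two_ne_zero, bw_two] at this
  linarith

lemma bw_one_le_abs_scale {ξ : ℝ} (h : 1 ≤ |ξ|) : bw 1 ξ ≤ |2 * Real.pi * ξ| := by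
  refine le_of_sq_le_sq ?_ (abs_nonneg _)
  have h1 := bw_half_sq 2 ξ
  rw [div_self two_ne_zero, bw_two] at h1
  rw [h1, sq_abs, mul_pow]
  have h2 : 1 ≤ ξ ^ 2 := by rw [← sq_abs]; nlinarith
  have h3 : 2 ≤ (2 * Real.pi) ^ 2 := by nlinarith [Real.pi_gt_three]
  nlinarith

lemma sqrt_sq_mul_bw {c : ℝ} (hc : 0 < c) (ρ ξ : ℝ) : √(c ^ 2 * bw ρ ξ) = c * bw (ρ / 2) ξ := by
  rw [← bw_half_sq, ← mul_pow, Real.sqrt_sq (mul_nonneg hc.le (bw_pos _ _).le)]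

/-- The two-sided bound on `l` makes `ω` comparable with the weight of order `1 + ρ/2`, and
`ρ/2 + r ≥ 1` makes the forcing symbol bounded. -/
lemma dispersion_waveFreq {ρ r : ℝ} (hρ : 0 ≤ ρ) (hr : 0 ≤ r) {l b : ℝ → ℝ} (hl_meas : Measurable l)
    (hb_meas : Measurable b) (hl_even : ∀ ξ, l (-ξ) = l ξ) (hb_even : ∀ ξ, b (-ξ) = b ξ)
    {c₁ c₂ c₃ : ℝ} (hc₁ : 0 < c₁) (hc₂ : 0 < c₂)
    (hl : ∀ ξ, c₁ ^ 2 * bw ρ ξ ≤ l ξ ∧ l ξ ≤ c₂ ^ 2 * bw ρ ξ)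
    (hb : ∀ ξ, 0 < b ξ ∧ b ξ ≤ c₃ ^ 2 * bw (-r) ξ) (hρr : 1 ≤ ρ / 2 + r) :
    Dispersion (1 + ρ / 2) (waveFreq l) (forcingSym (1 + ρ / 2) b) where
  exponent_nonneg := by linarith
  meas := by
    have h1 : Measurable fun ξ : ℝ ↦ 2 * Real.pi * ξ := measurable_const_mul _
    exact Measurable.ite (measurableSet_singleton 0) measurable_const
      (h1.abs.mul (hl_meas.comp h1).sqrt)
  pos ξ := by
    unfold waveFreq
    split_ifs with h
    · exact one_pos
    · have h1 : 2 * Real.pi * ξ ≠ 0 := mul_ne_zero Real.two_pi_pos.ne' h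
      have h2 : 0 < l (2 * Real.pi * ξ) :=
        (mul_pos (pow_pos hc₁ 2) (bw_pos _ _)).trans_le (hl _).1
      positivity
  even ξ := by simp [waveFreq, hl_even]
  le_bw := by
    refine ⟨1 + 2 * Real.pi * (c₂ * (2 * Real.pi) ^ (ρ / 2)), fun ξ ↦ ?_⟩
    have hK : 0 ≤ 2 * Real.pi * (c₂ * (2 * Real.pi) ^ (ρ / 2)) := by positivity
    have h1 : 1 ≤ bw (1 + ρ / 2) ξ := one_le_bw (by linarith) ξ
    unfold waveFreq
    split_ifs with h
    · nlinarith
    · have h2 : √(l (2 * Real.pi * ξ)) ≤ c₂ * ((2 * Real.pi) ^ (ρ / 2) * bw (ρ / 2) ξ) := by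
        refine (Real.sqrt_le_sqrt (hl _).2).trans ?_
        rw [sqrt_sq_mul_bw hc₂]
        exact mul_le_mul_of_nonneg_left (bw_scale_le (by linarith) ξ) hc₂.le
      calc _ ≤ (2 * Real.pi * bw 1 ξ) * (c₂ * ((2 * Real.pi) ^ (ρ / 2) * bw (ρ / 2) ξ)) :=
            mul_le_mul (abs_scale_le ξ) h2 (Real.sqrt_nonneg _)
              (mul_nonneg Real.two_pi_pos.le (bw_pos _ _).le)
        _ = 2 * Real.pi * (c₂ * (2 * Real.pi) ^ (ρ / 2)) * bw (1 + ρ / 2) ξ := by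
            rw [bw_add]; ring
        _ ≤ _ := by nlinarith
  bw_le := by
    refine ⟨1 / c₁, fun ξ hξ ↦ ?_⟩
    have h0 : ξ ≠ 0 := by
      rintro rfl
      norm_num at hξ
    rw [waveFreq, if_neg h0, bw_add, div_mul_eq_mul_div, le_div_iff₀ hc₁, one_mul, mul_assoc]
    refine mul_le_mul (bw_one_le_abs_scale hξ) ?_ (mul_nonneg (bw_pos _ _).le hc₁.le)
      (abs_nonneg _)
    refine le_trans ?_ (Real.sqrt_le_sqrt (hl _).1)
    rw [sqrt_sq_mul_bw hc₁, mul_comm]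
    exact mul_le_mul_of_nonneg_left (bw_le_scale (by linarith) ξ) hc₁.le
  forcing_bdd := by
    have h1 : Measurable fun ξ : ℝ ↦ 2 * Real.pi * ξ := measurable_const_mul _
    refine ⟨(continuous_bw _).measurable.mul ((hb_meas.comp h1).mul (h1.pow_const 2)),
      c₃ ^ 2 * (2 * Real.pi) ^ 2, fun ξ ↦ ?_⟩
    have hb1 : b (2 * Real.pi * ξ) ≤ c₃ ^ 2 * bw (-r) ξ := by
      refine (hb _).2.trans (mul_le_mul_of_nonneg_left ?_ (sq_nonneg _))
      rw [bw_neg, bw_neg]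
      exact inv_anti₀ (bw_pos _ _) (bw_le_scale hr ξ)
    have hx : (2 * Real.pi * ξ) ^ 2 ≤ (2 * Real.pi) ^ 2 * bw 2 ξ := by
      rw [bw_two]
      nlinarith [sq_nonneg (2 * Real.pi)]
    rw [forcingSym, abs_of_nonneg (mul_nonneg (bw_pos _ _).le
      (mul_nonneg (hb _).1.le (sq_nonneg _)))]
    calc _ ≤ bw (-(1 + ρ / 2)) ξ * ((c₃ ^ 2 * bw (-r) ξ) * ((2 * Real.pi) ^ 2 * bw 2 ξ)) := by
          refine mul_le_mul_of_nonneg_left ?_ (bw_pos _ _).le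
          exact mul_le_mul hb1 hx (sq_nonneg _) (mul_nonneg (sq_nonneg _) (bw_pos _ _).le)
      _ = c₃ ^ 2 * (2 * Real.pi) ^ 2 * bw (-(1 + ρ / 2) + -r + 2) ξ := by
          rw [bw_add, bw_add]; ring
      _ ≤ c₃ ^ 2 * (2 * Real.pi) ^ 2 * 1 := by
          refine mul_le_mul_of_nonneg_left (bw_le_one (by linarith) ξ) (by positivity)
      _ = _ := mul_one _
  forcing_even ξ := by simp [forcingSym, bw_even, hb_even]

/-! ### The equation in terms of Fourier transforms -/

lemma IsMultiplierImage.unique {m : ℝ → ℝ} {f h h' : 𝓢'(ℝ, ℂ)} (hh : IsMultiplierImage m f h)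
    (hh' : IsMultiplierImage m f h') : h = h' := by
  obtain ⟨w, h1, h2⟩ := hh
  obtain ⟨w', h1', h2'⟩ := hh'
  refine fourier_injective (h2.eq (h2'.congr ?_))
  filter_upwards [h1.ae_eq h1'] with ξ hξ
  rw [hξ]

lemma IsSuperposition.unique {g : ℝ → ℝ} {f G G' : 𝓢'(ℝ, ℂ)} (h : IsSuperposition g f G)
    (h' : IsSuperposition g f G') : G = G' := by
  obtain ⟨v, h1, h2⟩ := h
  obtain ⟨v', h1', h2'⟩ := h'
  refine h2.eq (h2'.congr ?_)
  filter_upwards [h1.ae_eq h1'] with ξ hξ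
  rw [Complex.ofReal_inj.1 hξ]

lemma isGivenBy_one :
    IsGivenBy (Measure.toTemperedDistribution (volume : Measure ℝ)) fun _ ↦ 1 := by
  intro η
  simp only [mul_one]
  exact ⟨η.integrable, by simp⟩

lemma dxx_one : dxx (Measure.toTemperedDistribution (volume : Measure ℝ)) = 0 := by
  have h : TemperedDistribution.derivCLM ℂ
      (Measure.toTemperedDistribution (volume : Measure ℝ)) = 0 := by
    ext η
    rw [TemperedDistribution.derivCLM_apply_apply, map_neg, (isGivenBy_one _).2]
    simp only [mul_one]
    rw [integral_eq_zero_of_hasDerivAt_of_integrable (f := η)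
      (fun x ↦ (SchwartzMap.derivCLM_apply ℂ η x) ▸ (η.differentiable x).hasDerivAt)
      (SchwartzMap.integrable _) η.integrable]
    simp
  rw [dxx, h, map_zero]

/-- `-L ∂ₓ²` has the symbol `ω²`, off the origin. -/
lemma isMultiplierImage_wave {l : ℝ → ℝ} (hl : ∀ ξ, 0 ≤ l ξ) {κ : ℝ} {q : ℝ → ℝ}
    (hω : Dispersion κ (waveFreq l) q) (A : L2C) :
    IsMultiplierImage l (dxx (ofWeighted 0 A)) (ofWeighted (2 * κ)
      (-mulOp (relFreq κ (waveFreq l)) (mulOp (relFreq κ (waveFreq l)) A))) := by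
  refine ⟨_, (isGivenBy_fourier_ofWeighted 0 A).dxx,
    (isGivenBy_fourier_ofWeighted _ _).congr ?_⟩
  have hr := hω.bdd_relFreq
  have h0 : ∀ᵐ ξ : ℝ, ξ ≠ 0 := by simp [ae_iff, measure_singleton]
  filter_upwards [h0, coeFn_mulOp hr (mulOp (relFreq κ (waveFreq l)) A), coeFn_mulOp hr A,
    Lp.coeFn_neg (mulOp (relFreq κ (waveFreq l)) (mulOp (relFreq κ (waveFreq l)) A))]
    with ξ h0 h1 h2 h3
  rw [h3, Pi.neg_apply, h1, h2, bw_zero, mul_neg, ← mul_assoc, ← mul_assoc, ← Complex.ofReal_mul,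
    ← Complex.ofReal_mul]
  have e : bw (2 * κ) ξ * relFreq κ (waveFreq l) ξ * relFreq κ (waveFreq l) ξ =
      (2 * Real.pi * ξ) ^ 2 * l (2 * Real.pi * ξ) := by
    rw [← sq_waveFreq hl h0, relFreq, two_mul, bw_add]
    calc _ = (bw (-κ) ξ * bw κ ξ) ^ 2 * waveFreq l ξ ^ 2 := by ring
      _ = _ := by rw [bw_neg_mul]; ring
  rw [e]
  push_cast
  ring

/-- The constant `g 0` drops out of `(g(u))_xx`, and the truncation does not matter below its level. -/
lemma exists_superposition_image {b : ℝ → ℝ} {κ : ℝ} {ω : ℝ → ℝ}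
    (hω : Dispersion κ ω (forcingSym κ b)) {g : ℝ → ℝ} {M : ℝ} {L : ℝ≥0}
    (hG : LipschitzWith L (truncNl g M)) (h0 : truncNl g M 0 = 0) {A : L2C} (hA : dagger A = A)
    (hM : ∀ᵐ x, ‖(𝓕⁻ A : L2C) x‖ ≤ M) :
    ∃ G, IsSuperposition g (ofWeighted 0 A) G ∧ IsMultiplierImage b (dxx G)
      (ofWeighted (2 * κ) (-mulOp (bw (-κ)) (mulOp (forcingSym κ b) (nlOp hG h0 A)))) := by
  have hgiven := isGivenBy_Lp (𝓕⁻ A : L2C)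
  have him := ae_im_eq_zero_of_isReal hgiven
    (by rw [← ofWeighted_zero]; exact isReal_ofWeighted_iff.2 hA)
  refine ⟨((hG.compLp h0 (𝓕⁻ A : L2C) : L2C) : 𝓢'(ℝ, ℂ)) +
      (g 0 : ℂ) • Measure.toTemperedDistribution (volume : Measure ℝ),
    ⟨fun x ↦ ((𝓕⁻ A : L2C) x).re, ?_, ?_⟩, ?_⟩
  · rw [ofWeighted_zero]
    refine hgiven.congr ?_
    filter_upwards [him] with x hx
    exact Complex.ext (by simp) (by simpa using hx)
  · refine ((isGivenBy_Lp _).add (isGivenBy_one.smul _)).congr ?_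
    filter_upwards [hM, hG.coeFn_compLp h0 (𝓕⁻ A : L2C)] with x h1 h2
    rw [h2, Function.comp_apply, truncNl_eq h1]
    push_cast
    ring
  · have hdxx : dxx (((hG.compLp h0 (𝓕⁻ A : L2C) : L2C) : 𝓢'(ℝ, ℂ)) +
        (g 0 : ℂ) • Measure.toTemperedDistribution (volume : Measure ℝ)) =
        dxx (ofWeighted 0 (nlOp hG h0 A)) := by
      have h1 : ∀ f h : 𝓢'(ℝ, ℂ), dxx (f + h) = dxx f + dxx h := fun f h ↦ by
        simp only [dxx, map_add]
      have h2 : ∀ (c : ℂ) (f : 𝓢'(ℝ, ℂ)), dxx (c • f) = c • dxx f := fun c f ↦ by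
        simp only [dxx, map_smul]
      have h3 : dxx ((g 0 : ℂ) • Measure.toTemperedDistribution (volume : Measure ℝ)) = 0 := by
        rw [h2, dxx_one]
        ext η
        exact smul_zero (g 0 : ℂ)
      rw [h1, h3, add_zero, ofWeighted_zero, nlOp, fourierInv_fourier_eq]
    rw [hdxx]
    refine ⟨_, (isGivenBy_fourier_ofWeighted 0 (nlOp hG h0 A)).dxx,
      (isGivenBy_fourier_ofWeighted _ _).congr ?_⟩
    set N := nlOp hG h0 A
    filter_upwards [coeFn_mulOp hω.bdd_bw (mulOp (forcingSym κ b) N),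
      coeFn_mulOp hω.forcing_bdd N,
      Lp.coeFn_neg (mulOp (bw (-κ)) (mulOp (forcingSym κ b) N))] with ξ h1 h2 h3
    rw [h3, Pi.neg_apply, h1, h2, bw_zero, mul_neg, ← mul_assoc, ← mul_assoc,
      ← Complex.ofReal_mul, ← Complex.ofReal_mul]
    have e : bw (2 * κ) ξ * bw (-κ) ξ * forcingSym κ b ξ =
        b (2 * Real.pi * ξ) * (2 * Real.pi * ξ) ^ 2 := by
      rw [forcingSym, two_mul, bw_add]
      calc _ = (bw (-κ) ξ * bw κ ξ) ^ 2 * (b (2 * Real.pi * ξ) * (2 * Real.pi * ξ) ^ 2) := by ring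
        _ = _ := by rw [bw_neg_mul]; ring
    rw [e]
    push_cast
    ring

/-- For bounded real functions in `H^s` the equation is an equation in `L²` between Fourier
transforms, with the nonlinearity truncated at any level above the supremum. -/
lemma satisfiesEquationAt_iff {l b : ℝ → ℝ} (hl : ∀ ξ, 0 ≤ l ξ) {κ : ℝ}
    (hω : Dispersion κ (waveFreq l) (forcingSym κ b)) {g : ℝ → ℝ} {M : ℝ} {L : ℝ≥0}
    (hG : LipschitzWith L (truncNl g M)) (h0 : truncNl g M 0 = 0) {T t : ℝ}
    {u ut : ℝ → 𝓢'(ℝ, ℂ)} {A : L2C} (hu : u t = ofWeighted 0 A) (hA : dagger A = A)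
    (hM : ∀ᵐ x, ‖(𝓕⁻ A : L2C) x‖ ≤ M) :
    SatisfiesEquationAt l b g T u ut t ↔ ∀ η, HasDerivWithinAt (fun τ ↦ ut τ η)
      (ofWeightedEval (2 * κ) η
        (-mulOp (relFreq κ (waveFreq l)) (mulOp (relFreq κ (waveFreq l)) A) -
          mulOp (bw (-κ)) (mulOp (forcingSym κ b) (nlOp hG h0 A)))) (Icc 0 T) t := by
  have hw := isMultiplierImage_wave hl hω A
  obtain ⟨G, hG1, hG2⟩ := exists_superposition_image hω hG h0 hA hM
  rw [← hu] at hw hG1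
  have e : ∀ η, ofWeightedEval (2 * κ) η
        (-mulOp (relFreq κ (waveFreq l)) (mulOp (relFreq κ (waveFreq l)) A) -
          mulOp (bw (-κ)) (mulOp (forcingSym κ b) (nlOp hG h0 A))) =
      ofWeighted (2 * κ) (-mulOp (relFreq κ (waveFreq l)) (mulOp (relFreq κ (waveFreq l)) A)) η +
      ofWeighted (2 * κ) (-mulOp (bw (-κ)) (mulOp (forcingSym κ b) (nlOp hG h0 A))) η := fun η ↦ by
    rw [sub_eq_add_neg, map_add]
    rfl
  constructor
  · rintro ⟨Lu, G', BG, h1, h2, h3, h4⟩ η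
    rw [h2.unique hG1] at h3
    rw [e, ← h1.unique hw, ← h3.unique hG2]
    exact h4 η
  · intro h
    refine ⟨_, G, _, hw, hG1, hG2, fun η ↦ ?_⟩
    rw [← e]
    exact h η

end NonlocalWave

namespace NonlocalWave
open Filter Topology
open scoped ENNReal NNReal

/-! ### From distributional solutions to the first order system -/

/-- The pair `(P, R)` whose position and velocity at time `t` are `A` and `Z`. -/
noncomputable def coefficients (κ : ℝ) (ω : ℝ → ℝ) (t : ℝ) (A Z : L2C) : L2C × L2C :=
  (mulOp (cosSym ω t) A - mulOp (sigmaSym κ ω t) Z,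
    mulOp (relFreq κ ω) (mulOp (sinSym ω t) A) + mulOp (cosSym ω t) Z)

lemma Dispersion.position_coefficients {κ : ℝ} {ω q : ℝ → ℝ} (hω : Dispersion κ ω q) {t : ℝ}
    (ht : t ∈ Icc (0 : ℝ) 1) (A Z : L2C) : position κ ω t (coefficients κ ω t A Z) = A := by
  have hσ := hω.bdd_sigma ht
  have e := hω.cos_cos_add_sin_sin (t := t) A
  rw [position, coefficients]
  simp only [map_add, map_sub]
  rw [mulOp_comm hσ hω.bdd_relFreq, hω.relFreq_sigma ht, mulOp_comm hσ (hω.bdd_cos t)]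
  nth_rewrite 3 [← e]
  abel

lemma position_zero (κ : ℝ) (ω : ℝ → ℝ) (y : L2C × L2C) : position κ ω 0 y = y.1 := by
  have h1 : cosSym ω 0 = fun _ ↦ 1 := by ext ξ; simp [cosSym]
  have h2 : sigmaSym κ ω 0 = fun _ ↦ 0 * 1 := by ext ξ; simp [sigmaSym, sincSym]
  rw [position, h1, h2, mulOp_one, mulOp_const_smul ⟨measurable_const, 1, fun _ ↦ by simp⟩,
    zero_smul, add_zero]

lemma velocity_zero (κ : ℝ) (ω : ℝ → ℝ) (y : L2C × L2C) : velocity κ ω 0 y = y.2 := by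
  have h1 : cosSym ω 0 = fun _ ↦ 1 := by ext ξ; simp [cosSym]
  have h2 : sinSym ω 0 = fun _ ↦ 0 * 1 := by ext ξ; simp [sinSym]
  rw [velocity, h1, h2, mulOp_one, mulOp_const_smul ⟨measurable_const, 1, fun _ ↦ by simp⟩,
    zero_smul, map_zero, sub_zero]

/-- If a curve in `L²`, tested against every Schwartz function, is differentiable for positive
times, with derivative a continuous curve, then it is differentiable in norm up to time `0`. -/
lemma hasDerivWithinAt_of_ofWeightedEval {m T : ℝ} {x x' : ℝ → L2C}
    (hx : ContinuousOn x (Icc 0 T)) (hx' : ContinuousOn x' (Icc 0 T))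
    (h : ∀ η, ∀ t ∈ Ioc 0 T, HasDerivWithinAt (fun τ ↦ ofWeightedEval m η (x τ))
      (ofWeightedEval m η (x' t)) (Icc 0 T) t) {t : ℝ} (ht : t ∈ Icc 0 T) :
    HasDerivWithinAt x (x' t) (Icc 0 T) t := by
  have key : ∀ t ∈ Icc 0 T, x t = x 0 + ∫ τ in (0 : ℝ)..t, x' τ := by
    intro t ht
    have hsub : Icc 0 t ⊆ Icc 0 T := Icc_subset_Icc_right ht.2
    have hi : IntervalIntegrable x' volume 0 t :=
      (hx'.mono (by rw [uIcc_of_le ht.1]; exact hsub)).intervalIntegrable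
    apply ofWeighted_injective m
    ext η
    have h1 := ((ofWeightedEval m η).restrictScalars ℝ).intervalIntegral_comp_comm hi
    have h2 := intervalIntegral.integral_eq_sub_of_hasDerivAt_of_le ht.1
      ((ofWeightedEval m η).continuous.comp_continuousOn (hx.mono hsub))
      (fun τ hτ ↦ (h η τ ⟨hτ.1, hτ.2.le.trans ht.2⟩).hasDerivAt
        (Icc_mem_nhds hτ.1 (hτ.2.trans_le ht.2)))
      (((ofWeightedEval m η).continuous.comp_continuousOn (hx'.mono (by
        rw [uIcc_of_le ht.1]; exact hsub))).intervalIntegrable)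
    simp only [ContinuousLinearMap.coe_restrictScalars'] at h1
    rw [h1] at h2
    rw [← ofWeightedEval_apply, ← ofWeightedEval_apply, map_add, h2]
    simp
  exact ((hasDerivWithinAt_integral hx' ht).const_add (x 0)).congr key (key t ht)

section Solutions

variable {ρ s : ℝ} {l b g : ℝ → ℝ}

/-- The coefficients of a distributional solution solve the first order system, for every large
truncation level. -/
lemma IsSolution.exists_coefficients (hl : ∀ ξ, 0 ≤ l ξ)
    (hω : Dispersion (1 + ρ / 2) (waveFreq l) (forcingSym (1 + ρ / 2) b)) (hs : 1 / 2 < s)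
    (hg : ContDiff ℝ ((⌊s⌋₊ + 1 : ℕ) : ℕ∞) g) {φ ψ : 𝓢'(ℝ, ℂ)} {T : ℝ} (hT0 : 0 ≤ T) (hT : T ≤ 1)
    {u : ℝ → 𝓢'(ℝ, ℂ)} (hu : IsSolution l b g ρ s φ ψ T u) :
    ∃ (A Z : ℝ → L2C) (M₀ : ℝ), (∀ t ∈ Icc 0 T, u t = ofWeighted 0 (A t)) ∧
      φ = ofWeighted 0 (A 0) ∧ ψ = ofWeighted (1 + ρ / 2) (Z 0) ∧
      ∀ (M : ℝ) (L : ℝ≥0) (hG : LipschitzWith L (truncNl g M)) (h0 : truncNl g M 0 = 0), M₀ ≤ M →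
        ∀ t ∈ Icc 0 T, HasDerivWithinAt
          (fun τ ↦ coefficients (1 + ρ / 2) (waveFreq l) τ (A τ) (Z τ))
          (field (1 + ρ / 2) (waveFreq l) (forcingSym (1 + ρ / 2) b) hG h0 t
            (coefficients (1 + ρ / 2) (waveFreq l) t (A t) (Z t))) (Icc 0 T) t := by
  obtain ⟨hreal, ⟨U, hU, hUc⟩, ut, ⟨U₂, V, hU₂, hV, hUV, hVc⟩, rfl, rfl, heq⟩ := hu
  set κ : ℝ := 1 + ρ / 2 with hκ
  have hs0 : 0 ≤ s := by linarith
  have hbw := bddSymbol_bw (s := -s) (by linarith)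
  have h0T : (0 : ℝ) ∈ Icc 0 T := ⟨le_rfl, hT0⟩
  have hsub : Icc 0 T ⊆ Icc (0 : ℝ) 1 := Icc_subset_Icc_right hT
  let B : ℝ → L2C := fun t ↦ 𝓕 (U t)
  let A : ℝ → L2C := fun t ↦ mulOp (bw (-s)) (B t)
  let Z : ℝ → L2C := fun t ↦ mulOp (bw (-s)) (𝓕 (V t))
  have hF : Continuous (fun x : L2C ↦ (𝓕 x : L2C)) := (fourierCLM ℂ L2C).continuous
  have hBc : ContinuousOn B (Icc 0 T) := hF.comp_continuousOn hUc
  have hAc : ContinuousOn A (Icc 0 T) := (mulOp (bw (-s))).continuous.comp_continuousOn hBc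
  have hZc : ContinuousOn Z (Icc 0 T) :=
    (mulOp (bw (-s))).continuous.comp_continuousOn (hF.comp_continuousOn hVc)
  have huA : ∀ t ∈ Icc 0 T, u t = ofWeighted 0 (A t) := fun t ht ↦ by
    rw [ofWeighted_mulOp 0 (by linarith), zero_add]
    exact eq_ofWeighted_of_besselPotential (hU t ht)
  have hutZ : ∀ t ∈ Icc 0 T, ut t = ofWeighted κ (Z t) := fun t ht ↦ by
    rw [ofWeighted_mulOp κ (by linarith), eq_ofWeighted_of_besselPotential (hV t ht)]
    congr 2
    rw [hκ]
    ring
  have hJneg : -κ ≤ 0 := by linarith [hω.exponent_nonneg]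
  have hJA : ∀ t ∈ Icc 0 T, mulOp (bw (-κ)) (A t) = mulOp (bw (-s)) (𝓕 (U₂ t) : L2C) := by
    intro t ht
    apply ofWeighted_injective κ
    rw [ofWeighted_mulOp κ hJneg, add_neg_cancel, ← huA t ht, ofWeighted_mulOp κ (by linarith),
      eq_ofWeighted_of_besselPotential (hU₂ t ht)]
    congr 2
    rw [hκ]
    ring
  have hdA : ∀ t ∈ Icc 0 T, HasDerivWithinAt (fun τ ↦ mulOp (bw (-κ)) (A τ)) (Z t) (Icc 0 T) t := by
    intro t ht
    have h1 := ((mulOp (bw (-s)) ∘L fourierCLM ℂ L2C).restrictScalars ℝ).hasFDerivAt.comp_hasDerivWithinAt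
      t (hUV t ht)
    exact h1.congr hJA (hJA t ht)
  have hdag : ∀ t ∈ Icc 0 T, dagger (A t) = A t := fun t ht ↦
    isReal_ofWeighted_iff.1 (huA t ht ▸ hreal t ht)
  obtain ⟨C₀, hC₀⟩ := isCompact_Icc.exists_bound_of_continuousOn hBc
  obtain ⟨M₀, _, -, -, hM₀⟩ := exists_nlOp_bound hs hg C₀
  have hsup : ∀ t ∈ Icc 0 T, ∀ᵐ x, ‖(𝓕⁻ (A t) : L2C) x‖ ≤ M₀ := fun t ht ↦
    (hM₀ (B t) (dagger_eq_of_mulOp_bw hs0 rfl (hdag t ht)) (hC₀ t ht)).1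
  refine ⟨A, Z, M₀, huA, huA 0 h0T, hutZ 0 h0T, fun M L hG h0 hM ↦ ?_⟩
  let w : ℝ → L2C := fun t ↦ mulOp (forcingSym κ b) (nlOp hG h0 (A t))
  have hwc : ContinuousOn w (Icc 0 T) := (mulOp (forcingSym κ b)).continuous.comp_continuousOn
    ((lipschitzWith_nlOp hG h0).continuous.comp_continuousOn hAc)
  have hutJ : ∀ t ∈ Icc 0 T, ut t = ofWeighted (2 * κ) (mulOp (bw (-κ)) (Z t)) := fun t ht ↦ by
    rw [ofWeighted_mulOp _ hJneg, hutZ t ht]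
    congr 2
    ring
  have hdZ : ∀ t ∈ Icc 0 T, HasDerivWithinAt (fun τ ↦ mulOp (bw (-κ)) (Z τ))
      (-mulOp (relFreq κ (waveFreq l)) (mulOp (relFreq κ (waveFreq l)) (A t)) -
        mulOp (bw (-κ)) (w t)) (Icc 0 T) t := by
    intro t ht
    refine hasDerivWithinAt_of_ofWeightedEval (m := 2 * κ)
      (x' := fun t ↦ -mulOp (relFreq κ (waveFreq l)) (mulOp (relFreq κ (waveFreq l)) (A t)) -
        mulOp (bw (-κ)) (w t))
      ((mulOp (bw (-κ))).continuous.comp_continuousOn hZc) ?_ (fun η τ hτ ↦ ?_) ht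
    · exact (((mulOp (relFreq κ (waveFreq l))).continuous.comp
        (mulOp (relFreq κ (waveFreq l))).continuous).comp_continuousOn hAc).neg.sub
        ((mulOp (bw (-κ))).continuous.comp_continuousOn hwc)
    · have hτ' : τ ∈ Icc 0 T := ⟨hτ.1.le, hτ.2⟩
      have h1 := (satisfiesEquationAt_iff hl hω hG h0 (huA τ hτ') (hdag τ hτ')
        ((hsup τ hτ').mono fun x hx ↦ hx.trans hM)).1 (heq τ hτ) η
      exact h1.congr (fun σ hσ ↦ by rw [hutJ σ hσ]; rfl) (by rw [hutJ τ hτ']; rfl)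
  obtain ⟨C, -, hσ⟩ := hω.exists_family_sigma
  have hcomp := fun t (ht : t ∈ Icc 0 T) ↦
    hω.hasDerivWithinAt_coefficients hT ht (hdA t ht) (hdZ t ht)
  have hinj : Function.Injective ((mulOp (bw (-κ)) ∘L mulOp (bw (-κ))).restrictScalars ℝ) :=
    (mulOp_injective hω.bdd_bw (bw_ne_zero _)).comp (mulOp_injective hω.bdd_bw (bw_ne_zero _))
  intro t ht
  have h1 := hasDerivWithinAt_of_injective hinj
    (x := fun τ ↦ mulOp (cosSym (waveFreq l) τ) (A τ) - mulOp (sigmaSym κ (waveFreq l) τ) (Z τ))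
    (x' := fun τ ↦ mulOp (sigmaSym κ (waveFreq l) τ) (w τ))
    (fun t ht ↦ (hcomp t ht).1) ((hσ.mono hsub).continuousOn hwc) ht
  have h2 := hasDerivWithinAt_of_injective hinj
    (x := fun τ ↦ mulOp (relFreq κ (waveFreq l)) (mulOp (sinSym (waveFreq l) τ) (A τ)) +
      mulOp (cosSym (waveFreq l) τ) (Z τ))
    (x' := fun τ ↦ -mulOp (cosSym (waveFreq l) τ) (w τ))
    (fun t ht ↦ (hcomp t ht).2) ((hω.family_cos _).continuousOn hwc).neg ht
  rw [field, hω.position_coefficients (hsub ht)]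
  exact h1.prodMk h2

/-- Two solutions on the same interval of length at most `1` agree. -/
lemma IsSolution.eq (hl : ∀ ξ, 0 ≤ l ξ)
    (hω : Dispersion (1 + ρ / 2) (waveFreq l) (forcingSym (1 + ρ / 2) b)) (hs : 1 / 2 < s)
    (hg : ContDiff ℝ ((⌊s⌋₊ + 1 : ℕ) : ℕ∞) g) {φ ψ : 𝓢'(ℝ, ℂ)} {T : ℝ} (hT0 : 0 ≤ T) (hT : T ≤ 1)
    {u v : ℝ → 𝓢'(ℝ, ℂ)} (hu : IsSolution l b g ρ s φ ψ T u)
    (hv : IsSolution l b g ρ s φ ψ T v) {t : ℝ} (ht : t ∈ Icc 0 T) : u t = v t := by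
  have hsub : Icc 0 T ⊆ Icc (0 : ℝ) 1 := Icc_subset_Icc_right hT
  obtain ⟨A, Z, M₁, huA, hφ, hψ, hode⟩ := hu.exists_coefficients hl hω hs hg hT0 hT
  obtain ⟨A', Z', M₂, hvA, hφ', hψ', hode'⟩ := hv.exists_coefficients hl hω hs hg hT0 hT
  have hg1 : ContDiff ℝ 1 g := contDiff_one_of_floor hg
  have hM : 0 ≤ max 0 (max M₁ M₂) := le_max_left _ _
  obtain ⟨L, hL⟩ := exists_lipschitzOnWith hg1 (max 0 (max M₁ M₂))
  have hG := lipschitzWith_truncNl hM hL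
  have h0 := truncNl_zero g hM
  obtain ⟨Λ, hΛ⟩ := hω.exists_lipschitzWith_field hG h0
  have hd := hode _ L hG h0 ((le_max_left _ _).trans (le_max_right _ _))
  have hd' := hode' _ L hG h0 ((le_max_right _ _).trans (le_max_right _ _))
  have hright : ∀ {y : ℝ → L2C × L2C} {y' : L2C × L2C} {τ : ℝ}, τ ∈ Ico 0 T →
      HasDerivWithinAt y y' (Icc 0 T) τ → HasDerivWithinAt y y' (Ici τ) τ := fun hτ h ↦
    h.mono_of_mem_nhdsWithin (Icc_mem_nhdsGE_of_mem hτ)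
  have h00 : A 0 = A' 0 := ofWeighted_injective _ (hφ.symm.trans hφ')
  have h01 : Z 0 = Z' 0 := ofWeighted_injective _ (hψ.symm.trans hψ')
  have key := ODE_solution_unique_of_mem_Icc_right (s := fun _ ↦ univ)
    (fun τ hτ ↦ (hΛ τ (hsub ⟨hτ.1, hτ.2.le⟩)).lipschitzOnWith)
    (fun τ hτ ↦ (hd τ hτ).continuousWithinAt)
    (fun τ hτ ↦ hright hτ (hd τ ⟨hτ.1, hτ.2.le⟩)) (fun _ _ ↦ mem_univ _)
    (fun τ hτ ↦ (hd' τ hτ).continuousWithinAt)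
    (fun τ hτ ↦ hright hτ (hd' τ ⟨hτ.1, hτ.2.le⟩)) (fun _ _ ↦ mem_univ _)
    (by simp only [h00, h01]) ht
  have h1 := congrArg (position (1 + ρ / 2) (waveFreq l) t) key
  simp only [hω.position_coefficients (hsub ht)] at h1
  rw [huA t ht, hvA t ht, h1]

/-- Local existence of a solution. -/
lemma exists_isSolution (hl : ∀ ξ, 0 ≤ l ξ)
    (hω : Dispersion (1 + ρ / 2) (waveFreq l) (forcingSym (1 + ρ / 2) b)) (hs : 1 / 2 < s)
    (hg : ContDiff ℝ ((⌊s⌋₊ + 1 : ℕ) : ℕ∞) g) {φ ψ : 𝓢'(ℝ, ℂ)}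
    (hφ : TemperedDistribution.MemSobolev s 2 φ) (hφ_real : IsReal φ)
    (hψ : TemperedDistribution.MemSobolev (s - 1 - ρ / 2) 2 ψ) (hψ_real : IsReal ψ) :
    ∃ T : ℝ, 0 < T ∧ T ≤ 1 ∧ ∃ u : ℝ → 𝓢'(ℝ, ℂ), IsSolution l b g ρ s φ ψ T u := by
  set κ : ℝ := 1 + ρ / 2 with hκ
  set ω : ℝ → ℝ := waveFreq l with hω'
  have hs0 : 0 ≤ s := by linarith
  have hbw := bddSymbol_bw (s := -s) (by linarith)
  have hJ := hω.bdd_bw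
  have hJneg : -κ ≤ 0 := by linarith [hω.exponent_nonneg]
  obtain ⟨U₀, hU₀⟩ := hφ
  obtain ⟨V₀, hV₀⟩ := hψ
  have hφe : φ = ofWeighted (-s) (𝓕 U₀) := eq_ofWeighted_of_besselPotential hU₀
  have hψe : ψ = ofWeighted (-(s - 1 - ρ / 2)) (𝓕 V₀) :=
    eq_ofWeighted_of_besselPotential hV₀
  obtain ⟨T, hT0, hT1, M, L, hG, h0, y, BP, BR, hy0, hyd, hyB, hBP, hBR, hdag, hsup⟩ :=
    hω.exists_solution hs hg (b₀ := 𝓕 U₀) (b₁ := 𝓕 V₀)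
      (isReal_ofWeighted_iff.1 (hφe ▸ hφ_real)) (isReal_ofWeighted_iff.1 (hψe ▸ hψ_real))
  have hsub : Icc 0 T ⊆ Icc (0 : ℝ) 1 := Icc_subset_Icc_right hT1
  have hF : Continuous (fun x : L2C ↦ (𝓕⁻ x : L2C)) := (fourierInvCLM ℂ L2C).continuous
  -- the lifts of the position and the velocity by the Bessel potential of order `s`
  let BA : ℝ → L2C := fun t ↦ position κ ω t (BP t, BR t)
  let BZ : ℝ → L2C := fun t ↦ velocity κ ω t (BP t, BR t)
  have hBA : ContinuousOn BA (Icc 0 T) := hω.continuousOn_position hT1 hBP hBR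
  have hBZ : ContinuousOn BZ (Icc 0 T) := hω.continuousOn_velocity hBP hBR
  have hBAe : ∀ t ∈ Icc 0 T, mulOp (bw (-s)) (BA t) = position κ ω t (y t) := fun t ht ↦ by
    simp only [BA, position]
    rw [hyB t ht, map_add, mulOp_comm hbw (hω.bdd_cos t), mulOp_comm hbw (hω.bdd_sigma (hsub ht))]
  have hBZe : ∀ t ∈ Icc 0 T, mulOp (bw (-s)) (BZ t) = velocity κ ω t (y t) := fun t ht ↦ by
    simp only [BZ, velocity]
    rw [hyB t ht, map_sub, mulOp_comm hbw (hω.bdd_cos t), mulOp_comm hbw hω.bdd_relFreq,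
      mulOp_comm hbw (hω.bdd_sin t)]
  have hdpos := fun t (ht : t ∈ Icc 0 T) ↦
    hω.hasDerivWithinAt_position hT1 ht (hyd t ht).fst (hyd t ht).snd
  have hdvel := fun t (ht : t ∈ Icc 0 T) ↦
    hω.hasDerivWithinAt_velocity hT1 ht (hyd t ht).fst (hyd t ht).snd
  have hdB : ∀ t ∈ Icc 0 T, HasDerivWithinAt (fun τ ↦ mulOp (bw (-κ)) (BA τ)) (BZ t) (Icc 0 T) t := by
    intro t ht
    refine hasDerivWithinAt_of_injective (A := (mulOp (bw (-s))).restrictScalars ℝ)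
      (mulOp_injective hbw (bw_ne_zero _)) (x := fun τ ↦ mulOp (bw (-κ)) (BA τ)) (x' := BZ)
      (fun t ht ↦ ?_) hBZ ht
    have e : ∀ τ ∈ Icc 0 T, mulOp (bw (-s)) (mulOp (bw (-κ)) (BA τ)) =
        mulOp (bw (-κ)) (position κ ω τ (y τ)) := fun τ hτ ↦ by
      rw [mulOp_comm hbw hJ, hBAe τ hτ]
    exact ((hdpos t ht).congr e (e t ht)).congr_deriv (hBZe t ht).symm
  refine ⟨T, hT0, hT1, fun t ↦ ofWeighted 0 (position κ ω t (y t)),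
    fun t ht ↦ isReal_ofWeighted_iff.2 (hdag t ht),
    ⟨fun t ↦ 𝓕⁻ (BA t), fun t ht ↦ ?_, hF.comp_continuousOn hBA⟩,
    fun t ↦ ofWeighted κ (velocity κ ω t (y t)),
    ⟨fun t ↦ 𝓕⁻ (mulOp (bw (-κ)) (BA t)), fun t ↦ 𝓕⁻ (BZ t), fun t ht ↦ ?_, fun t ht ↦ ?_,
      fun t ht ↦ ?_, hF.comp_continuousOn hBZ⟩, ?_, ?_, fun t ht ↦ ?_⟩
  · apply besselPotential_eq_of_eq_ofWeighted
    beta_reduce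
    rw [← hBAe t ht, ofWeighted_mulOp _ (by linarith), zero_add]
  · apply besselPotential_eq_of_eq_ofWeighted
    beta_reduce
    rw [ofWeighted_mulOp _ hJneg, ← hBAe t ht, ofWeighted_mulOp _ (by linarith)]
    congr 2
    rw [hκ]
    ring
  · apply besselPotential_eq_of_eq_ofWeighted
    beta_reduce
    rw [← hBZe t ht, ofWeighted_mulOp _ (by linarith)]
    congr 2
    rw [hκ]
    ring
  · exact ((fourierInvCLM ℂ L2C).restrictScalars ℝ).hasFDerivAt.comp_hasDerivWithinAt t (hdB t ht)
  · beta_reduce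
    rw [position_zero, hy0, ofWeighted_mulOp _ (by linarith), zero_add, ← hφe]
  · beta_reduce
    rw [velocity_zero, hy0, ofWeighted_mulOp _ (by linarith), hψe]
    congr 2
    rw [hκ]
    ring
  · have ht' : t ∈ Icc 0 T := ⟨ht.1.le, ht.2⟩
    rw [satisfiesEquationAt_iff hl hω hG h0 rfl (hdag t ht') (hsup t ht')]
    intro η
    have e : ∀ τ, ofWeighted κ (velocity κ ω τ (y τ)) =
        ofWeighted (2 * κ) (mulOp (bw (-κ)) (velocity κ ω τ (y τ))) := fun τ ↦ by
      rw [ofWeighted_mulOp _ hJneg]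
      congr 2
      ring
    have h1 := ((ofWeightedEval (2 * κ) η).restrictScalars ℝ).hasFDerivAt.comp_hasDerivWithinAt t
      (hdvel t ht')
    refine HasDerivWithinAt.congr h1 (fun τ _ ↦ ?_) ?_
    · rw [e]
      rfl
    · rw [e]
      rfl

end Solutions

end NonlocalWave

theorem theorem6p1
    (ρ r : ℝ) (hρ : 0 ≤ ρ) (hr : 0 ≤ r)
    (l b : ℝ → ℝ) (hl_meas : Measurable l) (hb_meas : Measurable b)
    (hl_even : ∀ ξ, l (-ξ) = l ξ) (hb_even : ∀ ξ, b (-ξ) = b ξ)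
    (c₁ c₂ c₃ : ℝ) (hc₁ : 0 < c₁) (hc₂ : 0 < c₂) (hc₃ : 0 < c₃)
    (hl : ∀ ξ, c₁ ^ 2 * (1 + ξ ^ 2) ^ (ρ / 2) ≤ l ξ ∧ l ξ ≤ c₂ ^ 2 * (1 + ξ ^ 2) ^ (ρ / 2))
    (hb : ∀ ξ, 0 < b ξ ∧ b ξ ≤ c₃ ^ 2 * (1 + ξ ^ 2) ^ (-r / 2))
    (hρr : 1 ≤ ρ / 2 + r)
    (s : ℝ) (hs : 1 / 2 < s)
    (φ ψ : 𝓢'(ℝ, ℂ))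
    (hφ : TemperedDistribution.MemSobolev s 2 φ) (hφ_real : NonlocalWave.IsReal φ)
    (hψ : TemperedDistribution.MemSobolev (s - 1 - ρ / 2) 2 ψ) (hψ_real : NonlocalWave.IsReal ψ)
    (g : ℝ → ℝ) (hg : ContDiff ℝ ((⌊s⌋₊ + 1 : ℕ) : ℕ∞) g) :
    ∃ T : ℝ, 0 < T ∧ ∃ u : ℝ → 𝓢'(ℝ, ℂ),
      NonlocalWave.IsSolution l b g ρ s φ ψ T u ∧
      ∀ v : ℝ → 𝓢'(ℝ, ℂ), NonlocalWave.IsSolution l b g ρ s φ ψ T v →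
        ∀ t ∈ Set.Icc 0 T, v t = u t := by
  have hl0 : ∀ ξ, 0 ≤ l ξ := fun ξ ↦ le_trans (by positivity) (hl ξ).1
  have hω := NonlocalWave.dispersion_waveFreq hρ hr hl_meas hb_meas hl_even hb_even hc₁ hc₂ hl hb
    hρr
  obtain ⟨T, hT0, hT1, u, hu⟩ :=
    NonlocalWave.exists_isSolution hl0 hω hs hg hφ hφ_real hψ hψ_real
  exact ⟨T, hT0, u, hu, fun v hv t ht ↦ hv.eq hl0 hω hs hg hT0.le hT1 hu ht⟩
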